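/- **Setting.** Let $J\in\mathbb R^{3\times3}$ be symmetric positive definite, let $b_1,b_2\in\mathbb R^3$ be orthonormal, and let $R_d:[0,\infty)\to SO(3)$ be smooth with $\dot R_d=\hat\omega_dR_d$ and $\omega_d:[0,\infty)\to\mathbb R^3$ bounded, where $\hat xy=x\times y$. Put $r_{d_i}=R_db_i$ for $i=1,2$. Consider the rigid body $$J\dot\Omega+\Omega\times J\Omega=u,\qquad \dot R=R\hat\Omega,\qquad (R,\Omega)\in SO(3)\times\mathbb R^3,\qquad \omega=R\Omega .$$ **Controller.** For $i=1,2$ let $\Psi_{N_i}=1-Rb_i\cdot r_{d_i}$ and $\Psi_{E_i}=\alpha+\beta\,Rb_i\cdot(r_{d_1}\times r_{d_2})$. For the modes $\mathbf m\in\{I,II,III\}$ let $$\Psi_I=k_1\Psi_{N_1}+k_2\Psi_{N_2},\quad \Psi_{II}=k_1\Psi_{N_1}+k_2\Psi_{E_2},\quad \Psi_{III}=k_1\Psi_{E_1}+k_2\Psi_{N_2},\qquad \rho=\min_{\mathbf m}\Psi_{\mathbf m}.$$ The state $(R,\Omega,\mathbf m)$ may flow with constant $\mathbf m$ while $\Psi_{\mathbf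 m}-\rho\le\delta$, and may jump when $\Psi_{\mathbf m}-\rho\ge\delta$; at a jump $(R,\Omega)$ is unchanged and the new mode is any element of $\{\mathbf m:\Psi_{\mathbf m}=\rho\}$. During flow $$u=-e_H-k_\Omega e_\Omega+(R^T\omega_d)^\wedge JR^T\omega_d+JR^T\dot\omega_d,\qquad e_\Omega=\Omega-R^T\omega_d,\qquad e_H=k_1e_{H_1}+k_2e_{H_2},$$ where $e_{H_1}=R^Tr_{d_1}\times b_1$ in modes $I,II$ and $e_{H_1}=-\beta\,(R^T(r_{d_1}\times r_{d_2}))\times b_1$ in mode $III$, while $e_{H_2}=R^Tr_{d_2}\times b_2$ in modes $I,III$ and $e_{H_2}=-\beta\,(R^T(r_{d_1}\times r_{d_2}))\times b_2$ in mode $II$. Solutions are hybrid arcs parametrized by $(t,j)$, where $t$ is time and $j$ is the number of jumps so far. **Proposition 3.** Let $k_1,k_2,k_\Omega>0$, $k_1\ne k_2$, $1<\alpha<2$, $0<|\beta|<\alpha-1$ and $$0<\delta<\min\{k_1,k_2\}\,\min\{2-\alpha,\ \alpha-|\beta|-1\}.$$ Then the desired trajectory $(R_d,\omega_d)$ is globally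 exponentially stable for the hybrid closed loop. That is: from every initial time $t_0\ge0$ and every initial state $(R_0,\Omega_0,\mathbf m_0)\in SO(3)\times\mathbb R^3\times\{I,II,III\}$ there is a solution that exists for all $t\ge t_0$; every maximal solution exists for all $t\ge t_0$; and there are constants $M,\lambda>0$, independent of the initial time and the initial state, such that every solution satisfies, at all $(t,j)$ in its domain, $$\|R-R_d\|_F+\|\omega-\omega_d\|\ \Big|_{(t,j)}\ \le\ M e^{-\lambda(t-t_0)}\Big(\|R-R_d\|_F+\|\omega-\omega_d\|\Big)\Big|_{(t_0,0)} .$$ -/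

import Mathlib

open scoped Matrix ContDiff

noncomputable section

namespace AttitudeTracking

/-- Column vectors of `ℝ³`; the Euclidean norm is `eucNorm` below. -/
abbrev Vec3 := Fin 3 → ℝ

abbrev Mat3 := Matrix (Fin 3) (Fin 3) ℝ

/-- The rotation group `{R | RᵀR = I, det R = 1}`. -/
abbrev SO3 : Submonoid Mat3 := Matrix.specialOrthogonalGroup (Fin 3) ℝ

/-- The Euclidean norm on `ℝ³`. -/
def eucNorm (x : Vec3) : ℝ := Real.sqrt (x ⬝ᵥ x)

/-- The Frobenius norm on `3 × 3` matrices. -/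
def frobNorm (A : Mat3) : ℝ := Real.sqrt (Aᵀ * A).trace

/-- The hat map: `hat x *ᵥ y = x ⨯₃ y`. -/
def hat (x : Vec3) : Mat3 :=
  !![0, -x 2, x 1; x 2, 0, -x 0; -x 1, x 0, 0]

theorem hat_mulVec (x y : Vec3) : hat x *ᵥ y = x ⨯₃ y := by
  ext i
  fin_cases i <;> simp [hat, Matrix.mulVec, dotProduct, Fin.sum_univ_three, crossProduct] <;> ring

/-- The discrete modes: `I` nominal, `II` and `III` expelling. -/
inductive Mode
  | I
  | II
  | III

/-- State of the hybrid closed loop: attitude, body angular velocity, discrete mode. -/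
structure State where
  R : Mat3
  Ω : Vec3
  m : Mode

/-- A desired trajectory: attitude and angular velocity in the inertial frame. -/
structure Reference where
  Rd : ℝ → Mat3
  ωd : ℝ → Vec3

/-- `ref` is a smooth curve `[0, ∞) → SO(3)` with `dRd/dt = hat ωd * Rd` and bounded `ωd`.
Smoothness and derivatives of matrix-valued curves are taken entrywise. -/
structure Reference.IsAdmissible (ref : Reference) : Prop where
  mem_SO3 : ∀ t, 0 ≤ t → ref.Rd t ∈ SO3
  smooth : ∀ i j, ContDiffOn ℝ ∞ (fun t => ref.Rd t i j) (Set.Ici 0)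
  kinematics : ∀ t, 0 ≤ t → ∀ i j,
    HasDerivWithinAt (fun s => ref.Rd s i j) ((hat (ref.ωd t) * ref.Rd t) i j) (Set.Ici 0) t
  bounded : ∃ B, ∀ t, 0 ≤ t → eucNorm (ref.ωd t) ≤ B

/-- Inertia matrix, body-fixed directions, gains and switching parameters. -/
structure Params where
  J : Mat3
  b₁ : Vec3
  b₂ : Vec3
  k₁ : ℝ
  k₂ : ℝ
  kΩ : ℝ
  α : ℝ
  β : ℝ
  δ : ℝ

section Controller

variable (p : Params) (ref : Reference)

/-- Desired directions. -/
def rd₁ (t : ℝ) : Vec3 := ref.Rd t *ᵥ p.b₁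

def rd₂ (t : ℝ) : Vec3 := ref.Rd t *ᵥ p.b₂

/-- Nominal configuration error functions. -/
def ΨN₁ (t : ℝ) (R : Mat3) : ℝ := 1 - (R *ᵥ p.b₁) ⬝ᵥ rd₁ p ref t

def ΨN₂ (t : ℝ) (R : Mat3) : ℝ := 1 - (R *ᵥ p.b₂) ⬝ᵥ rd₂ p ref t

/-- Expelling configuration error functions. -/
def ΨE₁ (t : ℝ) (R : Mat3) : ℝ :=
  p.α + p.β * ((R *ᵥ p.b₁) ⬝ᵥ (rd₁ p ref t ⨯₃ rd₂ p ref t))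

def ΨE₂ (t : ℝ) (R : Mat3) : ℝ :=
  p.α + p.β * ((R *ᵥ p.b₂) ⬝ᵥ (rd₁ p ref t ⨯₃ rd₂ p ref t))

/-- Configuration error function of each mode. -/
def Ψ (t : ℝ) (R : Mat3) : Mode → ℝ
  | .I => p.k₁ * ΨN₁ p ref t R + p.k₂ * ΨN₂ p ref t R
  | .II => p.k₁ * ΨN₁ p ref t R + p.k₂ * ΨE₂ p ref t R
  | .III => p.k₁ * ΨE₁ p ref t R + p.k₂ * ΨN₂ p ref t R

/-- The minimum of the configuration error functions over the three modes. -/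
def ρ (t : ℝ) (R : Mat3) : ℝ :=
  min (Ψ p ref t R .I) (min (Ψ p ref t R .II) (Ψ p ref t R .III))

/-- The set-valued jump map: the modes of minimal configuration error. -/
def jumpMap (t : ℝ) (R : Mat3) : Set Mode := {m | Ψ p ref t R m = ρ p ref t R}

/-- The jump set at time `t`. -/
def jumpSet (t : ℝ) : Set State := {x | p.δ ≤ Ψ p ref t x.R x.m - ρ p ref t x.R}

/-- The flow set at time `t`. -/
def flowSet (t : ℝ) : Set State := {x | Ψ p ref t x.R x.m - ρ p ref t x.R ≤ p.δ}

/-- Angular velocity error. -/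
def eΩ (t : ℝ) (x : State) : Vec3 := x.Ω - x.Rᵀ *ᵥ ref.ωd t

/-- Hybrid configuration error vectors. -/
def eH₁ (t : ℝ) (x : State) : Vec3 :=
  match x.m with
  | .I | .II => (x.Rᵀ *ᵥ rd₁ p ref t) ⨯₃ p.b₁
  | .III => -(p.β • ((x.Rᵀ *ᵥ (rd₁ p ref t ⨯₃ rd₂ p ref t)) ⨯₃ p.b₁))

def eH₂ (t : ℝ) (x : State) : Vec3 :=
  match x.m with
  | .I | .III => (x.Rᵀ *ᵥ rd₂ p ref t) ⨯₃ p.b₂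
  | .II => -(p.β • ((x.Rᵀ *ᵥ (rd₁ p ref t ⨯₃ rd₂ p ref t)) ⨯₃ p.b₂))

def eH (t : ℝ) (x : State) : Vec3 := p.k₁ • eH₁ p ref t x + p.k₂ • eH₂ p ref t x

/-- The control moment. -/
def control (t : ℝ) (x : State) : Vec3 :=
  -eH p ref t x - p.kΩ • eΩ ref t x
    + hat (x.Rᵀ *ᵥ ref.ωd t) *ᵥ (p.J *ᵥ (x.Rᵀ *ᵥ ref.ωd t))
    + p.J *ᵥ (x.Rᵀ *ᵥ derivWithin ref.ωd (Set.Ici 0) t)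

end Controller

/-- Hybrid time domains with initial time `t₀`: subsets `E` of `ℝ × ℕ` whose truncation at each
`(T, N) ∈ E` is `⋃_{j ≤ N} [τ j, τ (j+1)] × {j}` with `t₀ = τ 0 ≤ τ 1 ≤ … ≤ τ (N+1)`; equivalently
`E` is a finite or infinite union of such consecutive intervals, where a last interval may also be
`[τ j, T)` with `T ≤ ∞`. The field `ordered` excludes branching domains. -/
structure IsHybridTimeDomain (t₀ : ℝ) (E : Set (ℝ × ℕ)) : Prop where
  nonempty : E.Nonempty
  ordered : ∀ s i t j, (s, i) ∈ E → (t, j) ∈ E → i < j → s ≤ t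
  truncation : ∀ T N, (T, N) ∈ E → ∃ τ : ℕ → ℝ, τ 0 = t₀ ∧ (∀ j ≤ N, τ j ≤ τ (j + 1)) ∧
    ∀ t j, ((t, j) ∈ E ∧ t ≤ T ∧ j ≤ N) ↔ (j ≤ N ∧ t ∈ Set.Icc (τ j) (τ (j + 1)))

/-- The times at which exactly `j` jumps have occurred. -/
def timeSlice (E : Set (ℝ × ℕ)) (j : ℕ) : Set ℝ := {t | (t, j) ∈ E}

/-- `x`, restricted to `E`, is a solution with initial time `t₀` of the hybrid closed loop: the
disturbance-free rigid body under the hybrid controller. -/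
structure IsSolution (p : Params) (ref : Reference) (t₀ : ℝ) (E : Set (ℝ × ℕ))
    (x : ℝ → ℕ → State) : Prop where
  domain : IsHybridTimeDomain t₀ E
  mem_SO3 : ∀ t j, (t, j) ∈ E → (x t j).R ∈ SO3
  mode_const : ∀ s t j, (s, j) ∈ E → (t, j) ∈ E → (x s j).m = (x t j).m
  mem_flowSet : ∀ t j, t ∈ interior (timeSlice E j) → x t j ∈ flowSet p ref t
  kinematics : ∀ t j, (t, j) ∈ E → ∀ a b,
    HasDerivWithinAt (fun s => (x s j).R a b) (((x t j).R * hat (x t j).Ω) a b)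
      (timeSlice E j) t
  dynamics : ∀ t j, (t, j) ∈ E → ∃ Ω' : Vec3,
    HasDerivWithinAt (fun s => (x s j).Ω) Ω' (timeSlice E j) t ∧
      p.J *ᵥ Ω' + (x t j).Ω ⨯₃ (p.J *ᵥ (x t j).Ω) = control p ref t (x t j)
  jump : ∀ t j, (t, j) ∈ E → (t, j + 1) ∈ E →
    x t j ∈ jumpSet p ref t ∧ (x t (j + 1)).R = (x t j).R ∧ (x t (j + 1)).Ω = (x t j).Ω ∧
      (x t (j + 1)).m ∈ jumpMap p ref t (x t j).R

/-- A solution that has no proper extension. -/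
def IsMaximalSolution (p : Params) (ref : Reference) (t₀ : ℝ) (E : Set (ℝ × ℕ))
    (x : ℝ → ℕ → State) : Prop :=
  IsSolution p ref t₀ E x ∧
    ∀ E' x', IsSolution p ref t₀ E' x' → E ⊆ E' → (∀ t j, (t, j) ∈ E → x' t j = x t j) → E' = E

/-- The domain contains arbitrarily large times. -/
def TimeUnbounded (E : Set (ℝ × ℕ)) : Prop := ∀ T : ℝ, ∃ t j, (t, j) ∈ E ∧ T ≤ t

/-- The tracking error `‖R - Rd‖ + ‖ω - ωd‖`, with `ω = RΩ` the inertial angular velocity. -/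
def trackingError (ref : Reference) (t : ℝ) (x : State) : ℝ :=
  frobNorm (x.R - ref.Rd t) + eucNorm (x.R *ᵥ x.Ω - ref.ωd t)

/-- Global exponential stability of `(R, ω) = (Rd, ωd)` for the time-varying hybrid closed loop:
from every initial time, attitude, angular velocity and mode there is a solution for all future
times; no maximal solution ends in finite time (by escape, by getting stuck, or by accumulating
jumps); and the tracking error decays exponentially along every solution, uniformly in the initial
time and the initial state. -/
def GloballyExponentiallyStable (p : Params) (ref : Reference) : Prop :=
  (∀ t₀, 0 ≤ t₀ → ∀ x₀ : State, x₀.R ∈ SO3 →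
    ∃ E x, IsSolution p ref t₀ E x ∧ x t₀ 0 = x₀ ∧ TimeUnbounded E) ∧
  (∀ t₀, 0 ≤ t₀ → ∀ E x, IsMaximalSolution p ref t₀ E x → TimeUnbounded E) ∧
  ∃ M > 0, ∃ lam > 0, ∀ t₀, 0 ≤ t₀ → ∀ E x, IsSolution p ref t₀ E x → ∀ t j, (t, j) ∈ E →
    trackingError ref t (x t j) ≤
      M * Real.exp (-lam * (t - t₀)) * trackingError ref t₀ (x t₀ 0)

end AttitudeTracking

end

noncomputable section

namespace AttitudeTracking

/-! ### Configuration errors in the frame of the body-fixed directions -/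

/-! In the orthonormal frame `b₁, b₂, b₁ ⨯₃ b₂` the closed loop becomes a system for an attitude
error `P` in SO(3) and a velocity error `e`, with `P' = P * hat e` and `K e' = errorTorque`; the
reference enters only through a bounded velocity `c`. The configuration errors are affine in the
entries of `P`, and `eH` turns into their left-trivialized gradient `h`. Gyroscopic terms do no
work, so the energy (kinetic part `E` plus potential `Ψ`) decays at rate `kΩ |e|²` along flows and
falls by at least `δ` at jumps. Hence each solution jumps finitely often and no flow escapes in
finite time; existence and completeness follow by flowing until a jump is due, jumping, and
repeating.

The dissipation does not see `Ψ`, so exponential decay needs the cross term `κ (h · K e) / (1 + E)`,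
whose derivative contributes `-κ |h|² / (1 + E)`. This is enough because `Ψ ≤ C |h|²` in the flow
set (`exists_modePotential_le_gradient_sq`), and here the switching logic acts. Since `k₁ ≠ k₂`, a
critical point of the nominal mode has `P 0 0` and `P 1 1` equal to `1` or `-1`; if one of them is
`-1`, an expelling mode is lower by more than `δ`, so the point lies outside the flow set. An
expelling mode may flow only where `P 1 1` or `P 0 0` is at most some `-g < 0`, and there its
gradient is bounded away from zero.

The division by `1 + E` keeps the cross term bounded, so for small `κ` its change at a jump is paid
by the energy drop `δ`, however large `e` is. The decay rate stays uniform because `|h|²` is at most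
`|h|² / (1 + E)` plus a multiple of `|e|²`. Both facts are packaged in `exists_isLyapunovWeight`.

The energy dominates the squared tracking error everywhere, but is dominated by it only in the flow
set. A solution that starts outside the flow set cannot flow: it is a single point or jumps at once,
and the jump lands in the flow set without changing the tracking error. -/

/-- The configuration error function of a mode as a function of the attitude error matrix, expressed
in the orthonormal frame `b₁, b₂, b₁ ⨯₃ b₂`. -/
def modePotential (p : Params) (m : Mode) (P : Mat3) : ℝ :=
  match m with
  | .I => p.k₁ * (1 - P 0 0) + p.k₂ * (1 - P 1 1)
  | .II => p.k₁ * (1 - P 0 0) + p.k₂ * (p.α + p.β * P 2 1)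
  | .III => p.k₁ * (p.α + p.β * P 2 0) + p.k₂ * (1 - P 1 1)

/-- The left-trivialized gradient of `modePotential`. -/
def modeGradient (p : Params) (m : Mode) (P : Mat3) : Vec3 :=
  match m with
  | .I => ![-p.k₂ * P 1 2, p.k₁ * P 0 2, -p.k₁ * P 0 1 + p.k₂ * P 1 0]
  | .II => ![p.k₂ * p.β * P 2 2, p.k₁ * P 0 2, -p.k₁ * P 0 1 - p.k₂ * p.β * P 2 0]
  | .III => ![-p.k₂ * P 1 2, -p.k₁ * p.β * P 2 2, p.k₁ * p.β * P 2 1 + p.k₂ * P 1 0]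

/-- The minimum of `modePotential` over the modes. -/
def minPotential (p : Params) (P : Mat3) : ℝ :=
  min (modePotential p .I P) (min (modePotential p .II P) (modePotential p .III P))

/-- The hypotheses on the gains and on the switching parameters. -/
structure Params.Tuned (p : Params) : Prop where
  k₁_pos : 0 < p.k₁
  k₂_pos : 0 < p.k₂
  k_ne : p.k₁ ≠ p.k₂
  kΩ_pos : 0 < p.kΩ
  one_lt_α : 1 < p.α
  α_lt_two : p.α < 2
  β_ne_zero : p.β ≠ 0
  abs_β_lt : |p.β| < p.α - 1
  δ_pos : 0 < p.δ
  δ_lt : p.δ < min p.k₁ p.k₂ * min (2 - p.α) (p.α - |p.β| - 1)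

theorem minPotential_le (p : Params) (P : Mat3) (m : Mode) :
    minPotential p P ≤ modePotential p m P := by
  unfold minPotential
  cases m
  · exact min_le_left _ _
  · exact (min_le_right _ _).trans (min_le_left _ _)
  · exact (min_le_right _ _).trans (min_le_right _ _)

theorem exists_modePotential_eq_minPotential (p : Params) (P : Mat3) :
    ∃ m, modePotential p m P = minPotential p P := by
  unfold minPotential
  rcases min_choice (modePotential p .I P)
    (min (modePotential p .II P) (modePotential p .III P)) with h | h
  · exact ⟨.I, h.symm⟩
  · rw [h]
    rcases min_choice (modePotential p .II P) (modePotential p .III P) with h | h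
    · exact ⟨.II, h.symm⟩
    · exact ⟨.III, h.symm⟩

/-! ### Rotation matrices -/

theorem SO3.mul_transpose {P : Mat3} (hP : P ∈ SO3) : P * Pᵀ = 1 := by
  have := (Matrix.mem_specialOrthogonalGroup_iff.1 hP).1
  exact (Matrix.mem_orthogonalGroup_iff (Fin 3) ℝ).1 this

theorem SO3.transpose_mul {P : Mat3} (hP : P ∈ SO3) : Pᵀ * P = 1 := by
  have := (Matrix.mem_specialOrthogonalGroup_iff.1 hP).1
  exact (Matrix.mem_orthogonalGroup_iff' (Fin 3) ℝ).1 this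

theorem SO3.det_eq_one {P : Mat3} (hP : P ∈ SO3) : P.det = 1 :=
  (Matrix.mem_specialOrthogonalGroup_iff.1 hP).2

theorem mem_SO3_iff {P : Mat3} : P ∈ SO3 ↔ P * Pᵀ = 1 ∧ P.det = 1 := by
  refine ⟨fun h => ⟨SO3.mul_transpose h, SO3.det_eq_one h⟩, fun h => ?_⟩
  exact Matrix.mem_specialOrthogonalGroup_iff.2
    ⟨(Matrix.mem_orthogonalGroup_iff (Fin 3) ℝ).2 h.1, h.2⟩

theorem SO3.transpose_mem {P : Mat3} (hP : P ∈ SO3) : Pᵀ ∈ SO3 := by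
  rw [mem_SO3_iff]
  exact ⟨by simpa using SO3.transpose_mul hP, by simpa using SO3.det_eq_one hP⟩

theorem SO3.row_sq {P : Mat3} (hP : P ∈ SO3) (i : Fin 3) :
    P i 0 ^ 2 + P i 1 ^ 2 + P i 2 ^ 2 = 1 := by
  have := congrFun (congrFun (SO3.mul_transpose hP) i) i
  simp only [Matrix.mul_apply, Fin.sum_univ_three, Matrix.transpose_apply, Matrix.one_apply_eq]
    at this
  linarith

theorem SO3.col_sq {P : Mat3} (hP : P ∈ SO3) (i : Fin 3) :
    P 0 i ^ 2 + P 1 i ^ 2 + P 2 i ^ 2 = 1 := by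
  simpa using SO3.row_sq (SO3.transpose_mem hP) i

theorem SO3.abs_apply_le {P : Mat3} (hP : P ∈ SO3) (i j : Fin 3) : |P i j| ≤ 1 := by
  have h := SO3.row_sq hP i
  rw [← sq_le_one_iff_abs_le_one]
  fin_cases j <;> simp only [Fin.zero_eta, Fin.mk_one, Fin.reduceFinMk] <;>
    nlinarith [sq_nonneg (P i 0), sq_nonneg (P i 1), sq_nonneg (P i 2)]

/-- A rotation matrix is its own cofactor matrix; this is the last entry. -/
theorem SO3.apply_two_two {P : Mat3} (hP : P ∈ SO3) :
    P 2 2 = P 0 0 * P 1 1 - P 0 1 * P 1 0 := by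
  have h2 := SO3.det_eq_one hP
  have h : Pᵀ = P.adjugate := by
    have h1 := SO3.transpose_mul hP
    calc Pᵀ = Pᵀ * (P * P.adjugate) := by rw [Matrix.mul_adjugate, h2]; simp
      _ = P.adjugate := by rw [← Matrix.mul_assoc, h1, Matrix.one_mul]
  have := congrFun (congrFun h 2) 2
  rw [Matrix.transpose_apply, Matrix.adjugate_fin_three] at this
  simpa using this

theorem SO3.trace_le {P : Mat3} (hP : P ∈ SO3) : P 0 0 + P 1 1 + P 2 2 ≤ 3 := by
  have h0 := (abs_le.1 (SO3.abs_apply_le hP 0 0)).2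
  have h1 := (abs_le.1 (SO3.abs_apply_le hP 1 1)).2
  have h2 := (abs_le.1 (SO3.abs_apply_le hP 2 2)).2
  linarith

/-! ### Static estimates on the configuration errors -/

/-- Since `α - |β| > 1`, an expelling error function exceeds 1 on all of SO(3). Estimates by the
potential in expelling modes thus reduce to a bounded quantity against one bounded below. -/
theorem modePotential_expelling_ge {p : Params} (hp : p.Tuned) {P : Mat3} (hP : P ∈ SO3) :
    p.k₂ ≤ modePotential p .II P ∧ p.k₁ ≤ modePotential p .III P := by
  have h0 := (abs_le.1 (SO3.abs_apply_le hP 0 0)).2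
  have h1 := (abs_le.1 (SO3.abs_apply_le hP 1 1)).2
  have hβ : ∀ x : ℝ, |x| ≤ 1 → 1 ≤ p.α + p.β * x := fun x hx => by
    have : |p.β * x| ≤ |p.β| := by
      rw [abs_mul]; exact mul_le_of_le_one_right (abs_nonneg _) hx
    linarith [(abs_le.1 this).1, hp.abs_β_lt]
  have h2 := hβ _ (SO3.abs_apply_le hP 2 1)
  have h3 := hβ _ (SO3.abs_apply_le hP 2 0)
  have := hp.k₁_pos
  have := hp.k₂_pos
  constructor <;> simp only [modePotential] <;> nlinarith

theorem exists_modePotential_le (p : Params) :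
    ∃ C > 0, ∀ m, ∀ P ∈ SO3, modePotential p m P ≤ C := by
  refine ⟨|p.k₁| * (2 + |p.α| + |p.β|) + |p.k₂| * (2 + |p.α| + |p.β|) + 1, by positivity,
    fun m P hP => ?_⟩
  have key : ∀ k y : ℝ, |y| ≤ 2 + |p.α| + |p.β| → k * y ≤ |k| * (2 + |p.α| + |p.β|) :=
    fun k y hy => (le_abs_self _).trans <| by rw [abs_mul]; gcongr
  have hN : ∀ x : ℝ, |x| ≤ 1 → |1 - x| ≤ 2 + |p.α| + |p.β| := fun x hx => by
    rw [abs_le] at hx ⊢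
    constructor <;> linarith [abs_nonneg p.α, abs_nonneg p.β]
  have hE : ∀ x : ℝ, |x| ≤ 1 → |p.α + p.β * x| ≤ 2 + |p.α| + |p.β| := fun x hx => by
    have := abs_add_le p.α (p.β * x)
    rw [abs_mul] at this
    have h := mul_le_of_le_one_right (abs_nonneg p.β) hx
    linarith
  have h00 := hN _ (SO3.abs_apply_le hP 0 0)
  have h11 := hN _ (SO3.abs_apply_le hP 1 1)
  have h20 := hE _ (SO3.abs_apply_le hP 2 0)
  have h21 := hE _ (SO3.abs_apply_le hP 2 1)
  cases m <;> simp only [modePotential]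
  · linarith [key p.k₁ _ h00, key p.k₂ _ h11]
  · linarith [key p.k₁ _ h00, key p.k₂ _ h21]
  · linarith [key p.k₁ _ h20, key p.k₂ _ h11]

/-- The configuration error functions dominate the squared distance to the identity. -/
theorem exists_trace_le_modePotential {p : Params} (hp : p.Tuned) :
    ∃ C > 0, ∀ m, ∀ P ∈ SO3, 3 - (P 0 0 + P 1 1 + P 2 2) ≤ C * modePotential p m P := by
  have hk₁ := hp.k₁_pos
  have hk₂ := hp.k₂_pos
  -- In the expelling modes `3 - tr P ≤ 6` is compared with the lower bounds `k₂` and `k₁` of the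
  -- potential; the nominal mode needs less.
  refine ⟨6 / p.k₁ + 6 / p.k₂, by positivity, fun m P hP => ?_⟩
  have h00 := abs_le.1 (SO3.abs_apply_le hP 0 0)
  have h11 := abs_le.1 (SO3.abs_apply_le hP 1 1)
  have h22 := abs_le.1 (SO3.abs_apply_le hP 2 2)
  obtain ⟨hII, hIII⟩ := modePotential_expelling_ge hp hP
  have e1 : 6 / p.k₁ * p.k₁ = 6 := by field_simp
  have e2 : 6 / p.k₂ * p.k₂ = 6 := by field_simp
  have n1 : 0 < 6 / p.k₁ := by positivity
  have n2 : 0 < 6 / p.k₂ := by positivity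
  cases m
  · have h := SO3.apply_two_two hP
    have r0 := SO3.row_sq hP 0
    have c0 := SO3.col_sq hP 0
    -- Write `1 - P 2 2 = 1 - P 0 0 * P 1 1 + P 0 1 * P 1 0`. The first difference is at most `(1 -
    -- P 0 0) + (1 - P 1 1)`; row 0 and column 0 bound the last product by `1 - P 0 0 ^ 2 ≤ 2 * (1 -
    -- P 0 0)`.
    have key : 1 - P 2 2 ≤ 3 * (1 - P 0 0) + (1 - P 1 1) := by
      nlinarith [sq_nonneg (P 0 1 - P 1 0), sq_nonneg (P 0 2), sq_nonneg (P 2 0),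
        mul_nonneg (sub_nonneg.2 h00.2) (sub_nonneg.2 h11.2),
        mul_nonneg (sub_nonneg.2 h00.2) (neg_le_iff_add_nonneg.1 h00.1),
        mul_nonneg (sub_nonneg.2 h00.2) (sub_nonneg.2 h00.2), sq_nonneg (P 0 1 + P 1 0)]
    simp only [modePotential]
    have a1 : (6 / p.k₁) * (p.k₁ * (1 - P 0 0)) = 6 * (1 - P 0 0) := by field_simp
    have a2 : (6 / p.k₂) * (p.k₂ * (1 - P 1 1)) = 6 * (1 - P 1 1) := by field_simp
    have a3 : 0 ≤ (6 / p.k₁) * (p.k₂ * (1 - P 1 1)) := by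
      have := sub_nonneg.2 h11.2; positivity
    have a4 : 0 ≤ (6 / p.k₂) * (p.k₁ * (1 - P 0 0)) := by
      have := sub_nonneg.2 h00.2; positivity
    nlinarith
  · nlinarith
  · nlinarith

/-- In the nominal mode, unit rows give `P 0 1 ^ 2 + P 0 2 ^ 2 = 1 - P 0 0 ^ 2 ≤ 2 * (1 - P 0 0)`,
and likewise for row 1; in the expelling modes the gradient is bounded and the potential is bounded
below. This makes the cross term of the Lyapunov function small against the energy. -/
theorem exists_gradient_sq_le_modePotential {p : Params} (hp : p.Tuned) :
    ∃ C > 0, ∀ m, ∀ P ∈ SO3,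
      modeGradient p m P ⬝ᵥ modeGradient p m P ≤ C * modePotential p m P := by
  have hk₁ := hp.k₁_pos
  have hk₂ := hp.k₂_pos
  have hβ : |p.β| ≤ 1 := by linarith [hp.abs_β_lt, hp.α_lt_two]
  set S := 6 * (p.k₁ + p.k₂) ^ 2 with hS
  have hS0 : 0 < S := by positivity
  refine ⟨S / p.k₁ + S / p.k₂, by positivity, fun m P hP => ?_⟩
  obtain ⟨hII, hIII⟩ := modePotential_expelling_ge hp hP
  have e1 : S / p.k₁ * p.k₁ = S := by field_simp
  have e2 : S / p.k₂ * p.k₂ = S := by field_simp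
  have n1 : 0 < S / p.k₁ := by positivity
  have n2 : 0 < S / p.k₂ := by positivity
  have hb : ∀ k : ℝ, 0 < k → ∀ i j, (k * p.β * P i j) ^ 2 ≤ k ^ 2 := fun k hk i j => by
    rw [mul_assoc, mul_pow]
    refine mul_le_of_le_one_right (by positivity) ?_
    rw [sq_le_one_iff_abs_le_one, abs_mul]
    exact mul_le_one₀ hβ (abs_nonneg _) (SO3.abs_apply_le hP i j)
  have hn : ∀ k : ℝ, 0 < k → ∀ i j, (k * P i j) ^ 2 ≤ k ^ 2 := fun k hk i j => by
    rw [mul_pow]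
    exact mul_le_of_le_one_right (by positivity)
      ((sq_le_one_iff_abs_le_one _).2 (SO3.abs_apply_le hP i j))
  have hk : 0 < p.k₁ * p.k₂ := by positivity
  cases m
  · have h00 := abs_le.1 (SO3.abs_apply_le hP 0 0)
    have h11 := abs_le.1 (SO3.abs_apply_le hP 1 1)
    have r0 := SO3.row_sq hP 0
    have r1 := SO3.row_sq hP 1
    simp only [modePotential, modeGradient, dotProduct, Fin.sum_univ_three, Matrix.cons_val]
    have b0 : P 0 1 ^ 2 + P 0 2 ^ 2 ≤ 2 * (1 - P 0 0) := by nlinarith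
    have b1 : P 1 0 ^ 2 + P 1 2 ^ 2 ≤ 2 * (1 - P 1 1) := by nlinarith
    have a1 : (S / p.k₁) * (p.k₁ * (1 - P 0 0)) = S * (1 - P 0 0) := by field_simp
    have a2 : (S / p.k₂) * (p.k₂ * (1 - P 1 1)) = S * (1 - P 1 1) := by field_simp
    have a3 : 0 ≤ (S / p.k₁) * (p.k₂ * (1 - P 1 1)) := by
      have := sub_nonneg.2 h11.2; positivity
    have a4 : 0 ≤ (S / p.k₂) * (p.k₁ * (1 - P 0 0)) := by
      have := sub_nonneg.2 h00.2; positivity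
    have c1 : p.k₁ ^ 2 * (P 0 1 ^ 2 + P 0 2 ^ 2) ≤ S / 6 * (2 * (1 - P 0 0)) :=
      mul_le_mul (by rw [hS]; nlinarith) b0 (by positivity) (by positivity)
    have c2 : p.k₂ ^ 2 * (P 1 0 ^ 2 + P 1 2 ^ 2) ≤ S / 6 * (2 * (1 - P 1 1)) :=
      mul_le_mul (by rw [hS]; nlinarith) b1 (by positivity) (by positivity)
    nlinarith [sq_nonneg (p.k₁ * P 0 1 + p.k₂ * P 1 0), sq_nonneg (p.k₁ * P 0 2),
      sq_nonneg (p.k₂ * P 1 2)]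
  · have : modeGradient p .II P ⬝ᵥ modeGradient p .II P ≤ S := by
      simp only [modeGradient, dotProduct, Fin.sum_univ_three, Matrix.cons_val]
      have := hb p.k₂ hk₂ 2 2
      have := hn p.k₁ hk₁ 0 2
      have := hn p.k₁ hk₁ 0 1
      have := hb p.k₂ hk₂ 2 0
      rw [hS]
      nlinarith [sq_nonneg (p.k₁ * P 0 1 - p.k₂ * p.β * P 2 0)]
    nlinarith
  · have : modeGradient p .III P ⬝ᵥ modeGradient p .III P ≤ S := by
      simp only [modeGradient, dotProduct, Fin.sum_univ_three, Matrix.cons_val]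
      have := hb p.k₁ hk₁ 2 2
      have := hn p.k₂ hk₂ 1 2
      have := hn p.k₂ hk₂ 1 0
      have := hb p.k₁ hk₁ 2 1
      rw [hS]
      nlinarith [sq_nonneg (p.k₁ * p.β * P 2 1 - p.k₂ * P 1 0)]
    nlinarith

/-! ### Estimates in the flow set -/

/-- The margins by which the switching threshold clears the critical configurations. -/
theorem Params.Tuned.exists_margin {p : Params} (hp : p.Tuned) :
    ∃ g > 0, p.δ ≤ p.k₁ * (2 - p.α - g) ∧ p.δ ≤ p.k₂ * (2 - p.α - g) ∧
      p.δ ≤ p.k₁ * (p.α - |p.β| - 1 - g) ∧ p.δ ≤ p.k₂ * (p.α - |p.β| - 1 - g) := by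
  have hk₁ := hp.k₁_pos
  have hk₂ := hp.k₂_pos
  set k := min p.k₁ p.k₂
  set s := min (2 - p.α) (p.α - |p.β| - 1)
  have hk : 0 < k := lt_min hk₁ hk₂
  have hδ : p.δ < k * s := hp.δ_lt
  have hδ0 := hp.δ_pos
  have hd : k * (p.δ / k) = p.δ := by field_simp
  have hlt : p.δ / k < s := by rw [div_lt_iff₀ hk]; linarith
  have hpos : 0 < p.δ / k := by positivity
  have k1 : k ≤ p.k₁ := min_le_left _ _
  have k2 : k ≤ p.k₂ := min_le_right _ _
  have s1 : s ≤ 2 - p.α := min_le_left _ _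
  have s2 : s ≤ p.α - |p.β| - 1 := min_le_right _ _
  -- The margin is the slack in `δ / k < s`: for `s' ≥ s` it leaves `s' - g ≥ δ / k`.
  refine ⟨s - p.δ / k, by linarith, ?_⟩
  have key : ∀ k' s', k ≤ k' → s ≤ s' → p.δ ≤ k' * (s' - (s - p.δ / k)) := by
    intro k' s' h1 h2
    calc p.δ = k * (p.δ / k) := hd.symm
      _ ≤ k' * (s' - (s - p.δ / k)) := mul_le_mul h1 (by linarith) hpos.le (by linarith)
  exact ⟨key _ _ k1 s1, key _ _ k2 s1, key _ _ k1 s2, key _ _ k2 s2⟩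

theorem neg_abs_β_le (p : Params) {P : Mat3} (hP : P ∈ SO3) (i j : Fin 3) :
    -|p.β| ≤ p.β * P i j := by
  have : |p.β * P i j| ≤ |p.β| := by
    rw [abs_mul]
    exact mul_le_of_le_one_right (abs_nonneg _) (SO3.abs_apply_le hP i j)
  exact (abs_le.1 this).1

/-- In the flow set, the expelling modes are active only far from the identity. -/
theorem apply_le_of_expelling_flow {p : Params} (hp : p.Tuned) :
    ∃ g > 0, ∀ P ∈ SO3,
      (modePotential p .II P - minPotential p P ≤ p.δ → P 1 1 ≤ -g) ∧
      (modePotential p .III P - minPotential p P ≤ p.δ → P 0 0 ≤ -g) := by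
  obtain ⟨g, hg, -, -, h1, h2⟩ := hp.exists_margin
  refine ⟨g, hg, fun P hP => ⟨fun h => ?_, fun h => ?_⟩⟩
  -- Against mode `I` the `k₁` terms cancel, and the gap is at least `k₂ * (α - |β| - 1 + P 1 1)`.
  · have hI := minPotential_le p P .I
    have hb := neg_abs_β_le p hP 2 1
    simp only [modePotential] at h hI
    have : p.k₂ * (P 1 1 + g) ≤ 0 := by nlinarith [hp.k₂_pos]
    nlinarith [hp.k₂_pos]
  · have hI := minPotential_le p P .I
    have hb := neg_abs_β_le p hP 2 0
    simp only [modePotential] at h hI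
    have : p.k₁ * (P 0 0 + g) ≤ 0 := by nlinarith [hp.k₁_pos]
    nlinarith [hp.k₁_pos]

/-- At the identity an expelling mode has positive potential, so the bound fails without the flow
condition. That condition makes a diagonal entry negative, hence `3 - tr P ≥ 1`, and boundedness of
the potential suffices. -/
theorem exists_modePotential_le_trace {p : Params} (hp : p.Tuned) :
    ∃ C > 0, ∀ m, ∀ P ∈ SO3, modePotential p m P - minPotential p P ≤ p.δ →
      modePotential p m P ≤ C * (3 - (P 0 0 + P 1 1 + P 2 2)) := by
  obtain ⟨g, hg, hexp⟩ := apply_le_of_expelling_flow hp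
  obtain ⟨C, hC, hbd⟩ := exists_modePotential_le p
  have hk₁ := hp.k₁_pos
  have hk₂ := hp.k₂_pos
  refine ⟨C + p.k₁ + p.k₂, by positivity, fun m P hP h => ?_⟩
  have h00 := (abs_le.1 (SO3.abs_apply_le hP 0 0)).2
  have h11 := (abs_le.1 (SO3.abs_apply_le hP 1 1)).2
  have h22 := (abs_le.1 (SO3.abs_apply_le hP 2 2)).2
  cases m
  · simp only [modePotential]
    nlinarith [mul_nonneg hk₁.le (sub_nonneg.2 h11), mul_nonneg hk₁.le (sub_nonneg.2 h22),
      mul_nonneg hk₂.le (sub_nonneg.2 h00), mul_nonneg hk₂.le (sub_nonneg.2 h22),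
      mul_nonneg hC.le (sub_nonneg.2 (SO3.trace_le hP))]
  · have := (hexp P hP).1 h
    have := hbd .II P hP
    nlinarith
  · have := (hexp P hP).2 h
    have := hbd .III P hP
    nlinarith

/-- If `|r| ≤ g / 2`, then `1 + a ≥ g / 2` can be divided out of `1 - a ^ 2`. Otherwise `K * H ≥ r ^
2 ≥ g ^ 2 / 4`, and the trivial bound `1 - a ≤ 2` is already a multiple of `H`. -/
theorem one_sub_le_of_sq {a r H C K g : ℝ} (hg : 0 < g) (ha : -1 ≤ a) (ha' : a ≤ 1) (hH : 0 ≤ H)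
    (hC : 0 ≤ C) (hK : 0 ≤ K) (h1 : 1 - a ^ 2 ≤ C * H) (h2 : r ^ 2 ≤ K * H)
    (h3 : g - |r| ≤ 1 + a) : 1 - a ≤ (2 * C / g + 8 * K / g ^ 2) * H := by
  have n1 : 0 ≤ 2 * C / g * H := by positivity
  have n2 : 0 ≤ 8 * K / g ^ 2 * H := by positivity
  rcases le_or_gt |r| (g / 2) with h | h
  · have : 1 - a ≤ 2 * C / g * H := by
      rw [div_mul_eq_mul_div, le_div_iff₀ hg]
      nlinarith
    linarith
  · have : 1 - a ≤ 8 * K / g ^ 2 * H := by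
      rw [div_mul_eq_mul_div, le_div_iff₀ (by positivity)]
      have : (g / 2) ^ 2 ≤ r ^ 2 := by
        rw [← sq_abs r]; exact pow_le_pow_left₀ (by positivity) h.le 2
      nlinarith
    linarith

/-- The off-diagonal entries of a rotation are controlled by the gradient of the nominal mode. -/
theorem exists_offDiag_sq_le {p : Params} (hp : p.Tuned) :
    ∃ C > 0, ∀ P ∈ SO3, ∀ H, H = modeGradient p .I P ⬝ᵥ modeGradient p .I P →
      1 - P 0 0 ^ 2 ≤ C * H ∧ 1 - P 1 1 ^ 2 ≤ C * H ∧
        P 2 0 ^ 2 ≤ C * H ∧ P 2 1 ^ 2 ≤ C * H := by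
  have hk₁ := hp.k₁_pos
  have hk₂ := hp.k₂_pos
  -- Positivity of `D` is where `k₁ ≠ k₂` is used: for equal gains the third gradient component
  -- controls only `P 0 1 - P 1 0`.
  set D := |p.k₂ ^ 2 - p.k₁ ^ 2| with hD
  have hD0 : 0 < D := abs_pos.2 <| by
    intro h
    have : (p.k₂ - p.k₁) * (p.k₂ + p.k₁) = 0 := by linarith
    rcases mul_eq_zero.1 this with h | h
    · exact hp.k_ne (by linarith)
    · linarith
  set N := 1 / p.k₁ ^ 2 + 1 / p.k₂ ^ 2 with hN
  have hN0 : 0 < N := by positivity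
  set Cu := 2 / D * (p.k₂ ^ 2 * N + 1 + 2 * p.k₁ ^ 2 / D) with hCu
  have hCu0 : 0 < Cu := by positivity
  refine ⟨Cu + 2 * N, by positivity, fun P hP H hH => ?_⟩
  have r0 := SO3.row_sq hP 0
  have r1 := SO3.row_sq hP 1
  have r2 := SO3.row_sq hP 2
  have c0 := SO3.col_sq hP 0
  have c1 := SO3.col_sq hP 1
  have c2 := SO3.col_sq hP 2
  set z := -p.k₁ * P 0 1 + p.k₂ * P 1 0 with hz
  have hH' : H = p.k₂ ^ 2 * P 1 2 ^ 2 + p.k₁ ^ 2 * P 0 2 ^ 2 + z ^ 2 := by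
    rw [hH]
    simp only [modeGradient, dotProduct, Fin.sum_univ_three, Matrix.cons_val]
    ring
  have hH0 : 0 ≤ H := by rw [hH']; positivity
  have hx : P 0 2 ^ 2 ≤ 1 / p.k₁ ^ 2 * H := by
    rw [one_div_mul_eq_div, le_div_iff₀ (by positivity), hH']
    nlinarith [sq_nonneg (p.k₂ * P 1 2), sq_nonneg z]
  have hy : P 1 2 ^ 2 ≤ 1 / p.k₂ ^ 2 * H := by
    rw [one_div_mul_eq_div, le_div_iff₀ (by positivity), hH']
    nlinarith [sq_nonneg (p.k₁ * P 0 2), sq_nonneg z]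
  have hxy : P 0 2 ^ 2 + P 1 2 ^ 2 ≤ N * H := by rw [hN, add_mul]; linarith
  have hzH : z ^ 2 ≤ H := by
    rw [hH']; nlinarith [sq_nonneg (p.k₁ * P 0 2), sq_nonneg (p.k₂ * P 1 2)]
  -- Row 2 against column 2, then row 0 against column 0: all have unit length.
  have hrs : P 2 0 ^ 2 + P 2 1 ^ 2 = P 0 2 ^ 2 + P 1 2 ^ 2 := by linarith
  have huv : P 0 1 ^ 2 - P 1 0 ^ 2 = P 2 0 ^ 2 - P 0 2 ^ 2 := by linarith
  -- Eliminating `P 1 0` through `k₂ * P 1 0 = z + k₁ * P 0 1` leaves `P 0 1 ^ 2` as the only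
  -- unknown square, up to a term linear in `P 0 1` that Young's inequality absorbs into half of the
  -- left side.
  have hmain : (p.k₂ ^ 2 - p.k₁ ^ 2) * P 0 1 ^ 2 =
      p.k₂ ^ 2 * (P 2 0 ^ 2 - P 0 2 ^ 2) + (z ^ 2 + 2 * p.k₁ * P 0 1 * z) := by
    rw [← huv, hz]; ring
  have habs : D * P 0 1 ^ 2 ≤ p.k₂ ^ 2 * (N * H) + (H + 2 * p.k₁ * |P 0 1| * |z|) := by
    have e : D * P 0 1 ^ 2 = |(p.k₂ ^ 2 - p.k₁ ^ 2) * P 0 1 ^ 2| := by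
      rw [abs_mul, abs_of_nonneg (sq_nonneg (P 0 1))]
    rw [e, hmain]
    refine (abs_add_le _ _).trans (add_le_add ?_ ((abs_add_le _ _).trans (add_le_add ?_ ?_)))
    · rw [abs_mul, abs_of_nonneg (sq_nonneg p.k₂)]
      refine mul_le_mul_of_nonneg_left ?_ (sq_nonneg _)
      rw [abs_le]
      constructor <;> linarith [sq_nonneg (P 2 0), sq_nonneg (P 2 1), sq_nonneg (P 0 2),
        sq_nonneg (P 1 2)]
    · rw [abs_of_nonneg (sq_nonneg z)]; exact hzH
    · rw [abs_mul, abs_mul, abs_mul, abs_of_pos hk₁, abs_two]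
  have hyoung : 2 * p.k₁ * |P 0 1| * |z| ≤ D / 2 * P 0 1 ^ 2 + 2 * p.k₁ ^ 2 / D * H := by
    have h1 : 2 * p.k₁ * |P 0 1| * |z| ≤ D / 2 * P 0 1 ^ 2 + 2 * p.k₁ ^ 2 / D * z ^ 2 := by
      have h := mul_nonneg (div_nonneg zero_le_two hD0.le)
        (sq_nonneg (D / 2 * |P 0 1| - p.k₁ * |z|))
      have e : 2 / D * (D / 2 * |P 0 1| - p.k₁ * |z|) ^ 2 =
          D / 2 * |P 0 1| ^ 2 + 2 * p.k₁ ^ 2 / D * |z| ^ 2 - 2 * p.k₁ * |P 0 1| * |z| := by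
        field_simp; ring
      rw [sq_abs, sq_abs] at e
      linarith
    have h2 : 2 * p.k₁ ^ 2 / D * z ^ 2 ≤ 2 * p.k₁ ^ 2 / D * H := by gcongr
    linarith
  have hu : P 0 1 ^ 2 ≤ Cu * H := by
    have h : D / 2 * P 0 1 ^ 2 ≤ (p.k₂ ^ 2 * N + 1 + 2 * p.k₁ ^ 2 / D) * H := by linarith
    calc P 0 1 ^ 2 = 2 / D * (D / 2 * P 0 1 ^ 2) := by field_simp
      _ ≤ 2 / D * ((p.k₂ ^ 2 * N + 1 + 2 * p.k₁ ^ 2 / D) * H) := by gcongr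
      _ = Cu * H := by rw [hCu]; ring
  have hNH : 0 ≤ N * H := by positivity
  have hCuH : 0 ≤ Cu * H := by positivity
  have e : (Cu + 2 * N) * H = Cu * H + 2 * (N * H) := by ring
  rw [e]
  have := sq_nonneg (P 2 0)
  have := sq_nonneg (P 2 1)
  have := sq_nonneg (P 0 2)
  have := sq_nonneg (P 1 2)
  refine ⟨?_, ?_, ?_, ?_⟩ <;> linarith

/-- In the flow set, the configuration error is controlled by its gradient: the only critical point
there is the identity in the nominal mode. -/
theorem exists_modePotential_le_gradient_sq {p : Params} (hp : p.Tuned) :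
    ∃ C > 0, ∀ m, ∀ P ∈ SO3, modePotential p m P - minPotential p P ≤ p.δ →
      modePotential p m P ≤ C * (modeGradient p m P ⬝ᵥ modeGradient p m P) := by
  have hk₁ := hp.k₁_pos
  have hk₂ := hp.k₂_pos
  have hβ : |p.β| ≤ 1 := by linarith [hp.abs_β_lt, hp.α_lt_two]
  have hβ2 : 0 < p.β ^ 2 := by have := hp.β_ne_zero; positivity
  obtain ⟨g, hg, hm1, hm2, -, -⟩ := hp.exists_margin
  obtain ⟨g', hg', hexp⟩ := apply_le_of_expelling_flow hp
  obtain ⟨C, hC, hbd⟩ := exists_modePotential_le p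
  obtain ⟨C₀, hC₀, hoff⟩ := exists_offDiag_sq_le hp
  set A := 2 * C₀ / g + 8 * C₀ / g ^ 2 with hA
  have hA0 : 0 < A := by positivity
  set N := 1 / p.k₁ ^ 2 + 1 / p.k₂ ^ 2 + 1 / (p.k₁ ^ 2 * p.β ^ 2) + 1 / (p.k₂ ^ 2 * p.β ^ 2)
    with hN
  have i1 : 0 < 1 / p.k₁ ^ 2 := by positivity
  have i2 : 0 < 1 / p.k₂ ^ 2 := by positivity
  have i3 : 0 < 1 / (p.k₁ ^ 2 * p.β ^ 2) := by positivity
  have i4 : 0 < 1 / (p.k₂ ^ 2 * p.β ^ 2) := by positivity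
  have hN0 : 0 < N := by positivity
  have hdiv : ∀ k x H : ℝ, 0 < k → k * x ≤ H → x ≤ 1 / k * H := fun k x H hk h => by
    rw [one_div_mul_eq_div, le_div_iff₀ hk]; linarith
  -- A diagonal entry below `-g'` whose square is at most `N * H` forces `H ≥ g' ^ 2 / N`, so the
  -- uniform bound `C` of the potential becomes a multiple of `H`.
  have hfar : ∀ d H : ℝ, d ≤ -g' → d ^ 2 ≤ N * H → 0 ≤ H → C ≤ (C * N / g' ^ 2) * H := by
    intro d H h1 h2 h3
    rw [div_mul_eq_mul_div, le_div_iff₀ (by positivity), mul_assoc]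
    exact mul_le_mul_of_nonneg_left (le_trans (by nlinarith) h2) hC.le
  refine ⟨(p.k₁ + p.k₂) * A + C * N / g' ^ 2, by positivity, fun m P hP h => ?_⟩
  set H := modeGradient p m P ⬝ᵥ modeGradient p m P with hH
  have hH0 : 0 ≤ H := by
    rw [hH]; simp only [dotProduct, Fin.sum_univ_three]; nlinarith [sq_nonneg (modeGradient p m P 0),
      sq_nonneg (modeGradient p m P 1), sq_nonneg (modeGradient p m P 2)]
  have m1 : 0 ≤ (p.k₁ + p.k₂) * A * H := by positivity
  have m2 : 0 ≤ C * N / g' ^ 2 * H := by positivity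
  have c2 := SO3.col_sq hP 2
  have hNH : N * H = 1 / p.k₁ ^ 2 * H + 1 / p.k₂ ^ 2 * H + 1 / (p.k₁ ^ 2 * p.β ^ 2) * H
      + 1 / (p.k₂ ^ 2 * p.β ^ 2) * H := by rw [hN]; ring
  have j1 := mul_nonneg i1.le hH0
  have j2 := mul_nonneg i2.le hH0
  have j3 := mul_nonneg i3.le hH0
  have j4 := mul_nonneg i4.le hH0
  rw [add_mul]
  cases m
  · obtain ⟨o1, o2, o3, o4⟩ := hoff P hP H hH
    have hII := minPotential_le p P .II
    have hIII := minPotential_le p P .III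
    have h00 := abs_le.1 (SO3.abs_apply_le hP 0 0)
    have h11 := abs_le.1 (SO3.abs_apply_le hP 1 1)
    have hb : ∀ i j, p.β * P i j ≤ |P i j| := fun i j => (le_abs_self _).trans <| by
      rw [abs_mul]; exact mul_le_of_le_one_left (abs_nonneg _) hβ
    simp only [modePotential] at h hII hIII
    -- The gap to mode `III`, where the `k₂` terms cancel, keeps `P 0 0` away from `-1` unless `|P 2
    -- 0|` is of order `g`, and `P 2 0 ^ 2` is itself controlled by the gradient.
    have t1 : g - |P 2 0| ≤ 1 + P 0 0 := by
      have : p.k₁ * (1 - P 0 0 - p.α - p.β * P 2 0) ≤ p.k₁ * (2 - p.α - g) := by linarith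
      linarith [le_of_mul_le_mul_left this hk₁, hb 2 0]
    have t2 : g - |P 2 1| ≤ 1 + P 1 1 := by
      have : p.k₂ * (1 - P 1 1 - p.α - p.β * P 2 1) ≤ p.k₂ * (2 - p.α - g) := by linarith
      linarith [le_of_mul_le_mul_left this hk₂, hb 2 1]
    have f1 := one_sub_le_of_sq hg h00.1 h00.2 hH0 hC₀.le hC₀.le o1 o3 t1
    have f2 := one_sub_le_of_sq hg h11.1 h11.2 hH0 hC₀.le hC₀.le o2 o4 t2
    rw [← hA] at f1 f2
    simp only [modePotential]
    nlinarith [mul_le_mul_of_nonneg_left f1 hk₁.le, mul_le_mul_of_nonneg_left f2 hk₂.le]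
  · have h1 := (hexp P hP).1 h
    have hH' : H = (p.k₂ * p.β * P 2 2) ^ 2 + (p.k₁ * P 0 2) ^ 2
        + (-p.k₁ * P 0 1 - p.k₂ * p.β * P 2 0) ^ 2 := by
      rw [hH]; simp only [modeGradient, dotProduct, Fin.sum_univ_three, Matrix.cons_val]; ring
    have hq := hdiv (p.k₂ ^ 2 * p.β ^ 2) (P 2 2 ^ 2) H (by positivity) (by
      rw [hH', ← mul_pow, ← mul_pow]
      simp only [neg_mul]
      linarith [sq_nonneg (p.k₁ * P 0 2), sq_nonneg (-(p.k₁ * P 0 1) - p.k₂ * p.β * P 2 0)])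
    have hx := hdiv (p.k₁ ^ 2) (P 0 2 ^ 2) H (by positivity) (by
      rw [hH', ← mul_pow]
      simp only [neg_mul]
      linarith [sq_nonneg (p.k₂ * p.β * P 2 2), sq_nonneg (-(p.k₁ * P 0 1) - p.k₂ * p.β * P 2 0)])
    have r1 := SO3.row_sq hP 1
    -- Column 2 turns the bounds on `P 0 2` and `P 2 2` into one on `1 - P 1 2 ^ 2`, which dominates
    -- `P 1 1 ^ 2` by row 1.
    have := hfar (P 1 1) H h1 (by
      rw [hNH]; linarith [sq_nonneg (P 1 0)]) hH0
    linarith [hbd .II P hP]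
  · have h1 := (hexp P hP).2 h
    have hH' : H = (-p.k₂ * P 1 2) ^ 2 + (-p.k₁ * p.β * P 2 2) ^ 2
        + (p.k₁ * p.β * P 2 1 + p.k₂ * P 1 0) ^ 2 := by
      rw [hH]; simp only [modeGradient, dotProduct, Fin.sum_univ_three, Matrix.cons_val]; ring
    have hq := hdiv (p.k₁ ^ 2 * p.β ^ 2) (P 2 2 ^ 2) H (by positivity) (by
      rw [hH', ← mul_pow, ← mul_pow]
      simp only [neg_mul, neg_sq]
      linarith [sq_nonneg (p.k₂ * P 1 2), sq_nonneg (p.k₁ * p.β * P 2 1 + p.k₂ * P 1 0)])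
    have hx := hdiv (p.k₂ ^ 2) (P 1 2 ^ 2) H (by positivity) (by
      rw [hH', ← mul_pow]
      simp only [neg_mul, neg_sq]
      linarith [sq_nonneg (p.k₁ * p.β * P 2 2), sq_nonneg (p.k₁ * p.β * P 2 1 + p.k₂ * P 1 0)])
    have r0 := SO3.row_sq hP 0
    have := hfar (P 0 0) H h1 (by
      rw [hNH]; linarith [sq_nonneg (P 0 1)]) hH0
    linarith [hbd .III P hP]

end AttitudeTracking

end

noncomputable section

namespace AttitudeTracking

/-! ### The Euclidean norm -/

theorem dotProduct_self_nonneg' (x : Vec3) : 0 ≤ x ⬝ᵥ x := by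
  simp only [dotProduct, Fin.sum_univ_three]
  nlinarith [sq_nonneg (x 0), sq_nonneg (x 1), sq_nonneg (x 2)]

theorem eucNorm_nonneg (x : Vec3) : 0 ≤ eucNorm x := Real.sqrt_nonneg _

theorem eucNorm_sq (x : Vec3) : eucNorm x ^ 2 = x ⬝ᵥ x :=
  Real.sq_sqrt (dotProduct_self_nonneg' x)

/-- Lagrange's identity: the defect is the squared length of the cross product. -/
theorem dotProduct_sq_le (x y : Vec3) : (x ⬝ᵥ y) ^ 2 ≤ (x ⬝ᵥ x) * (y ⬝ᵥ y) := by
  have h := cross_dot_cross x y x y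
  have h2 := dotProduct_self_nonneg' (x ⨯₃ y)
  rw [h, dotProduct_comm y x] at h2
  nlinarith

theorem abs_dotProduct_le (x y : Vec3) : |x ⬝ᵥ y| ≤ eucNorm x * eucNorm y := by
  refine abs_le_of_sq_le_sq ?_ (mul_nonneg (eucNorm_nonneg x) (eucNorm_nonneg y))
  rw [mul_pow, eucNorm_sq, eucNorm_sq]
  exact dotProduct_sq_le x y

theorem eucNorm_cross_le (x y : Vec3) : eucNorm (x ⨯₃ y) ≤ eucNorm x * eucNorm y := by
  refine le_of_sq_le_sq ?_ (mul_nonneg (eucNorm_nonneg x) (eucNorm_nonneg y))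
  rw [mul_pow, eucNorm_sq, eucNorm_sq, eucNorm_sq, cross_dot_cross, dotProduct_comm y x]
  nlinarith [sq_nonneg (x ⬝ᵥ y)]

theorem abs_apply_le_eucNorm (x : Vec3) (i : Fin 3) : |x i| ≤ eucNorm x := by
  refine Real.abs_le_sqrt ?_
  simp only [dotProduct, Fin.sum_univ_three]
  fin_cases i <;> simp only [Fin.zero_eta, Fin.mk_one, Fin.reduceFinMk] <;>
    nlinarith [sq_nonneg (x 0), sq_nonneg (x 1), sq_nonneg (x 2)]

theorem eucNorm_le_of_abs_le {x : Vec3} {s : ℝ} (h : ∀ i, |x i| ≤ s) : eucNorm x ≤ 3 * s := by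
  have hs : 0 ≤ s := (abs_nonneg _).trans (h 0)
  refine Real.sqrt_le_iff.2 ⟨by positivity, ?_⟩
  have hi : ∀ i, x i * x i ≤ s ^ 2 := fun i => by
    rw [← pow_two, ← sq_abs]; exact pow_le_pow_left₀ (abs_nonneg _) (h i) 2
  simp only [dotProduct, Fin.sum_univ_three]
  nlinarith [hi 0, hi 1, hi 2]

theorem exists_eucNorm_mulVec_le (K : Mat3) :
    ∃ L > 0, ∀ x, eucNorm (K *ᵥ x) ≤ L * eucNorm x := by
  refine ⟨3 * (eucNorm (K 0) + eucNorm (K 1) + eucNorm (K 2) + 1), ?_, fun x => ?_⟩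
  · have := eucNorm_nonneg (K 0)
    have := eucNorm_nonneg (K 1)
    have := eucNorm_nonneg (K 2)
    positivity
  · rw [mul_assoc]
    refine eucNorm_le_of_abs_le fun i => (abs_dotProduct_le (K i) x).trans ?_
    refine mul_le_mul_of_nonneg_right ?_ (eucNorm_nonneg x)
    have := eucNorm_nonneg (K 0)
    have := eucNorm_nonneg (K 1)
    have := eucNorm_nonneg (K 2)
    fin_cases i <;> simp only [Fin.zero_eta, Fin.mk_one, Fin.reduceFinMk] <;> linarith

theorem dotProduct_mulVec_mulVec {P : Mat3} (hP : Pᵀ * P = 1) (x y : Vec3) :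
    (P *ᵥ x) ⬝ᵥ (P *ᵥ y) = x ⬝ᵥ y := by
  rw [Matrix.dotProduct_mulVec, ← Matrix.mulVec_transpose, Matrix.mulVec_mulVec, hP,
    Matrix.one_mulVec]

theorem eucNorm_mulVec_SO3 {P : Mat3} (hP : P ∈ SO3) (x : Vec3) :
    eucNorm (P *ᵥ x) = eucNorm x := by
  unfold eucNorm
  rw [dotProduct_mulVec_mulVec (SO3.transpose_mul hP)]

theorem PosDef.transpose_eq {K : Mat3} (hK : K.PosDef) : Kᵀ = K := by
  have := hK.isHermitian.eq
  rwa [Matrix.conjTranspose_eq_transpose_of_trivial] at this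

theorem PosDef.mul_inv {K : Mat3} (hK : K.PosDef) : K * K⁻¹ = 1 :=
  Matrix.mul_nonsing_inv K hK.det_pos.ne'.isUnit

theorem PosDef.inv_mul {K : Mat3} (hK : K.PosDef) : K⁻¹ * K = 1 :=
  Matrix.nonsing_inv_mul K hK.det_pos.ne'.isUnit

theorem dotProduct_mulVec_symm {K : Mat3} (hK : Kᵀ = K) (x y : Vec3) :
    x ⬝ᵥ (K *ᵥ y) = y ⬝ᵥ (K *ᵥ x) := by
  rw [Matrix.dotProduct_mulVec, ← Matrix.mulVec_transpose, hK, dotProduct_comm]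

/-- Evaluate the form at `x - s • K⁻¹ *ᵥ x` and expand: `0 ≤ x·Kx - 2s |x|² + s² x·K⁻¹x`. With `s =
1 / L`, where `L` bounds `K⁻¹`, the last term is at most `s |x|²`. -/
theorem PosDef.exists_lower_bound {K : Mat3} (hK : K.PosDef) :
    ∃ l > 0, ∀ x : Vec3, l * (x ⬝ᵥ x) ≤ x ⬝ᵥ (K *ᵥ x) := by
  obtain ⟨L, hL, hKL⟩ := exists_eucNorm_mulVec_le K⁻¹
  refine ⟨1 / L, by positivity, fun x => ?_⟩
  set s := 1 / L with hs
  have h1 : 0 ≤ (x - s • K⁻¹ *ᵥ x) ⬝ᵥ (K *ᵥ (x - s • K⁻¹ *ᵥ x)) := by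
    by_cases h0 : x - s • K⁻¹ *ᵥ x = 0
    · simp [h0]
    · simpa using (hK.dotProduct_mulVec_pos h0).le
  have e1 : K *ᵥ (x - s • K⁻¹ *ᵥ x) = K *ᵥ x - s • x := by
    rw [Matrix.mulVec_sub, Matrix.mulVec_smul, Matrix.mulVec_mulVec, PosDef.mul_inv hK,
      Matrix.one_mulVec]
  have e2 : (K⁻¹ *ᵥ x) ⬝ᵥ (K *ᵥ x) = x ⬝ᵥ x := by
    rw [dotProduct_mulVec_symm (PosDef.transpose_eq hK), Matrix.mulVec_mulVec, PosDef.mul_inv hK,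
      Matrix.one_mulVec]
  rw [e1, sub_dotProduct, dotProduct_sub, dotProduct_sub, smul_dotProduct, smul_dotProduct,
    dotProduct_smul, dotProduct_smul, e2] at h1
  simp only [smul_eq_mul] at h1
  have h2 : (K⁻¹ *ᵥ x) ⬝ᵥ x ≤ L * (x ⬝ᵥ x) := by
    refine (le_abs_self _).trans ((abs_dotProduct_le _ _).trans ?_)
    rw [← eucNorm_sq, pow_two, ← mul_assoc]
    exact mul_le_mul_of_nonneg_right (hKL x) (eucNorm_nonneg x)
  have h3 : s * (s * ((K⁻¹ *ᵥ x) ⬝ᵥ x)) ≤ s * (x ⬝ᵥ x) := by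
    have hs0 : 0 < s := by positivity
    calc s * (s * ((K⁻¹ *ᵥ x) ⬝ᵥ x)) ≤ s * (s * (L * (x ⬝ᵥ x))) := by gcongr
      _ = s * (x ⬝ᵥ x) := by rw [hs]; field_simp
  linarith

/-! ### Entrywise differentiation -/

/-- Entrywise derivative of a matrix-valued curve. -/
def MatHasDerivWithinAt (A : ℝ → Mat3) (A' : Mat3) (S : Set ℝ) (t : ℝ) : Prop :=
  ∀ i j, HasDerivWithinAt (fun s => A s i j) (A' i j) S t

theorem MatHasDerivWithinAt.mono {A : ℝ → Mat3} {A' : Mat3} {S S' : Set ℝ} {t : ℝ}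
    (h : MatHasDerivWithinAt A A' S t) (hS : S' ⊆ S) : MatHasDerivWithinAt A A' S' t :=
  fun i j => (h i j).mono hS

theorem matHasDerivWithinAt_const (A : Mat3) (S : Set ℝ) (t : ℝ) :
    MatHasDerivWithinAt (fun _ => A) 0 S t :=
  fun _ _ => hasDerivWithinAt_const _ _ _

theorem MatHasDerivWithinAt.transpose {A : ℝ → Mat3} {A' : Mat3} {S : Set ℝ} {t : ℝ}
    (h : MatHasDerivWithinAt A A' S t) : MatHasDerivWithinAt (fun s => (A s)ᵀ) A'ᵀ S t :=
  fun i j => h j i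

theorem MatHasDerivWithinAt.mul {A B : ℝ → Mat3} {A' B' : Mat3} {S : Set ℝ} {t : ℝ}
    (hA : MatHasDerivWithinAt A A' S t) (hB : MatHasDerivWithinAt B B' S t) :
    MatHasDerivWithinAt (fun s => A s * B s) (A' * B t + A t * B') S t := by
  intro i j
  simp only [Matrix.mul_apply, Matrix.add_apply, ← Finset.sum_add_distrib]
  exact HasDerivWithinAt.fun_sum fun k _ => (hA i k).fun_mul (hB k j)

theorem MatHasDerivWithinAt.mulVec {A : ℝ → Mat3} {A' : Mat3} {v : ℝ → Vec3} {v' : Vec3}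
    {S : Set ℝ} {t : ℝ} (hA : MatHasDerivWithinAt A A' S t) (hv : HasDerivWithinAt v v' S t) :
    HasDerivWithinAt (fun s => A s *ᵥ v s) (A' *ᵥ v t + A t *ᵥ v') S t := by
  rw [hasDerivWithinAt_pi] at hv ⊢
  intro i
  simp only [Matrix.mulVec, dotProduct, Pi.add_apply, ← Finset.sum_add_distrib]
  exact HasDerivWithinAt.fun_sum fun k _ => (hA i k).fun_mul (hv k)

theorem hasDerivWithinAt_const_mulVec (A : Mat3) {v : ℝ → Vec3} {v' : Vec3} {S : Set ℝ} {t : ℝ}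
    (hv : HasDerivWithinAt v v' S t) : HasDerivWithinAt (fun s => A *ᵥ v s) (A *ᵥ v') S t := by
  simpa using (matHasDerivWithinAt_const A S t).mulVec hv

theorem hasDerivWithinAt_dotProduct {u v : ℝ → Vec3} {u' v' : Vec3} {S : Set ℝ} {t : ℝ}
    (hu : HasDerivWithinAt u u' S t) (hv : HasDerivWithinAt v v' S t) :
    HasDerivWithinAt (fun s => u s ⬝ᵥ v s) (u' ⬝ᵥ v t + u t ⬝ᵥ v') S t := by
  rw [hasDerivWithinAt_pi] at hu hv
  simp only [dotProduct, ← Finset.sum_add_distrib]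
  exact HasDerivWithinAt.fun_sum fun k _ => (hu k).fun_mul (hv k)

/-! ### Error dynamics -/

/-- The torque that drives the angular velocity error `e`, with reference angular velocity `c` and
inertia `K` in the frame of the body-fixed directions. -/
def errorTorque (p : Params) (K : Mat3) (m : Mode) (c : Vec3) (P : Mat3) (e : Vec3) : Vec3 :=
  -(e ⨯₃ (K *ᵥ e)) - e ⨯₃ (K *ᵥ (Pᵀ *ᵥ c)) - (Pᵀ *ᵥ c) ⨯₃ (K *ᵥ e)
    + K *ᵥ (e ⨯₃ (Pᵀ *ᵥ c)) - modeGradient p m P - p.kΩ • e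

/-- Kinetic energy of the angular velocity error. -/
def kinetic (K : Mat3) (e : Vec3) : ℝ := (1 / 2) * (e ⬝ᵥ (K *ᵥ e))

/-- Total error energy in a mode. -/
def energy (p : Params) (K : Mat3) (m : Mode) (P : Mat3) (e : Vec3) : ℝ :=
  kinetic K e + modePotential p m P

/-- With `w = Pᵀ *ᵥ c`, products `e ⨯₃ _` are orthogonal to `e`, and by symmetry of `K` the terms
`-(w ⨯₃ K e)` and `K (e ⨯₃ w)` pair with `e` to the same triple product with opposite signs. The
reference velocity does no work. -/
theorem dotProduct_errorTorque (p : Params) {K : Mat3} (hK : Kᵀ = K) (m : Mode) (c : Vec3)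
    (P : Mat3) (e : Vec3) :
    e ⬝ᵥ errorTorque p K m c P e = -(modeGradient p m P ⬝ᵥ e) - p.kΩ * (e ⬝ᵥ e) := by
  simp only [errorTorque, dotProduct_sub, dotProduct_add, dotProduct_neg, dotProduct_smul,
    dot_self_cross, smul_eq_mul]
  rw [dotProduct_mulVec_symm hK, triple_product_permutation e (Pᵀ *ᵥ c) (K *ᵥ e),
    dotProduct_comm e (modeGradient p m P), triple_product_permutation (Pᵀ *ᵥ c) (K *ᵥ e) e,
    dotProduct_comm (K *ᵥ e), dotProduct_comm (e ⨯₃ _)]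
  ring

theorem hasDerivWithinAt_kinetic {K : Mat3} (hK : Kᵀ = K) {e : ℝ → Vec3} {e' : Vec3} {S : Set ℝ}
    {t : ℝ} (he : HasDerivWithinAt e e' S t) :
    HasDerivWithinAt (fun s => kinetic K (e s)) (e t ⬝ᵥ (K *ᵥ e')) S t := by
  have h := (hasDerivWithinAt_dotProduct he (hasDerivWithinAt_const_mulVec K he)).const_mul (1 / 2)
  refine h.congr_deriv ?_
  rw [dotProduct_mulVec_symm hK e']
  ring

theorem hasDerivWithinAt_modePotential (p : Params) (m : Mode) {P : ℝ → Mat3} {v : Vec3}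
    {S : Set ℝ} {t : ℝ} (hP : MatHasDerivWithinAt P (P t * hat v) S t) :
    HasDerivWithinAt (fun s => modePotential p m (P s)) (modeGradient p m (P t) ⬝ᵥ v) S t := by
  cases m <;> simp only [modePotential]
  · refine ((((hP 0 0).const_sub 1).const_mul p.k₁).add
      (((hP 1 1).const_sub 1).const_mul p.k₂)).congr_deriv ?_
    simp [modeGradient, dotProduct, Fin.sum_univ_three, Matrix.mul_apply, hat]
    ring
  · refine ((((hP 0 0).const_sub 1).const_mul p.k₁).add
      ((((hP 2 1).const_mul p.β).const_add p.α).const_mul p.k₂)).congr_deriv ?_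
    simp [modeGradient, dotProduct, Fin.sum_univ_three, Matrix.mul_apply, hat]
    ring
  · refine (((((hP 2 0).const_mul p.β).const_add p.α).const_mul p.k₁).add
      (((hP 1 1).const_sub 1).const_mul p.k₂)).congr_deriv ?_
    simp [modeGradient, dotProduct, Fin.sum_univ_three, Matrix.mul_apply, hat]
    ring

/-- The gradient is linear in the matrix, so its derivative is the same expression evaluated at the
velocity of `P`. -/
theorem hasDerivWithinAt_modeGradient (p : Params) (m : Mode) {P : ℝ → Mat3} {A : Mat3}
    {S : Set ℝ} {t : ℝ} (hP : MatHasDerivWithinAt P A S t) :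
    HasDerivWithinAt (fun s => modeGradient p m (P s)) (modeGradient p m A) S t := by
  rw [hasDerivWithinAt_pi]
  intro i
  cases m <;> fin_cases i <;> simp [modeGradient]
  · exact ((hP 1 2).const_mul p.k₂).neg
  · exact (hP 0 2).const_mul p.k₁
  · exact ((hP 0 1).const_mul p.k₁).neg.add ((hP 1 0).const_mul p.k₂)
  · exact (hP 2 2).const_mul (p.k₂ * p.β)
  · exact (hP 0 2).const_mul p.k₁
  · exact ((hP 0 1).const_mul p.k₁).neg.sub ((hP 2 0).const_mul (p.k₂ * p.β))
  · exact ((hP 1 2).const_mul p.k₂).neg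
  · exact ((hP 2 2).const_mul (p.k₁ * p.β)).neg
  · exact ((hP 2 1).const_mul (p.k₁ * p.β)).add ((hP 1 0).const_mul p.k₂)

/-- Energy balance along the error dynamics, run at the rate `χ`. -/
theorem hasDerivWithinAt_energy (p : Params) {K : Mat3} (hK : K.PosDef) (m : Mode) {c : Vec3}
    {P : ℝ → Mat3} {e : ℝ → Vec3} {χ : ℝ} {S : Set ℝ} {t : ℝ}
    (hP : MatHasDerivWithinAt P (P t * hat (χ • e t)) S t)
    (he : HasDerivWithinAt e (χ • K⁻¹ *ᵥ errorTorque p K m c (P t) (e t)) S t) :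
    HasDerivWithinAt (fun s => energy p K m (P s) (e s)) (-(χ * p.kΩ * (e t ⬝ᵥ e t))) S t := by
  have hKT := PosDef.transpose_eq hK
  refine ((hasDerivWithinAt_kinetic hKT he).add
    (hasDerivWithinAt_modePotential p m hP)).congr_deriv ?_
  rw [Matrix.mulVec_smul, Matrix.mulVec_mulVec, PosDef.mul_inv hK, Matrix.one_mulVec,
    dotProduct_smul, dotProduct_errorTorque p hKT, dotProduct_smul]
  simp only [smul_eq_mul]
  ring

end AttitudeTracking

end

noncomputable section

namespace AttitudeTracking

/-! ### The strict Lyapunov function -/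

/-- The error energy with a cross term that is saturated in the angular velocity error, so that the
cross term changes by a bounded amount at jumps. -/
def lyapunov (p : Params) (K : Mat3) (κ : ℝ) (m : Mode) (P : Mat3) (e : Vec3) : ℝ :=
  energy p K m P e + κ * ((modeGradient p m P ⬝ᵥ (K *ᵥ e)) / (1 + kinetic K e))

/-- The derivative of `lyapunov` along the error dynamics. -/
def lyapunovRate (p : Params) (K : Mat3) (κ : ℝ) (m : Mode) (c : Vec3) (P : Mat3) (e : Vec3) : ℝ :=
  -(p.kΩ * (e ⬝ᵥ e)) + κ * (((modeGradient p m (P * hat e) ⬝ᵥ (K *ᵥ e)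
      + modeGradient p m P ⬝ᵥ errorTorque p K m c P e) * (1 + kinetic K e)
    - (modeGradient p m P ⬝ᵥ (K *ᵥ e)) * (-(modeGradient p m P ⬝ᵥ e) - p.kΩ * (e ⬝ᵥ e)))
      / (1 + kinetic K e) ^ 2)

theorem kinetic_nonneg {K : Mat3} (hK : K.PosDef) (e : Vec3) : 0 ≤ kinetic K e := by
  unfold kinetic
  by_cases h : e = 0
  · simp [h]
  · have := hK.dotProduct_mulVec_pos h
    simp only [star_trivial] at this
    positivity

theorem hasDerivWithinAt_lyapunov (p : Params) {K : Mat3} (hK : K.PosDef) (κ : ℝ) (m : Mode)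
    {c : Vec3} {P : ℝ → Mat3} {e : ℝ → Vec3} {S : Set ℝ} {t : ℝ}
    (hP : MatHasDerivWithinAt P (P t * hat (e t)) S t)
    (he : HasDerivWithinAt e (K⁻¹ *ᵥ errorTorque p K m c (P t) (e t)) S t) :
    HasDerivWithinAt (fun s => lyapunov p K κ m (P s) (e s))
      (lyapunovRate p K κ m c (P t) (e t)) S t := by
  have hKT := PosDef.transpose_eq hK
  have hV := hasDerivWithinAt_energy p hK m (c := c) (χ := 1) (by simpa using hP)
    (by simpa using he)
  have hX := hasDerivWithinAt_dotProduct (hasDerivWithinAt_modeGradient p m hP)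
    (hasDerivWithinAt_const_mulVec K he)
  have hE := (hasDerivWithinAt_kinetic hKT he).const_add 1
  have hne : 1 + kinetic K (e t) ≠ 0 := by linarith [kinetic_nonneg hK (e t)]
  refine (hV.add ((hX.div hE hne).const_mul κ)).congr_deriv ?_
  rw [Matrix.mulVec_mulVec, PosDef.mul_inv hK, Matrix.one_mulVec, dotProduct_errorTorque p hKT]
  simp only [lyapunovRate, one_mul]

/-- By linearity one constant serves both at `P`, with `s = 1`, and at `P * hat e`, with `s = 2 *
eucNorm e`. -/
theorem exists_eucNorm_modeGradient_le (p : Params) :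
    ∃ G > 0, ∀ m (A : Mat3) (s : ℝ), (∀ i j, |A i j| ≤ s) →
      eucNorm (modeGradient p m A) ≤ G * s := by
  refine ⟨3 * ((|p.k₁| + |p.k₂|) * (1 + |p.β|) + 1), by positivity, fun m A s hA => ?_⟩
  rw [mul_assoc]
  refine eucNorm_le_of_abs_le fun i => ?_
  have hs : 0 ≤ s := (abs_nonneg _).trans (hA 0 0)
  have n1 := abs_nonneg p.k₁
  have n2 := abs_nonneg p.k₂
  have n3 := abs_nonneg p.β
  have hk : ∀ k i j, |k * A i j| ≤ |k| * s := fun k i j => by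
    rw [abs_mul]; exact mul_le_mul_of_nonneg_left (hA i j) (abs_nonneg _)
  have e : ((|p.k₁| + |p.k₂|) * (1 + |p.β|) + 1) * s = |p.k₁| * s + |p.k₂| * s
      + |p.k₁ * p.β| * s + |p.k₂ * p.β| * s + s := by simp only [abs_mul]; ring
  rw [e]
  have q1 : 0 ≤ |p.k₁| * s := by positivity
  have q2 : 0 ≤ |p.k₂| * s := by positivity
  have q3 : 0 ≤ |p.k₁ * p.β| * s := by positivity
  have q4 : 0 ≤ |p.k₂ * p.β| * s := by positivity
  cases m <;> fin_cases i <;> simp only [modeGradient, Fin.zero_eta, Fin.mk_one, Fin.reduceFinMk,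
    Matrix.cons_val, neg_mul, abs_neg]
  · linarith [hk p.k₂ 1 2]
  · linarith [hk p.k₁ 0 2]
  · refine (abs_add_le _ _).trans ?_
    rw [abs_neg]; linarith [hk p.k₁ 0 1, hk p.k₂ 1 0]
  · linarith [hk (p.k₂ * p.β) 2 2]
  · linarith [hk p.k₁ 0 2]
  · refine (abs_sub _ _).trans ?_
    rw [abs_neg]; linarith [hk p.k₁ 0 1, hk (p.k₂ * p.β) 2 0]
  · linarith [hk p.k₂ 1 2]
  · linarith [hk (p.k₁ * p.β) 2 2]
  · refine (abs_add_le _ _).trans ?_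
    linarith [hk (p.k₁ * p.β) 2 1, hk p.k₂ 1 0]

theorem abs_mul_hat_apply_le {P : Mat3} (hP : P ∈ SO3) (e : Vec3) (i j : Fin 3) :
    |(P * hat e) i j| ≤ 2 * eucNorm e := by
  have h : ∀ k l, |P i k * e l| ≤ eucNorm e := fun k l => by
    rw [abs_mul]
    exact (mul_le_of_le_one_left (abs_nonneg _) (SO3.abs_apply_le hP i k)).trans
      (abs_apply_le_eucNorm e l)
  have h' := fun k l => abs_le.1 (h k l)
  rw [Matrix.mul_apply, Fin.sum_univ_three, abs_le]
  fin_cases j <;> simp [hat] <;> constructor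
  · linarith [h' 1 2, h' 2 1, (h' 1 2).1, (h' 2 1).2]
  · linarith [(h' 1 2).2, (h' 2 1).1]
  · linarith [(h' 0 2).2, (h' 2 0).1]
  · linarith [(h' 0 2).1, (h' 2 0).2]
  · linarith [(h' 0 1).1, (h' 1 0).2]
  · linarith [(h' 0 1).2, (h' 1 0).1]

/-- The torque contains `-h`, the source of the good term. The three products bilinear in `e` and
the reference velocity give `3 * L * B`, damping gives `kΩ`, and `e ⨯₃ K e` gives the term quadratic
in `e`. -/
theorem dotProduct_errorTorque_le {p : Params} (hkΩ : 0 < p.kΩ) {K : Mat3} {L B : ℝ}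
    (hL0 : 0 < L) (hL : ∀ x, eucNorm (K *ᵥ x) ≤ L * eucNorm x) (m : Mode) {c : Vec3}
    (hc : eucNorm c ≤ B) {P : Mat3} (hP : P ∈ SO3) (e : Vec3) :
    modeGradient p m P ⬝ᵥ errorTorque p K m c P e ≤
      -eucNorm (modeGradient p m P) ^ 2
        + (p.kΩ + 3 * L * B) * (eucNorm e * eucNorm (modeGradient p m P))
        + L * eucNorm (modeGradient p m P) * eucNorm e ^ 2 := by
  set h := modeGradient p m P with hh
  set w := Pᵀ *ᵥ c with hw
  have hwB : eucNorm w ≤ B := by rw [hw, eucNorm_mulVec_SO3 (SO3.transpose_mem hP)]; exact hc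
  have na := eucNorm_nonneg e
  have nh := eucNorm_nonneg h
  have nw := eucNorm_nonneg w
  have hB : 0 ≤ B := nw.trans hwB
  have t1 : |h ⬝ᵥ e ⨯₃ (K *ᵥ e)| ≤ eucNorm h * (eucNorm e * (L * eucNorm e)) :=
    (abs_dotProduct_le _ _).trans (mul_le_mul_of_nonneg_left ((eucNorm_cross_le _ _).trans
      (mul_le_mul_of_nonneg_left (hL e) na)) nh)
  have t2 : |h ⬝ᵥ e ⨯₃ (K *ᵥ w)| ≤ eucNorm h * (eucNorm e * (L * B)) :=
    (abs_dotProduct_le _ _).trans (mul_le_mul_of_nonneg_left ((eucNorm_cross_le _ _).trans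
      (mul_le_mul_of_nonneg_left ((hL w).trans (by gcongr)) na)) nh)
  have t3 : |h ⬝ᵥ w ⨯₃ (K *ᵥ e)| ≤ eucNorm h * (B * (L * eucNorm e)) :=
    (abs_dotProduct_le _ _).trans (mul_le_mul_of_nonneg_left ((eucNorm_cross_le _ _).trans
      (mul_le_mul hwB (hL e) (eucNorm_nonneg _) hB)) nh)
  have t4 : |h ⬝ᵥ K *ᵥ (e ⨯₃ w)| ≤ eucNorm h * (L * (eucNorm e * B)) :=
    (abs_dotProduct_le _ _).trans (mul_le_mul_of_nonneg_left ((hL _).trans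
      (mul_le_mul_of_nonneg_left ((eucNorm_cross_le _ _).trans
        (mul_le_mul_of_nonneg_left hwB na)) hL0.le)) nh)
  have t5 : |h ⬝ᵥ e| ≤ eucNorm h * eucNorm e := abs_dotProduct_le _ _
  have t6 : p.kΩ * -(h ⬝ᵥ e) ≤ p.kΩ * (eucNorm h * eucNorm e) :=
    mul_le_mul_of_nonneg_left (by linarith [(abs_le.1 t5).1]) hkΩ.le
  simp only [errorTorque, dotProduct_sub, dotProduct_add, dotProduct_neg, dotProduct_smul,
    smul_eq_mul, ← hh, ← hw]
  rw [← eucNorm_sq h]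
  linarith [(abs_le.1 t1).1, (abs_le.1 t2).1, (abs_le.1 t3).1, (abs_le.1 t4).2]

/-- The scalar inequality behind the decay of the Lyapunov function. -/
theorem decay_inequality {a η E X X' E' k C₁ C₂ C₃ L Hm Ca κ : ℝ}
    (hη : 0 ≤ η) (ha : 0 ≤ a) (hE : 0 ≤ E) (hL : 0 < L) (hk : 0 < k) (hκ : 0 < κ)
    (hX : |X| ≤ L * (a * η)) (hE' : |E'| ≤ a * η + k * a ^ 2) (hηm : η ≤ Hm)
    (hX' : X' ≤ C₁ * a ^ 2 + C₂ * (a * η) - η ^ 2) (haE : a ≤ Ca * (1 + E)) (hC₁ : 0 ≤ C₁)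
    (hC₃ : C₁ + C₂ ^ 2 / 2 + L * Hm ^ 2 + L * Hm * k * Ca ≤ C₃) (hκC : κ * C₃ ≤ k / 2) :
    -(k * a ^ 2) + κ * ((X' * (1 + E) - X * E') / (1 + E) ^ 2) ≤
      -(k / 2 * a ^ 2) - κ / 2 * (η ^ 2 / (1 + E)) := by
  have hD : 0 < 1 + E := by linarith
  have hHm : 0 ≤ Hm := hη.trans hηm
  have hCa : 0 ≤ Ca := by
    by_contra h
    nlinarith
  -- Young's inequality splits `C₂ * (a * η)`; the denominator is dropped from the `a ^ 2` part but
  -- kept under `η ^ 2`.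
  have s1 : X' / (1 + E) ≤ (C₁ + C₂ ^ 2 / 2) * a ^ 2 - 1 / 2 * (η ^ 2 / (1 + E)) := by
    have h1 : X' ≤ (C₁ + C₂ ^ 2 / 2) * a ^ 2 - 1 / 2 * η ^ 2 := by
      nlinarith [sq_nonneg (C₂ * a - η)]
    have h2 : (C₁ + C₂ ^ 2 / 2) * a ^ 2 / (1 + E) ≤ (C₁ + C₂ ^ 2 / 2) * a ^ 2 :=
      div_le_self (by positivity) (by linarith)
    calc X' / (1 + E) ≤ ((C₁ + C₂ ^ 2 / 2) * a ^ 2 - 1 / 2 * η ^ 2) / (1 + E) := by gcongr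
      _ = (C₁ + C₂ ^ 2 / 2) * a ^ 2 / (1 + E) - 1 / 2 * (η ^ 2 / (1 + E)) := by ring
      _ ≤ _ := by linarith
  have s2 : -(X * E') / (1 + E) ^ 2 ≤ (L * Hm ^ 2 + L * Hm * k * Ca) * a ^ 2 := by
    have h1 : -(X * E') ≤ L * (a * η) * (a * η + k * a ^ 2) := by
      refine (neg_le_abs _).trans ?_
      rw [abs_mul]
      exact mul_le_mul hX hE' (abs_nonneg _) (by positivity)
    rw [div_le_iff₀ (by positivity)]
    have h2 : L * (a * η) * (a * η) ≤ L * Hm ^ 2 * a ^ 2 * (1 + E) ^ 2 := by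
      have : L * (a * η) * (a * η) ≤ L * (a * Hm) * (a * Hm) := by gcongr
      have h1D : 1 ≤ (1 + E) ^ 2 := one_le_pow₀ (by linarith)
      have := le_mul_of_one_le_right (show 0 ≤ L * Hm ^ 2 * a ^ 2 by positivity) h1D
      nlinarith
    -- This term is cubic in `a`: one factor is traded for `Ca * (1 + E)`, which the squared
    -- denominator of the quotient rule absorbs.
    have h3 : L * (a * η) * (k * a ^ 2) ≤ L * Hm * k * Ca * a ^ 2 * (1 + E) ^ 2 := by
      calc L * (a * η) * (k * a ^ 2) ≤ L * (Ca * (1 + E) * Hm) * (k * a ^ 2) := by gcongr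
        _ = L * Hm * k * Ca * a ^ 2 * (1 + E) := by ring
        _ ≤ L * Hm * k * Ca * a ^ 2 * (1 + E) ^ 2 := by
          gcongr
          nlinarith
    nlinarith
  have e : (X' * (1 + E) - X * E') / (1 + E) ^ 2 =
      X' / (1 + E) + -(X * E') / (1 + E) ^ 2 := by field_simp; ring
  have s3 : (X' * (1 + E) - X * E') / (1 + E) ^ 2 ≤ C₃ * a ^ 2 - 1 / 2 * (η ^ 2 / (1 + E)) := by
    rw [e]
    nlinarith [sq_nonneg a]
  have s4 := mul_le_mul_of_nonneg_left s3 hκ.le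
  nlinarith [sq_nonneg a]

/-- Properties of a weight `κ` of the cross term that make `lyapunov` a strict Lyapunov function with
decay rate `r` for the hybrid error dynamics with reference angular velocity bounded by `B`. -/
structure IsLyapunovWeight (p : Params) (K : Mat3) (B κ r : ℝ) : Prop where
  lower : ∀ m, ∀ P ∈ SO3, ∀ e, energy p K m P e ≤ 2 * lyapunov p K κ m P e
  upper : ∀ m, ∀ P ∈ SO3, ∀ e, lyapunov p K κ m P e ≤ 2 * energy p K m P e
  jump : ∀ m m', ∀ P ∈ SO3, ∀ e, modePotential p m' P ≤ modePotential p m P - p.δ →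
    lyapunov p K κ m' P e ≤ lyapunov p K κ m P e
  decay : ∀ m, ∀ P ∈ SO3, ∀ e c, eucNorm c ≤ B → modePotential p m P - minPotential p P ≤ p.δ →
    lyapunovRate p K κ m c P e ≤ -(r * lyapunov p K κ m P e)

/-- Smallness of `κ` meets three separate demands: the cross term is at most half the energy, at
most `δ / 2` in absolute value, and its derivative costs at most half of the damping. The gradient
bound of the flow set then converts the remaining terms into a multiple of the Lyapunov function. -/
theorem exists_isLyapunovWeight {p : Params} (hp : p.Tuned) {K : Mat3} (hK : K.PosDef) {B : ℝ}
    (hB : 0 ≤ B) : ∃ κ > 0, ∃ r > 0, IsLyapunovWeight p K B κ r := by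
  obtain ⟨L, hL0, hL⟩ := exists_eucNorm_mulVec_le K
  obtain ⟨l, hl0, hl⟩ := PosDef.exists_lower_bound hK
  obtain ⟨G, hG0, hG⟩ := exists_eucNorm_modeGradient_le p
  obtain ⟨Cg, hCg0, hCg⟩ := exists_gradient_sq_le_modePotential hp
  obtain ⟨Cf, hCf0, hCf⟩ := exists_modePotential_le_gradient_sq hp
  have hk := hp.kΩ_pos
  have hδ := hp.δ_pos
  have hGm : ∀ m, ∀ P ∈ SO3, eucNorm (modeGradient p m P) ≤ G := fun m P hP => by
    simpa using hG m P 1 (SO3.abs_apply_le hP)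
  have hElow : ∀ e, l / 2 * eucNorm e ^ 2 ≤ kinetic K e := fun e => by
    rw [eucNorm_sq, kinetic]; linarith [hl e]
  have hEup : ∀ e, kinetic K e ≤ L / 2 * eucNorm e ^ 2 := fun e => by
    have h1 := (le_abs_self _).trans (abs_dotProduct_le e (K *ᵥ e))
    have h2 := mul_le_mul_of_nonneg_left (hL e) (eucNorm_nonneg e)
    rw [kinetic]; nlinarith
  -- From `a ≤ 1 + a ^ 2` and `a ^ 2 ≤ 2 / l * E`.
  set Ca := 1 + 2 / l with hCa
  have hCa0 : 0 < Ca := by positivity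
  have haE : ∀ e, eucNorm e ≤ Ca * (1 + kinetic K e) := fun e => by
    have hE := kinetic_nonneg hK e
    have h1 : eucNorm e ^ 2 ≤ 2 / l * kinetic K e := by
      rw [div_mul_eq_mul_div, le_div_iff₀ hl0]; linarith [hElow e]
    have h2 : eucNorm e ≤ 1 + eucNorm e ^ 2 := by nlinarith [sq_nonneg (eucNorm e - 1)]
    have h3 : 0 < 2 / l := by positivity
    rw [hCa]; nlinarith
  have hX : ∀ m P e, |modeGradient p m P ⬝ᵥ (K *ᵥ e)| ≤
      L * (eucNorm e * eucNorm (modeGradient p m P)) := fun m P e => by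
    refine (abs_dotProduct_le _ _).trans ?_
    have := mul_le_mul_of_nonneg_left (hL e) (eucNorm_nonneg (modeGradient p m P))
    linarith
  -- The first summand comes from differentiating the gradient along the motion, the second from `e
  -- ⨯₃ K e` with the gradient bounded by `G`.
  set C₁ := 2 * G * L + L * G with hC₁
  set C₂ := p.kΩ + 3 * L * B with hC₂
  set C₃ := C₁ + C₂ ^ 2 / 2 + L * G ^ 2 + L * G * p.kΩ * Ca with hC₃
  have hC₁0 : 0 < C₁ := by positivity
  have hC₃0 : 0 < C₃ := by positivity
  set c₁ := L * (1 / l + Cg / 2) with hc₁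
  have hc₁0 : 0 < c₁ := by positivity
  set c₂ := 2 * (L * (Ca * G)) with hc₂
  have hc₂0 : 0 < c₂ := by positivity
  -- In order: the decay estimate, comparability with the energy, and monotonicity at jumps.
  obtain ⟨κ, hκ0, hκ1, hκ2, hκ3⟩ : ∃ κ > 0, κ * C₃ ≤ p.kΩ / 2 ∧ κ * c₁ ≤ 1 / 2 ∧ κ * c₂ ≤ p.δ := by
    refine ⟨min (p.kΩ / 2 / C₃) (min (1 / 2 / c₁) (p.δ / c₂)), by positivity, ?_, ?_, ?_⟩
    · rw [← le_div_iff₀ hC₃0]; exact min_le_left _ _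
    · rw [← le_div_iff₀ hc₁0]; exact (min_le_right _ _).trans (min_le_left _ _)
    · rw [← le_div_iff₀ hc₂0]; exact (min_le_right _ _).trans (min_le_right _ _)
  have hcross : ∀ m, ∀ P ∈ SO3, ∀ e,
      |κ * ((modeGradient p m P ⬝ᵥ (K *ᵥ e)) / (1 + kinetic K e))| ≤ energy p K m P e / 2 := by
    intro m P hP e
    have hE := kinetic_nonneg hK e
    have hH := hCg m P hP
    rw [← eucNorm_sq] at hH
    have h1 : eucNorm e ^ 2 ≤ 2 / l * kinetic K e := by
      rw [div_mul_eq_mul_div, le_div_iff₀ hl0]; linarith [hElow e]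
    have hΨ : 0 ≤ modePotential p m P := by
      have := sq_nonneg (eucNorm (modeGradient p m P))
      by_contra h
      nlinarith
    rw [abs_mul, abs_div, abs_of_pos hκ0, abs_of_pos (by linarith : 0 < 1 + kinetic K e)]
    have h2 : |modeGradient p m P ⬝ᵥ (K *ᵥ e)| / (1 + kinetic K e) ≤
        c₁ * (kinetic K e + modePotential p m P) := by
      refine (div_le_self (abs_nonneg _) (by linarith)).trans ((hX m P e).trans ?_)
      rw [hc₁, mul_assoc]
      refine mul_le_mul_of_nonneg_left ?_ hL0.le
      have h3 : 0 ≤ 1 / l * modePotential p m P := by positivity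
      have h4 : 0 ≤ Cg / 2 * kinetic K e := by positivity
      have h5 : 2 / l * kinetic K e = 2 * (1 / l * kinetic K e) := by ring
      nlinarith [sq_nonneg (eucNorm e - eucNorm (modeGradient p m P))]
    have h3 := mul_le_mul_of_nonneg_left h2 hκ0.le
    rw [← mul_assoc] at h3
    have h4 := mul_le_mul_of_nonneg_right hκ2 (add_nonneg hE hΨ)
    rw [energy]
    linarith
  have hcross' : ∀ m, ∀ P ∈ SO3, ∀ e,
      |κ * ((modeGradient p m P ⬝ᵥ (K *ᵥ e)) / (1 + kinetic K e))| ≤ p.δ / 2 := by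
    intro m P hP e
    have hE := kinetic_nonneg hK e
    have hD : 0 < 1 + kinetic K e := by linarith
    rw [abs_mul, abs_div, abs_of_pos hκ0, abs_of_pos hD]
    -- Saturation at work: `|e|` grows no faster than `1 + E`, so the bound does not depend on `e`.
    have h2 : |modeGradient p m P ⬝ᵥ (K *ᵥ e)| / (1 + kinetic K e) ≤ c₂ / 2 := by
      rw [div_le_iff₀ hD]
      refine (hX m P e).trans ?_
      calc L * (eucNorm e * eucNorm (modeGradient p m P))
          ≤ L * (Ca * (1 + kinetic K e) * G) := by
            have := haE e
            have := hGm m P hP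
            have := eucNorm_nonneg (modeGradient p m P)
            gcongr
        _ = c₂ / 2 * (1 + kinetic K e) := by rw [hc₂]; ring
    have h3 := mul_le_mul_of_nonneg_left h2 hκ0.le
    linarith
  have hupper : ∀ m, ∀ P ∈ SO3, ∀ e, lyapunov p K κ m P e ≤ 2 * energy p K m P e := by
    intro m P hP e
    have h := hcross m P hP e
    have h2 := abs_nonneg (κ * ((modeGradient p m P ⬝ᵥ (K *ᵥ e)) / (1 + kinetic K e)))
    rw [lyapunov]
    linarith [(abs_le.1 h).2]
  set A := L / 2 + Cf * (G ^ 2 * (L / 2)) with hA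
  have hA0 : 0 < A := by positivity
  -- The two conditions match the dissipation `kΩ / 2 * |e|²` and `κ / 2 * y` against `r` times
  -- twice the energy bound `A * |e|² + Cf * y`.
  obtain ⟨r, hr0, hr1, hr2⟩ : ∃ r > 0, r * (2 * A) ≤ p.kΩ / 2 ∧ r * (2 * Cf) ≤ κ / 2 := by
    refine ⟨min (p.kΩ / 2 / (2 * A)) (κ / 2 / (2 * Cf)), by positivity, ?_, ?_⟩
    · rw [← le_div_iff₀ (by positivity)]; exact min_le_left _ _
    · rw [← le_div_iff₀ (by positivity)]; exact min_le_right _ _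
  refine ⟨κ, hκ0, r, hr0, ?_, hupper, ?_, ?_⟩
  · intro m P hP e
    have h := hcross m P hP e
    rw [lyapunov]
    linarith [(abs_le.1 h).1]
  · intro m m' P hP e hlt
    have h1 := (abs_le.1 (hcross' m P hP e)).1
    have h2 := (abs_le.1 (hcross' m' P hP e)).2
    simp only [lyapunov, energy]
    linarith
  · intro m P hP e c hc hflow
    have hE := kinetic_nonneg hK e
    have hD : 0 < 1 + kinetic K e := by linarith
    set h := modeGradient p m P with hh
    have na := eucNorm_nonneg e
    have nη := eucNorm_nonneg h
    have hX' : modeGradient p m (P * hat e) ⬝ᵥ (K *ᵥ e) + h ⬝ᵥ errorTorque p K m c P e ≤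
        C₁ * eucNorm e ^ 2 + C₂ * (eucNorm e * eucNorm h) - eucNorm h ^ 2 := by
      have h1 := dotProduct_errorTorque_le hk hL0 hL m hc hP e
      rw [← hh] at h1
      have h2 : modeGradient p m (P * hat e) ⬝ᵥ (K *ᵥ e) ≤
          G * (2 * eucNorm e) * (L * eucNorm e) := by
        refine (le_abs_self _).trans ((abs_dotProduct_le _ _).trans ?_)
        exact mul_le_mul (hG m _ _ (abs_mul_hat_apply_le hP e)) (hL e) (eucNorm_nonneg _)
          (by positivity)
      have h3 : L * eucNorm h * eucNorm e ^ 2 ≤ L * G * eucNorm e ^ 2 := by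
        have := hGm m P hP
        gcongr
      rw [hC₁]
      linarith
    have hE' : |-(h ⬝ᵥ e) - p.kΩ * (e ⬝ᵥ e)| ≤ eucNorm e * eucNorm h + p.kΩ * eucNorm e ^ 2 := by
      refine (abs_sub _ _).trans ?_
      rw [abs_neg, ← eucNorm_sq, abs_of_nonneg (by positivity : 0 ≤ p.kΩ * eucNorm e ^ 2)]
      linarith [abs_dotProduct_le h e]
    have key := decay_inequality nη na hE hL0 hk hκ0 (hX m P e) hE' (hGm m P hP) hX' (haE e)
      hC₁0.le hC₃.ge hκ1
    have hrate : lyapunovRate p K κ m c P e ≤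
        -(p.kΩ / 2 * eucNorm e ^ 2) - κ / 2 * (eucNorm h ^ 2 / (1 + kinetic K e)) := by
      rw [lyapunovRate, ← hh]
      rw [← eucNorm_sq e] at key ⊢
      exact key
    set y := eucNorm h ^ 2 / (1 + kinetic K e) with hy
    have hy0 : 0 ≤ y := by positivity
    -- Undoing the saturation: `|h|² = y + y * E`, where `y ≤ G ^ 2` and `E ≤ L / 2 * |e|²`.
    have hη : eucNorm h ^ 2 ≤ y + G ^ 2 * (L / 2) * eucNorm e ^ 2 := by
      have e1 : eucNorm h ^ 2 = y * (1 + kinetic K e) := by rw [hy]; field_simp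
      have e2 : y ≤ G ^ 2 := by
        refine (div_le_self (by positivity) (by linarith)).trans ?_
        exact pow_le_pow_left₀ nη (hGm m P hP) 2
      have e3 := mul_le_mul e2 (hEup e) hE (by positivity)
      linarith
    have hV : energy p K m P e ≤ A * eucNorm e ^ 2 + Cf * y := by
      have h1 := hCf m P hP hflow
      rw [← hh, ← eucNorm_sq h] at h1
      have h2 := mul_le_mul_of_nonneg_left hη hCf0.le
      rw [energy, hA]
      linarith [hEup e]
    have h1 := mul_le_mul_of_nonneg_left (hupper m P hP e) hr0.le
    have h2 := mul_le_mul_of_nonneg_left hV (by positivity : 0 ≤ r * 2)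
    have h3 := mul_le_mul_of_nonneg_right hr1 (sq_nonneg (eucNorm e))
    have h4 := mul_le_mul_of_nonneg_right hr2 hy0
    linarith

end AttitudeTracking

end

noncomputable section

/-! ### Global solutions of bounded Lipschitz differential equations -/

-- Boundedness lets Picard–Lindelöf run on arbitrarily long intervals. The solutions on `[t₁, t₁ + n
-- + 1]` agree where they overlap, by uniqueness, and are glued.
open Set in
theorem exists_forall_ge_hasDerivWithinAt_of_lipschitzWith {Y : Type*} [NormedAddCommGroup Y]
    [NormedSpace ℝ Y] [CompleteSpace Y] {f : ℝ → Y → Y} {C L : NNReal} {t₁ : ℝ}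
    (hLip : ∀ t, t₁ ≤ t → LipschitzWith C (f t)) (hcont : ∀ y, ContinuousOn (f · y) (Ici t₁))
    (hbd : ∀ t, t₁ ≤ t → ∀ y, ‖f t y‖ ≤ L) (y₀ : Y) :
    ∃ α : ℝ → Y, α t₁ = y₀ ∧
      ∀ t, t₁ ≤ t → HasDerivWithinAt α (f t (α t)) (Ici t₁) t := by
  have hloc : ∀ n : ℕ, ∃ α : ℝ → Y, α t₁ = y₀ ∧ ∀ t ∈ Icc t₁ (t₁ + n + 1),
      HasDerivWithinAt α (f t (α t)) (Icc t₁ (t₁ + n + 1)) t := by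
    intro n
    have hmem : t₁ ∈ Icc t₁ (t₁ + n + 1) := ⟨le_rfl, by linarith [n.cast_nonneg (α := ℝ)]⟩
    -- The radius is the speed bound times the length `n + 1`, so the solution cannot leave the
    -- ball.
    have hPL : IsPicardLindelof f (⟨t₁, hmem⟩ : Icc t₁ (t₁ + n + 1)) y₀ (L * (n + 1)) 0 L C := by
      refine ⟨fun t ht => (hLip t ht.1).lipschitzOnWith,
        fun y _ => (hcont y).mono Icc_subset_Ici_self, fun t ht y _ => hbd t ht.1 y, ?_⟩
      have h0 : (0 : ℝ) ≤ n + 1 := by positivity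
      have : max (t₁ + n + 1 - t₁) (t₁ - t₁) = (n : ℝ) + 1 := by
        rw [sub_self, max_eq_left (by linarith)]; ring
      simp only [this]
      push_cast
      simp
    exact hPL.exists_eq_forall_mem_Icc_hasDerivWithinAt₀
  choose α hα₀ hα using hloc
  have hright : ∀ n : ℕ, ∀ b ≤ t₁ + n + 1, ContinuousOn (α n) (Icc t₁ b) ∧
      ∀ t ∈ Ico t₁ b, HasDerivWithinAt (α n) (f t (α n t)) (Ici t) t := by
    intro n b hb
    refine ⟨fun t ht => ((hα n t ⟨ht.1, ht.2.trans hb⟩).continuousWithinAt).mono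
      (Icc_subset_Icc_right hb), fun t ht => ?_⟩
    refine ((hα n t ⟨ht.1, ht.2.le.trans hb⟩).mono (Icc_subset_Icc_left ht.1)).mono_of_mem_nhdsWithin
      (Icc_mem_nhdsGE (lt_of_lt_of_le ht.2 hb))
  have huniq : ∀ (n k : ℕ) t, t₁ ≤ t → t ≤ t₁ + n + 1 → t ≤ t₁ + k + 1 → α n t = α k t := by
    intro n k t ht hn hk
    obtain ⟨c1, d1⟩ := hright n t hn
    obtain ⟨c2, d2⟩ := hright k t hk
    exact ODE_solution_unique_of_mem_Icc_right (v := f) (s := fun _ => univ)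
      (fun s hs => (hLip s hs.1).lipschitzOnWith) c1 d1 (fun _ _ => trivial) c2 d2
      (fun _ _ => trivial) ((hα₀ n).trans (hα₀ k).symm) ⟨ht, le_rfl⟩
  have hglue : ∀ (n : ℕ) t, t₁ ≤ t → t ≤ t₁ + n + 1 → α ⌊t - t₁⌋₊ t = α n t := fun n t ht hn =>
    huniq _ _ t ht (by linarith [Nat.lt_floor_add_one (t - t₁)]) hn
  -- The floor gives `t < t₁ + n + 1` strictly, so the chosen interval is a neighborhood of `t`
  -- within `Ici t₁`.
  refine ⟨fun t => α ⌊t - t₁⌋₊ t, hα₀ _, fun t ht => ?_⟩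
  set n := ⌊t - t₁⌋₊ with hn
  have hlt : t < t₁ + n + 1 := by linarith [Nat.lt_floor_add_one (t - t₁)]
  have h := hα n t ⟨ht, hlt.le⟩
  have h2 := h.congr (fun s hs => hglue n s hs.1 hs.2) (hglue n t ht hlt.le)
  refine h2.mono_of_mem_nhdsWithin ?_
  rw [← Ici_inter_Iic]
  exact inter_mem_nhdsWithin _ (Iic_mem_nhds hlt)

theorem eq_of_forall_hasDerivWithinAt_zero {S : Set ℝ} (hS : Convex ℝ S) {f : ℝ → ℝ}
    (hf : ∀ t ∈ S, HasDerivWithinAt f 0 S t) {a b : ℝ} (ha : a ∈ S) (hb : b ∈ S) : f a = f b := by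
  have hc : ContinuousOn f S := fun t ht => (hf t ht).continuousWithinAt
  have hi : ∀ t ∈ interior S, HasDerivWithinAt f 0 (interior S) t := fun t ht =>
    (hf t (interior_subset ht)).mono interior_subset
  have h1 := antitoneOn_of_hasDerivWithinAt_nonpos hS hc hi (fun _ _ => le_rfl)
  have h2 := monotoneOn_of_hasDerivWithinAt_nonneg hS hc hi (fun _ _ => le_rfl)
  rcases le_total a b with h | h
  · exact le_antisymm (h2 ha hb h) (h1 ha hb h)
  · exact le_antisymm (h1 hb ha h) (h2 hb ha h)

namespace AttitudeTracking

/-! ### Flows of the error dynamics -/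

theorem hat_transpose (v : Vec3) : (hat v)ᵀ = -hat v := by
  ext i j
  fin_cases i <;> fin_cases j <;> simp [hat]

theorem hat_smul (s : ℝ) (v : Vec3) : hat (s • v) = s • hat v := by
  ext i j
  fin_cases i <;> fin_cases j <;> simp [hat]

/-- The rotation group is invariant under the attitude kinematics. -/
theorem mem_SO3_of_kinematics {S : Set ℝ} (hS : Convex ℝ S) {P : ℝ → Mat3} {v : ℝ → Vec3}
    (hP : ∀ t ∈ S, MatHasDerivWithinAt P (P t * hat (v t)) S t) {a b : ℝ} (ha : a ∈ S)
    (hb : b ∈ S) (h : P a ∈ SO3) : P b ∈ SO3 := by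
  rw [mem_SO3_iff] at h ⊢
  constructor
  · rw [← h.1]
    ext i j
    refine (eq_of_forall_hasDerivWithinAt_zero hS (f := fun t => (P t * (P t)ᵀ) i j)
      (fun t ht => ?_) ha hb).symm
    refine ((hP t ht).mul (hP t ht).transpose i j).congr_deriv ?_
    rw [Matrix.transpose_mul, hat_transpose, Matrix.mul_assoc, Matrix.neg_mul, Matrix.mul_neg]
    simp
  -- The determinant has derivative `det P * tr (hat v)`, which vanishes; this is checked on the
  -- six-term expansion.
  · rw [← h.2]
    refine (eq_of_forall_hasDerivWithinAt_zero hS (f := fun t => (P t).det)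
      (fun t ht => ?_) ha hb).symm
    simp only [Matrix.det_fin_three]
    have d := hP t ht
    refine ((((((((d 0 0).fun_mul (d 1 1)).fun_mul (d 2 2)).sub
      (((d 0 0).fun_mul (d 1 2)).fun_mul (d 2 1))).sub
      (((d 0 1).fun_mul (d 1 0)).fun_mul (d 2 2))).add
      (((d 0 1).fun_mul (d 1 2)).fun_mul (d 2 0))).add
      (((d 0 2).fun_mul (d 1 0)).fun_mul (d 2 1))).sub
      (((d 0 2).fun_mul (d 1 1)).fun_mul (d 2 0))).congr_deriv ?_
    simp [Matrix.mul_apply, Fin.sum_univ_three, hat]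
    ring

/-- Attitude and angular velocity errors, as a normed space. -/
abbrev ErrSpace := (Fin 3 → Fin 3 → ℝ) × Vec3

/-- The error vector field, with the reference angular velocity as a parameter. -/
def errorField (p : Params) (K : Mat3) (m : Mode) (z : Vec3 × ErrSpace) : ErrSpace :=
  (fun i j => (Matrix.of z.2.1 * hat z.2.2) i j,
    K⁻¹ *ᵥ errorTorque p K m z.1 (Matrix.of z.2.1) z.2.2)

theorem contDiff_errorField (p : Params) (K : Mat3) (m : Mode) :
    ContDiff ℝ ∞ (errorField p K m) := by
  have hmv : ∀ (A : Mat3) {v : Vec3 × ErrSpace → Vec3}, ContDiff ℝ ∞ v →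
      ContDiff ℝ ∞ (fun z => A *ᵥ v z) := fun A v hv =>
    (Matrix.mulVecLin A).toContinuousLinearMap.contDiff.comp hv
  have hcr : ∀ {u v : Vec3 × ErrSpace → Vec3}, ContDiff ℝ ∞ u → ContDiff ℝ ∞ v →
      ContDiff ℝ ∞ (fun z => u z ⨯₃ v z) := fun {u v} hu hv => by
    rw [contDiff_pi] at hu hv ⊢
    have h := fun i j => (hu i).mul (hv j)
    intro i
    fin_cases i <;> simp [cross_apply]
    · exact (h 1 2).sub (h 2 1)
    · exact (h 2 0).sub (h 0 2)
    · exact (h 0 1).sub (h 1 0)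
  have he : ContDiff ℝ ∞ (fun z : Vec3 × ErrSpace => z.2.2) := by fun_prop
  have hPij : ∀ i j, ContDiff ℝ ∞ (fun z : Vec3 × ErrSpace => z.2.1 i j) := fun i j => by fun_prop
  have hei : ∀ i, ContDiff ℝ ∞ (fun z : Vec3 × ErrSpace => z.2.2 i) := fun i => by fun_prop
  have hw : ContDiff ℝ ∞ (fun z : Vec3 × ErrSpace => (Matrix.of z.2.1)ᵀ *ᵥ z.1) := by
    rw [contDiff_pi]
    intro i
    simp only [Matrix.mulVec, dotProduct, Matrix.transpose_apply, Matrix.of_apply]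
    fun_prop
  have hg : ContDiff ℝ ∞ (fun z : Vec3 × ErrSpace => modeGradient p m (Matrix.of z.2.1)) := by
    rw [contDiff_pi]
    intro i
    cases m <;> fin_cases i <;> simp [modeGradient] <;> fun_prop
  refine ContDiff.prodMk ?_ (hmv _ ?_)
  · rw [contDiff_pi]
    intro i
    rw [contDiff_pi]
    intro j
    simp only [Matrix.mul_apply, Matrix.of_apply, Fin.sum_univ_three]
    fin_cases j <;> simp [hat] <;> fun_prop
  · exact ((((((hcr he (hmv K he)).neg.sub (hcr he (hmv K hw))).sub (hcr hw (hmv K he))).add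
      (hmv K (hcr he hw))).sub hg).sub (he.const_smul p.kΩ))

/-- A bounded, globally Lipschitz field obtained from the error field by slowing it down outside a
ball. -/
theorem exists_cutoff_errorField (p : Params) (K : Mat3) (m : Mode) (R : ℝ) :
    ∃ (χ : Vec3 × ErrSpace → ℝ) (C L : NNReal), (∀ z, 0 ≤ χ z) ∧ (∀ z, ‖z‖ ≤ R → χ z = 1) ∧
      LipschitzWith C (fun z => χ z • errorField p K m z) ∧
      ∀ z, ‖χ z • errorField p K m z‖ ≤ L := by
  let f : ContDiffBump (0 : Vec3 × ErrSpace) :=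
    { rIn := max R 1, rOut := max R 1 + 1, rIn_pos := by positivity, rIn_lt_rOut := by linarith }
  have hsupp : HasCompactSupport (fun z => f z • errorField p K m z) :=
    f.hasCompactSupport.smul_right
  have hsm : ContDiff ℝ ∞ (fun z => f z • errorField p K m z) :=
    f.contDiff.smul (contDiff_errorField p K m)
  obtain ⟨C, hC⟩ := hsm.lipschitzWith_of_hasCompactSupport hsupp (by simp)
  obtain ⟨L, hL⟩ := hsupp.exists_bound_of_continuous hsm.continuous
  refine ⟨f, C, L.toNNReal, fun z => f.nonneg, fun z hz => ?_, hC,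
    fun z => (hL z).trans (Real.le_coe_toNNReal L)⟩
  refine f.one_of_mem_closedBall ?_
  rw [mem_closedBall_zero_iff]
  exact hz.trans (le_max_left _ _)

theorem modePotential_nonneg {p : Params} (hp : p.Tuned) (m : Mode) {P : Mat3} (hP : P ∈ SO3) :
    0 ≤ modePotential p m P := by
  obtain ⟨C, hC, h⟩ := exists_trace_le_modePotential hp
  have h1 := h m P hP
  have h2 := SO3.trace_le hP
  by_contra hneg
  nlinarith

theorem energy_nonneg {p : Params} (hp : p.Tuned) {K : Mat3} (hK : K.PosDef) (m : Mode) {P : Mat3}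
    (hP : P ∈ SO3) (e : Vec3) : 0 ≤ energy p K m P e :=
  add_nonneg (kinetic_nonneg hK e) (modePotential_nonneg hp m hP)

/-- The potential is nonnegative, so the energy bounds the kinetic part and with it `e`; rotations
are bounded anyway. The sublevel set therefore fits in a ball on which a cutoff can equal 1. -/
theorem exists_norm_le_of_energy_le {p : Params} (hp : p.Tuned) {K : Mat3} (hK : K.PosDef)
    (m : Mode) (B V : ℝ) :
    ∃ R, ∀ c P e, eucNorm c ≤ B → P ∈ SO3 → energy p K m P e ≤ V →
      ‖((c, ((fun i j => P i j), e)) : Vec3 × ErrSpace)‖ ≤ R := by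
  obtain ⟨l, hl, hlow⟩ := PosDef.exists_lower_bound hK
  refine ⟨max B (max 1 (Real.sqrt (2 * V / l))), fun c P e hc hP hV => ?_⟩
  have hB : 0 ≤ B := (eucNorm_nonneg c).trans hc
  have hpi : ∀ (x : Vec3), ‖x‖ ≤ eucNorm x := fun x =>
    (pi_norm_le_iff_of_nonneg (eucNorm_nonneg x)).2 (abs_apply_le_eucNorm x)
  rw [Prod.norm_mk, Prod.norm_mk]
  refine max_le_max ((hpi c).trans hc) (max_le_max ?_ ((hpi e).trans ?_))
  · rw [pi_norm_le_iff_of_nonneg zero_le_one]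
    intro i
    rw [pi_norm_le_iff_of_nonneg zero_le_one]
    exact fun j => SO3.abs_apply_le hP i j
  · refine Real.sqrt_le_sqrt ?_
    have h1 := modePotential_nonneg hp m hP
    have h2 := hlow e
    rw [energy, kinetic] at hV
    rw [le_div_iff₀ hl]
    linarith

/-- A flow of the error dynamics on the time set `S` in the mode `m`, for the reference angular
velocity `c`. -/
structure IsErrorFlow (p : Params) (K : Mat3) (c : ℝ → Vec3) (m : Mode) (S : Set ℝ) (P : ℝ → Mat3)
    (e : ℝ → Vec3) : Prop where
  mem_SO3 : ∀ t ∈ S, P t ∈ SO3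
  kinematics : ∀ t ∈ S, MatHasDerivWithinAt P (P t * hat (e t)) S t
  dynamics : ∀ t ∈ S, HasDerivWithinAt e (K⁻¹ *ᵥ errorTorque p K m (c t) (P t) (e t)) S t

theorem energy_antitoneOn {p : Params} (hk : 0 < p.kΩ) {K : Mat3} (hK : K.PosDef)
    {c : ℝ → Vec3} {m : Mode} {S : Set ℝ} (hS : Convex ℝ S) {P : ℝ → Mat3} {e : ℝ → Vec3}
    {χ : ℝ → ℝ} (hχ : ∀ t ∈ S, 0 ≤ χ t)
    (hP : ∀ t ∈ S, MatHasDerivWithinAt P (P t * hat (χ t • e t)) S t)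
    (he : ∀ t ∈ S, HasDerivWithinAt e (χ t • K⁻¹ *ᵥ errorTorque p K m (c t) (P t) (e t)) S t) :
    AntitoneOn (fun t => energy p K m (P t) (e t)) S := by
  have hd := fun t (ht : t ∈ S) => hasDerivWithinAt_energy p hK m (hP t ht) (he t ht)
  refine antitoneOn_of_hasDerivWithinAt_nonpos hS (fun t ht => (hd t ht).continuousWithinAt)
    (fun t ht => (hd t (interior_subset ht)).mono interior_subset) fun t ht => ?_
  have h1 := hχ t (interior_subset ht)
  have h2 := dotProduct_self_nonneg' (e t)
  have : 0 ≤ χ t * p.kΩ * (e t ⬝ᵥ e t) := by positivity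
  linarith

theorem IsErrorFlow.energy_antitoneOn {p : Params} (hk : 0 < p.kΩ) {K : Mat3} (hK : K.PosDef)
    {c : ℝ → Vec3} {m : Mode} {S : Set ℝ} (hS : Convex ℝ S) {P : ℝ → Mat3} {e : ℝ → Vec3}
    (h : IsErrorFlow p K c m S P e) : AntitoneOn (fun t => energy p K m (P t) (e t)) S :=
  AttitudeTracking.energy_antitoneOn hk hK hS (χ := fun _ => 1) (fun _ _ => zero_le_one)
    (by simpa using h.kinematics) (by simpa using h.dynamics)

theorem hasDerivWithinAt_errSpace {P : ℝ → Mat3} {e : ℝ → Vec3} {P' : Mat3} {e' : Vec3} {S : Set ℝ}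
    {t : ℝ} (hP : MatHasDerivWithinAt P P' S t) (he : HasDerivWithinAt e e' S t) :
    HasDerivWithinAt (fun s => ((fun i j => P s i j, e s) : ErrSpace)) (fun i j => P' i j, e') S t :=
  HasDerivWithinAt.prodMk (hasDerivWithinAt_pi.2 fun i => hasDerivWithinAt_pi.2 fun j => hP i j) he

/-- From every state there is a flow for all future times. -/
theorem exists_isErrorFlow {p : Params} (hp : p.Tuned) {K : Mat3} (hK : K.PosDef) {c : ℝ → Vec3}
    {B : ℝ} (hc : ContinuousOn c (Set.Ici 0)) (hB : ∀ t, 0 ≤ t → eucNorm (c t) ≤ B) (m : Mode)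
    {t₁ : ℝ} (ht₁ : 0 ≤ t₁) {P₁ : Mat3} (hP₁ : P₁ ∈ SO3) (e₁ : Vec3) :
    ∃ P e, P t₁ = P₁ ∧ e t₁ = e₁ ∧ IsErrorFlow p K c m (Set.Ici t₁) P e := by
  -- The cutoff scales both equations by the same `χ ≥ 0`, so the modified system still preserves
  -- SO(3) and does not increase the energy. Its solution never leaves the ball where `χ = 1`, and
  -- so solves the original system.
  obtain ⟨R, hR⟩ := exists_norm_le_of_energy_le hp hK m B (energy p K m P₁ e₁)
  obtain ⟨χ, C, L, hχ0, hχ1, hLip, hbd⟩ := exists_cutoff_errorField p K m R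
  obtain ⟨α, hα₀, hα⟩ := exists_forall_ge_hasDerivWithinAt_of_lipschitzWith
    (f := fun t y => χ (c t, y) • errorField p K m (c t, y)) (C := C) (L := L) (t₁ := t₁)
    (fun t _ => by
      have := hLip.comp (LipschitzWith.prodMk_left (β := ErrSpace) (c t))
      rw [mul_one] at this; exact this)
    (fun y => by
      refine hLip.continuous.comp_continuousOn ?_
      exact (hc.mono (Set.Ici_subset_Ici.2 ht₁)).prodMk continuousOn_const)
    (fun t _ y => hbd _) ((fun i j => P₁ i j, e₁) : ErrSpace)
  set P : ℝ → Mat3 := fun t => Matrix.of (α t).1 with hPdef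
  set e : ℝ → Vec3 := fun t => (α t).2 with hedef
  have hPd : ∀ t ∈ Set.Ici t₁,
      MatHasDerivWithinAt P (P t * hat (χ (c t, α t) • e t)) (Set.Ici t₁) t := by
    intro t ht i j
    have h1 := hasDerivWithinAt_pi.1 (hasDerivWithinAt_pi.1 (hα t ht).fst i) j
    refine h1.congr_deriv ?_
    rw [hat_smul, Matrix.mul_smul]
    rfl
  have hed : ∀ t ∈ Set.Ici t₁, HasDerivWithinAt e
      (χ (c t, α t) • K⁻¹ *ᵥ errorTorque p K m (c t) (P t) (e t)) (Set.Ici t₁) t :=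
    fun t ht => (hα t ht).snd
  have hconv : Convex ℝ (Set.Ici t₁) := convex_Ici t₁
  have hP0 : P t₁ = P₁ := by ext i j; simp [hPdef, hα₀]
  have he0 : e t₁ = e₁ := by simp [hedef, hα₀]
  have hself : t₁ ∈ Set.Ici t₁ := Set.self_mem_Ici
  have hSO : ∀ t ∈ Set.Ici t₁, P t ∈ SO3 := fun t ht =>
    mem_SO3_of_kinematics hconv hPd hself ht (hP0 ▸ hP₁)
  have hV := energy_antitoneOn hp.kΩ_pos hK (c := c) (m := m) hconv
    (fun t _ => hχ0 (c t, α t)) hPd hed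
  have hone : ∀ t ∈ Set.Ici t₁, χ (c t, α t) = 1 := fun t ht => by
    refine hχ1 _ ?_
    have h1 := hV hself ht ht
    simp only [hP0, he0] at h1
    exact hR (c t) (P t) (e t) (hB t (ht₁.trans ht)) (hSO t ht) h1
  refine ⟨P, e, hP0, he0, hSO, fun t ht => ?_, fun t ht => ?_⟩
  · simpa [hone t ht] using hPd t ht
  · simpa [hone t ht] using hed t ht

/-- Flows are determined by their initial state. -/
theorem IsErrorFlow.eq {p : Params} (hp : p.Tuned) {K : Mat3} (hK : K.PosDef) {c : ℝ → Vec3}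
    {B a b : ℝ} (hB : ∀ t ∈ Set.Icc a b, eucNorm (c t) ≤ B) {m : Mode} (hab : a ≤ b)
    {P Q : ℝ → Mat3} {e f : ℝ → Vec3} (h : IsErrorFlow p K c m (Set.Icc a b) P e)
    (h' : IsErrorFlow p K c m (Set.Icc a b) Q f) (hP : P a = Q a) (he : e a = f a) :
    P b = Q b ∧ e b = f b := by
  -- The error field is not globally Lipschitz. Both flows stay in the energy sublevel set, hence
  -- both solve the cutoff equation, for which uniqueness is available.
  obtain ⟨R, hR⟩ := exists_norm_le_of_energy_le hp hK m B (energy p K m (P a) (e a))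
  obtain ⟨χ, C, L, -, hχ1, hLip, -⟩ := exists_cutoff_errorField p K m R
  have key : ∀ {P : ℝ → Mat3} {e : ℝ → Vec3}, IsErrorFlow p K c m (Set.Icc a b) P e →
      energy p K m (P a) (e a) ≤ energy p K m (Q a) (f a) → ∀ t ∈ Set.Icc a b,
      HasDerivWithinAt (fun s => ((fun i j => P s i j, e s) : ErrSpace))
        ((fun y : ErrSpace => χ (c t, y) • errorField p K m (c t, y)) (fun i j => P t i j, e t))
        (Set.Icc a b) t := by
    intro P e hf hle t ht
    have hd := hasDerivWithinAt_errSpace (hf.kinematics t ht) (hf.dynamics t ht)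
    refine hd.congr_deriv ?_
    have hV := hf.energy_antitoneOn hp.kΩ_pos hK (convex_Icc a b)
      (Set.left_mem_Icc.2 hab) ht ht.1
    have := hχ1 _ (hR (c t) (P t) (e t) (hB t ht) (hf.mem_SO3 t ht)
      (hV.trans (hle.trans (by rw [hP, he]))))
    simp only [this, one_smul]
    rfl
  have d1 := key h (by rw [hP, he])
  have d2 := key h' le_rfl
  have hright : ∀ {g : ℝ → ErrSpace} {g' : ErrSpace} {t : ℝ}, t ∈ Set.Ico a b →
      HasDerivWithinAt g g' (Set.Icc a b) t → HasDerivWithinAt g g' (Set.Ici t) t :=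
    fun {g g' t} ht hg => (hg.mono (Set.Icc_subset_Icc_left ht.1)).mono_of_mem_nhdsWithin
      (Icc_mem_nhdsGE ht.2)
  have heq := ODE_solution_unique_of_mem_Icc_right (K := C) (s := fun _ => Set.univ)
    (v := fun t y => χ (c t, y) • errorField p K m (c t, y))
    (fun t _ => by
      have := hLip.comp (LipschitzWith.prodMk_left (β := ErrSpace) (c t))
      simp only [mul_one] at this
      exact this.lipschitzOnWith)
    (fun t ht => (d1 t ht).continuousWithinAt)
    (fun t ht => hright ht (d1 t (Set.Ico_subset_Icc_self ht))) (fun _ _ => trivial)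
    (fun t ht => (d2 t ht).continuousWithinAt)
    (fun t ht => hright ht (d2 t (Set.Ico_subset_Icc_self ht))) (fun _ _ => trivial)
    (by simp [hP, he]) (Set.right_mem_Icc.2 hab)
  have h1 := congrArg Prod.fst heq
  have h2 := congrArg Prod.snd heq
  refine ⟨?_, h2⟩
  ext i j
  exact congrFun (congrFun h1 i) j

end AttitudeTracking

end

noncomputable section

namespace AttitudeTracking

/-! ### Rotations and the cross product -/

/-- For any matrix `Pᵀ (P x ⨯₃ P y) = det P • (x ⨯₃ y)`; for a rotation `Pᵀ` is inverted by `P`. -/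
theorem mulVec_cross {P : Mat3} (hP : P ∈ SO3) (x y : Vec3) :
    P *ᵥ (x ⨯₃ y) = (P *ᵥ x) ⨯₃ (P *ᵥ y) := by
  have h : Pᵀ *ᵥ ((P *ᵥ x) ⨯₃ (P *ᵥ y)) = P.det • (x ⨯₃ y) := by
    ext i
    fin_cases i <;> simp [Matrix.mulVec, dotProduct, Fin.sum_univ_three, cross_apply,
      Matrix.det_fin_three] <;> ring
  rw [SO3.det_eq_one hP, one_smul] at h
  rw [← h, Matrix.mulVec_mulVec, SO3.mul_transpose hP, Matrix.one_mulVec]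

theorem hat_mulVec_mul {P : Mat3} (hP : P ∈ SO3) (v : Vec3) :
    hat (P *ᵥ v) * P = P * hat v := by
  refine Matrix.ext_of_mulVec_single fun i => ?_
  rw [← Matrix.mulVec_mulVec, ← Matrix.mulVec_mulVec, hat_mulVec, hat_mulVec, mulVec_cross hP]

theorem hat_add (u v : Vec3) : hat (u + v) = hat u + hat v := by
  ext i j
  fin_cases i <;> fin_cases j <;> simp [hat] <;> ring

theorem hat_sub (u v : Vec3) : hat (u - v) = hat u - hat v := by
  ext i j
  fin_cases i <;> fin_cases j <;> simp [hat] <;> ring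

/-! ### Error coordinates -/

/-- The rotation with columns `b₁, b₂, b₁ ⨯₃ b₂`. -/
def frame (p : Params) : Mat3 := (Matrix.of ![p.b₁, p.b₂, p.b₁ ⨯₃ p.b₂])ᵀ

/-- The attitude error matrix in the frame of the body-fixed directions. -/
def attErr (p : Params) (ref : Reference) (t : ℝ) (R : Mat3) : Mat3 :=
  (frame p)ᵀ * (ref.Rd t)ᵀ * R * frame p

/-- The angular velocity error in the frame of the body-fixed directions. -/
def velErr (p : Params) (ref : Reference) (t : ℝ) (x : State) : Vec3 :=
  (frame p)ᵀ *ᵥ eΩ ref t x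

/-- The inertia matrix in the frame of the body-fixed directions. -/
def frameInertia (p : Params) : Mat3 := (frame p)ᵀ * p.J * frame p

/-- The reference angular velocity in the frame of the desired directions. -/
def refVel (p : Params) (ref : Reference) (t : ℝ) : Vec3 :=
  (frame p)ᵀ *ᵥ ((ref.Rd t)ᵀ *ᵥ ref.ωd t)

/-- The hypotheses on the body-fixed directions. -/
structure Params.Orthonormal (p : Params) : Prop where
  b₁_sq : p.b₁ ⬝ᵥ p.b₁ = 1
  b₂_sq : p.b₂ ⬝ᵥ p.b₂ = 1
  b₁_b₂ : p.b₁ ⬝ᵥ p.b₂ = 0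

theorem frame_transpose_zero (p : Params) : (frame p)ᵀ 0 = p.b₁ := rfl

theorem frame_transpose_one (p : Params) : (frame p)ᵀ 1 = p.b₂ := rfl

theorem frame_transpose_two (p : Params) : (frame p)ᵀ 2 = p.b₁ ⨯₃ p.b₂ := rfl

theorem frame_mem_SO3 {p : Params} (hb : p.Orthonormal) : frame p ∈ SO3 := by
  have h : (frame p)ᵀ ∈ SO3 := by
    rw [mem_SO3_iff]
    have h3 : (p.b₁ ⨯₃ p.b₂) ⬝ᵥ (p.b₁ ⨯₃ p.b₂) = 1 := by
      rw [cross_dot_cross, hb.b₁_sq, hb.b₂_sq, hb.b₁_b₂]; ring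
    constructor
    · ext i j
      have : ((frame p)ᵀ * (frame p)ᵀᵀ) i j = (frame p)ᵀ i ⬝ᵥ (frame p)ᵀ j := rfl
      rw [this]
      have h21 : p.b₂ ⬝ᵥ p.b₁ = 0 := by rw [dotProduct_comm, hb.b₁_b₂]
      have h31 : (p.b₁ ⨯₃ p.b₂) ⬝ᵥ p.b₁ = 0 := by rw [dotProduct_comm, dot_self_cross]
      have h32 : (p.b₁ ⨯₃ p.b₂) ⬝ᵥ p.b₂ = 0 := by rw [dotProduct_comm, dot_cross_self]
      fin_cases i <;> fin_cases j <;> simp only [Fin.zero_eta, Fin.mk_one, Fin.reduceFinMk,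
        frame_transpose_zero, frame_transpose_one, frame_transpose_two, hb.b₁_sq, hb.b₂_sq,
        hb.b₁_b₂, h3, h21, h31, h32, dot_self_cross, dot_cross_self] <;> simp
    · have : (frame p)ᵀ.det = Matrix.det ![p.b₁, p.b₂, p.b₁ ⨯₃ p.b₂] := rfl
      rw [this, ← triple_product_eq_det, triple_product_permutation, triple_product_permutation,
        h3]
  simpa using SO3.transpose_mem h

theorem cross_b₂_b₃ {p : Params} (hb : p.Orthonormal) : p.b₂ ⨯₃ (p.b₁ ⨯₃ p.b₂) = p.b₁ := by
  rw [cross_cross_eq_smul_sub_smul', hb.b₂_sq, hb.b₁_b₂]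
  simp

theorem cross_b₃_b₁ {p : Params} (hb : p.Orthonormal) : (p.b₁ ⨯₃ p.b₂) ⨯₃ p.b₁ = p.b₂ := by
  rw [cross_cross_eq_smul_sub_smul, hb.b₁_sq, dotProduct_comm, hb.b₁_b₂]
  simp

theorem attErr_apply (p : Params) (ref : Reference) (t : ℝ) (R : Mat3) (i j : Fin 3) :
    attErr p ref t R i j = (R *ᵥ (frame p)ᵀ j) ⬝ᵥ (ref.Rd t *ᵥ (frame p)ᵀ i) := by
  have h1 : attErr p ref t R = (ref.Rd t * frame p)ᵀ * (R * frame p) := by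
    rw [attErr, Matrix.transpose_mul]; simp only [Matrix.mul_assoc]
  rw [h1, dotProduct_comm]
  rfl

section Errors

variable {p : Params} {ref : Reference} {t : ℝ}

theorem attErr_mem_SO3 (hb : p.Orthonormal) (hRd : ref.Rd t ∈ SO3) {R : Mat3} (hR : R ∈ SO3) :
    attErr p ref t R ∈ SO3 :=
  mul_mem (mul_mem (mul_mem (SO3.transpose_mem (frame_mem_SO3 hb)) (SO3.transpose_mem hRd)) hR)
    (frame_mem_SO3 hb)

theorem Ψ_eq_modePotential (hRd : ref.Rd t ∈ SO3) (R : Mat3) (m : Mode) :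
    Ψ p ref t R m = modePotential p m (attErr p ref t R) := by
  have h3 : rd₁ p ref t ⨯₃ rd₂ p ref t = ref.Rd t *ᵥ (p.b₁ ⨯₃ p.b₂) :=
    (mulVec_cross hRd _ _).symm
  cases m <;> simp only [Ψ, modePotential, ΨN₁, ΨN₂, ΨE₁, ΨE₂, h3, attErr_apply] <;> rfl

theorem ρ_eq_minPotential (hRd : ref.Rd t ∈ SO3) (R : Mat3) :
    ρ p ref t R = minPotential p (attErr p ref t R) := by
  simp only [ρ, minPotential, Ψ_eq_modePotential hRd]

theorem dotProduct_transpose_mulVec_cross (R : Mat3) (u b b' : Vec3) :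
    b ⬝ᵥ ((Rᵀ *ᵥ u) ⨯₃ b') = (R *ᵥ (b' ⨯₃ b)) ⬝ᵥ u := by
  rw [triple_product_permutation, Matrix.mulVec_transpose, ← Matrix.dotProduct_mulVec,
    dotProduct_comm]

/-- Paired with a frame vector, each cross product in `eH` is a triple product, which rotates into
`(R (b' ⨯₃ b)) · u`: zero or, up to sign, an entry of the error matrix. -/
theorem frame_mulVec_eH (hb : p.Orthonormal) (hRd : ref.Rd t ∈ SO3) (x : State) :
    (frame p)ᵀ *ᵥ eH p ref t x = modeGradient p x.m (attErr p ref t x.R) := by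
  have h3 : (ref.Rd t *ᵥ p.b₁) ⨯₃ (ref.Rd t *ᵥ p.b₂) = ref.Rd t *ᵥ (p.b₁ ⨯₃ p.b₂) :=
    (mulVec_cross hRd _ _).symm
  have c23 := cross_b₂_b₃ hb
  have c31 := cross_b₃_b₁ hb
  have c13 : p.b₁ ⨯₃ (p.b₁ ⨯₃ p.b₂) = -p.b₂ := by rw [← cross_anticomm, c31]
  have c21 : p.b₂ ⨯₃ p.b₁ = -(p.b₁ ⨯₃ p.b₂) := by rw [cross_anticomm]
  ext k
  have hk : ((frame p)ᵀ *ᵥ eH p ref t x) k = (frame p)ᵀ k ⬝ᵥ eH p ref t x := rfl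
  rw [hk]
  rcases hm : x.m <;> fin_cases k <;>
    simp only [Fin.zero_eta, Fin.mk_one, Fin.reduceFinMk, modeGradient, Matrix.cons_val, eH, eH₁,
      eH₂, hm, h3, attErr_apply, frame_transpose_zero, frame_transpose_one,
      frame_transpose_two, dotProduct_add, dotProduct_smul, dotProduct_neg,
      dotProduct_transpose_mulVec_cross, c23, c13, c21, cross_self, Matrix.mulVec_neg,
      Matrix.mulVec_zero, neg_dotProduct, zero_dotProduct, smul_eq_mul, rd₁, rd₂] <;> ring

theorem eucNorm_velErr (hb : p.Orthonormal) {x : State} (hR : x.R ∈ SO3) :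
    eucNorm (velErr p ref t x) = eucNorm (x.R *ᵥ x.Ω - ref.ωd t) := by
  rw [velErr, eucNorm_mulVec_SO3 (SO3.transpose_mem (frame_mem_SO3 hb)),
    ← eucNorm_mulVec_SO3 hR (eΩ ref t x), eΩ, Matrix.mulVec_sub, Matrix.mulVec_mulVec,
    SO3.mul_transpose hR, Matrix.one_mulVec]

/-- For rotations the squared distance is `6 - 2 tr (Rdᵀ R)`, and the trace is unchanged by passing
to the frame. -/
theorem frobNorm_sq (hb : p.Orthonormal) (hRd : ref.Rd t ∈ SO3) {R : Mat3} (hR : R ∈ SO3) :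
    frobNorm (R - ref.Rd t) ^ 2 = 2 * (3 - (attErr p ref t R 0 0 + attErr p ref t R 1 1
      + attErr p ref t R 2 2)) := by
  have h1 : ((R - ref.Rd t)ᵀ * (R - ref.Rd t)).trace = 6 - 2 * (attErr p ref t R).trace := by
    have e1 : (R - ref.Rd t)ᵀ * (R - ref.Rd t) =
        1 + 1 - (Rᵀ * ref.Rd t + (ref.Rd t)ᵀ * R) := by
      rw [Matrix.transpose_sub, Matrix.sub_mul, Matrix.mul_sub, Matrix.mul_sub,
        SO3.transpose_mul hR, SO3.transpose_mul hRd]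
      abel
    have e2 : (Rᵀ * ref.Rd t).trace = ((ref.Rd t)ᵀ * R).trace := by
      rw [← Matrix.trace_transpose, Matrix.transpose_mul, Matrix.transpose_transpose]
    have e3 : (attErr p ref t R).trace = ((ref.Rd t)ᵀ * R).trace := by
      rw [attErr, Matrix.trace_mul_comm, ← Matrix.mul_assoc, ← Matrix.mul_assoc,
        SO3.mul_transpose (frame_mem_SO3 hb), Matrix.one_mul]
    rw [e1, Matrix.trace_sub, Matrix.trace_add, Matrix.trace_add, e2, e3]
    simp only [Matrix.trace_one, Fintype.card_fin]
    push_cast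
    ring
  have h2 : (attErr p ref t R).trace = attErr p ref t R 0 0 + attErr p ref t R 1 1
      + attErr p ref t R 2 2 := by rw [Matrix.trace, Fin.sum_univ_three]; rfl
  rw [frobNorm, h1, h2, Real.sq_sqrt]
  · ring
  · linarith [SO3.trace_le (attErr_mem_SO3 hb hRd hR)]

theorem frameInertia_posDef (hb : p.Orthonormal) (hJ : p.J.PosDef) : (frameInertia p).PosDef := by
  have h := hJ.conjTranspose_mul_mul_same (B := frame p) (fun x y hxy => by
    have := congrArg (fun v => (frame p)ᵀ *ᵥ v) hxy
    simpa [Matrix.mulVec_mulVec, SO3.transpose_mul (frame_mem_SO3 hb)] using this)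
  rwa [Matrix.conjTranspose_eq_transpose_of_trivial] at h

theorem eucNorm_refVel (hb : p.Orthonormal) (hRd : ref.Rd t ∈ SO3) :
    eucNorm (refVel p ref t) = eucNorm (ref.ωd t) := by
  rw [refVel, eucNorm_mulVec_SO3 (SO3.transpose_mem (frame_mem_SO3 hb)),
    eucNorm_mulVec_SO3 (SO3.transpose_mem hRd)]

theorem transpose_attErr_mulVec_refVel (hb : p.Orthonormal) (hRd : ref.Rd t ∈ SO3) (R : Mat3) :
    (attErr p ref t R)ᵀ *ᵥ refVel p ref t = (frame p)ᵀ *ᵥ (Rᵀ *ᵥ ref.ωd t) := by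
  have hB := SO3.mul_transpose (frame_mem_SO3 hb)
  have hD := SO3.mul_transpose hRd
  simp only [attErr, refVel, Matrix.transpose_mul, Matrix.transpose_transpose,
    Matrix.mulVec_mulVec]
  congr 1
  calc _ = (frame p)ᵀ * Rᵀ * (ref.Rd t * (frame p * (frame p)ᵀ) * (ref.Rd t)ᵀ) := by
        simp only [Matrix.mul_assoc]
    _ = _ := by rw [hB, Matrix.mul_one, hD, Matrix.mul_one]

/-- The argument on the right is `J` times the derivative of `eΩ` along the closed loop.
Substituting `Ω = eΩ + Rᵀ ωd`, the feedforward cancels every term free of the errors. -/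
theorem frame_mulVec_torque (hb : p.Orthonormal) (hRd : ref.Rd t ∈ SO3) (x : State) :
    errorTorque p (frameInertia p) x.m (refVel p ref t) (attErr p ref t x.R) (velErr p ref t x) =
      (frame p)ᵀ *ᵥ (control p ref t x - x.Ω ⨯₃ (p.J *ᵥ x.Ω)
        + p.J *ᵥ (x.Ω ⨯₃ (x.Rᵀ *ᵥ ref.ωd t))
        - p.J *ᵥ (x.Rᵀ *ᵥ derivWithin ref.ωd (Set.Ici 0) t)) := by
  have hBT := SO3.transpose_mem (frame_mem_SO3 hb)
  have hB := SO3.mul_transpose (frame_mem_SO3 hb)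
  have hK : ∀ v, frameInertia p *ᵥ ((frame p)ᵀ *ᵥ v) = (frame p)ᵀ *ᵥ (p.J *ᵥ v) := fun v => by
    simp only [frameInertia, Matrix.mulVec_mulVec]
    rw [Matrix.mul_assoc, hB, Matrix.mul_one]
  set w := x.Rᵀ *ᵥ ref.ωd t with hw
  set v := eΩ ref t x with hv
  have hΩ : x.Ω = v + w := by rw [hv, eΩ]; simp [hw]
  rw [errorTorque, transpose_attErr_mulVec_refVel hb hRd, ← hw, ← frame_mulVec_eH hb hRd, velErr,
    ← hv, hK, hK, ← mulVec_cross hBT, ← mulVec_cross hBT, ← mulVec_cross hBT, ← mulVec_cross hBT,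
    hK, ← Matrix.mulVec_smul, ← Matrix.mulVec_neg, ← Matrix.mulVec_sub, ← Matrix.mulVec_sub,
    ← Matrix.mulVec_add, ← Matrix.mulVec_sub, ← Matrix.mulVec_sub]
  congr 1
  simp only [control, ← hw, ← hv, hat_mulVec, hΩ, map_add, LinearMap.add_apply,
    Matrix.mulVec_add, cross_self, Matrix.mulVec_zero]
  abel

end Errors

/-! ### Regularity of the reference -/

/-- Only `Rd` is assumed smooth, but `hat ωd = Rd' * Rdᵀ` passes differentiability to `ωd`. The
`derivWithin` in the control is thus a true derivative. -/
theorem Reference.IsAdmissible.hasDerivWithinAt_ωd {ref : Reference} (h : ref.IsAdmissible) {t : ℝ}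
    (ht : 0 ≤ t) :
    HasDerivWithinAt ref.ωd (derivWithin ref.ωd (Set.Ici 0) t) (Set.Ici 0) t := by
  have hent : ∀ i j, DifferentiableOn ℝ (fun s => hat (ref.ωd s) i j) (Set.Ici 0) := by
    intro i j
    have hd : ∀ k, DifferentiableOn ℝ
        (fun s => derivWithin (fun r => ref.Rd r i k) (Set.Ici 0) s * ref.Rd s j k) (Set.Ici 0) :=
      fun k => DifferentiableOn.fun_mul
        (((h.smooth i k).derivWithin (uniqueDiffOn_Ici 0) (m := ∞) (by simp)).differentiableOn
          (by simp)) ((h.smooth j k).differentiableOn (by simp))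
    refine (DifferentiableOn.fun_sum (u := Finset.univ) fun k _ => hd k).congr fun s hs => ?_
    have h1 : hat (ref.ωd s) = (hat (ref.ωd s) * ref.Rd s) * (ref.Rd s)ᵀ := by
      rw [Matrix.mul_assoc, SO3.mul_transpose (h.mem_SO3 s hs), Matrix.mul_one]
    rw [h1, Matrix.mul_apply]
    refine Finset.sum_congr rfl fun k _ => ?_
    rw [(h.kinematics s hs i k).derivWithin (uniqueDiffOn_Ici 0 s hs), Matrix.transpose_apply]
  have hd : DifferentiableOn ℝ ref.ωd (Set.Ici 0) := by
    rw [differentiableOn_pi]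
    intro i
    fin_cases i
    · exact (hent 2 1).congr fun s _ => by simp [hat]
    · exact (hent 0 2).congr fun s _ => by simp [hat]
    · exact (hent 1 0).congr fun s _ => by simp [hat]
  exact (hd t ht).hasDerivWithinAt

theorem Reference.IsAdmissible.continuousOn_refVel {ref : Reference} (h : ref.IsAdmissible)
    (p : Params) : ContinuousOn (refVel p ref) (Set.Ici 0) := fun t ht =>
  (hasDerivWithinAt_const_mulVec _ (MatHasDerivWithinAt.mulVec
    (MatHasDerivWithinAt.transpose (h.kinematics t ht)) (h.hasDerivWithinAt_ωd ht))).continuousWithinAt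

/-! ### Flows of the closed loop in error coordinates -/

/-- A flow of the closed loop in the mode `m` on the time set `S`. -/
structure IsFlow (p : Params) (ref : Reference) (m : Mode) (S : Set ℝ) (x : ℝ → State) : Prop where
  mode : ∀ t ∈ S, (x t).m = m
  mem_SO3 : ∀ t ∈ S, (x t).R ∈ SO3
  kinematics : ∀ t ∈ S, MatHasDerivWithinAt (fun s => (x s).R) ((x t).R * hat (x t).Ω) S t
  dynamics : ∀ t ∈ S, ∃ Ω' : Vec3, HasDerivWithinAt (fun s => (x s).Ω) Ω' S t ∧
    p.J *ᵥ Ω' + (x t).Ω ⨯₃ (p.J *ᵥ (x t).Ω) = control p ref t (x t)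

section Reduction

variable {p : Params} {ref : Reference}

theorem IsFlow.isErrorFlow (hb : p.Orthonormal) (hJ : p.J.PosDef) (href : ref.IsAdmissible)
    {m : Mode} {S : Set ℝ} (hS : S ⊆ Set.Ici 0) {x : ℝ → State} (h : IsFlow p ref m S x) :
    IsErrorFlow p (frameInertia p) (refVel p ref) m S (fun t => attErr p ref t (x t).R)
      (fun t => velErr p ref t (x t)) := by
  have hB := SO3.mul_transpose (frame_mem_SO3 hb)
  refine ⟨fun t ht => attErr_mem_SO3 hb (href.mem_SO3 t (hS ht)) (h.mem_SO3 t ht), fun t ht => ?_,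
    fun t ht => ?_⟩
  · have hd := ((((matHasDerivWithinAt_const (frame p)ᵀ S t).mul
      (MatHasDerivWithinAt.transpose (MatHasDerivWithinAt.mono
        (href.kinematics t (hS ht)) hS))).mul (h.kinematics t ht)).mul
      (matHasDerivWithinAt_const (frame p) S t))
    intro i j
    refine (hd i j).congr_deriv (congrFun (congrFun ?_ i) j)
    have hR := h.mem_SO3 t ht
    have e1 : hat (ref.ωd t) * (x t).R = (x t).R * hat ((x t).Rᵀ *ᵥ ref.ωd t) := by
      rw [← hat_mulVec_mul hR, Matrix.mulVec_mulVec, SO3.mul_transpose hR, Matrix.one_mulVec]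
    have e2 : frame p * hat (velErr p ref t (x t)) = hat (eΩ ref t (x t)) * frame p := by
      rw [← hat_mulVec_mul (frame_mem_SO3 hb), velErr, Matrix.mulVec_mulVec, hB, Matrix.one_mulVec]
    have e3 : attErr p ref t (x t).R * hat (velErr p ref t (x t)) =
        (frame p)ᵀ * (ref.Rd t)ᵀ * (x t).R * (hat (eΩ ref t (x t)) * frame p) := by
      rw [attErr, ← e2]; simp only [Matrix.mul_assoc]
    rw [e3, eΩ, hat_sub, Matrix.transpose_mul, hat_transpose]
    simp only [Matrix.zero_mul, Matrix.mul_zero, zero_add, add_zero, Matrix.add_mul, Matrix.sub_mul,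
      Matrix.mul_sub, Matrix.mul_assoc, Matrix.neg_mul, Matrix.mul_neg]
    rw [← Matrix.mul_assoc (hat (ref.ωd t)), e1]
    simp only [Matrix.mul_assoc]
    abel
  · obtain ⟨Ω', hΩ', heq⟩ := h.dynamics t ht
    have hw := MatHasDerivWithinAt.mulVec (MatHasDerivWithinAt.transpose (h.kinematics t ht))
      ((href.hasDerivWithinAt_ωd (hS ht)).mono hS)
    have hd := hasDerivWithinAt_const_mulVec (frame p)ᵀ (hΩ'.sub hw)
    refine hd.congr_deriv ?_
    have hK := frameInertia_posDef hb hJ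
    rw [← h.mode t ht, frame_mulVec_torque hb (href.mem_SO3 t (hS ht)), ← heq]
    have e1 : (((x t).R * hat (x t).Ω)ᵀ *ᵥ ref.ωd t) =
        -((x t).Ω ⨯₃ ((x t).Rᵀ *ᵥ ref.ωd t)) := by
      rw [Matrix.transpose_mul, hat_transpose, Matrix.neg_mul, Matrix.neg_mulVec,
        ← Matrix.mulVec_mulVec, hat_mulVec]
    rw [e1]
    have e2 : ∀ v, (frame p)ᵀ *ᵥ (p.J *ᵥ v) = frameInertia p *ᵥ ((frame p)ᵀ *ᵥ v) := fun v => by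
      simp only [frameInertia, Matrix.mulVec_mulVec]
      rw [Matrix.mul_assoc _ (frame p), hB, Matrix.mul_one]
    rw [add_sub_cancel_right, ← Matrix.mulVec_add, ← Matrix.mulVec_sub, e2,
      Matrix.mulVec_mulVec _ _ (frameInertia p), PosDef.inv_mul hK, Matrix.one_mulVec]
    congr 1
    abel

/-- The state with prescribed errors. -/
def errState (p : Params) (ref : Reference) (m : Mode) (t : ℝ) (P : Mat3) (e : Vec3) : State where
  R := ref.Rd t * (frame p * P * (frame p)ᵀ)
  Ω := frame p *ᵥ e + (ref.Rd t * (frame p * P * (frame p)ᵀ))ᵀ *ᵥ ref.ωd t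
  m := m

theorem attErr_errState (hb : p.Orthonormal) {t : ℝ} (hRd : ref.Rd t ∈ SO3) (m : Mode) (P : Mat3)
    (e : Vec3) : attErr p ref t (errState p ref m t P e).R = P := by
  have hB := SO3.transpose_mul (frame_mem_SO3 hb)
  have hD := SO3.transpose_mul hRd
  calc attErr p ref t (errState p ref m t P e).R
      = (frame p)ᵀ * ((ref.Rd t)ᵀ * ref.Rd t) * frame p * P * ((frame p)ᵀ * frame p) := by
        simp only [attErr, errState, Matrix.mul_assoc]
    _ = P := by rw [hD, Matrix.mul_one, hB, Matrix.one_mul, Matrix.mul_one]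

theorem velErr_errState (hb : p.Orthonormal) (t : ℝ) (m : Mode) (P : Mat3) (e : Vec3) :
    velErr p ref t (errState p ref m t P e) = e := by
  simp only [velErr, eΩ, errState, add_sub_cancel_right]
  rw [Matrix.mulVec_mulVec, SO3.transpose_mul (frame_mem_SO3 hb), Matrix.one_mulVec]

theorem errState_attErr_velErr (hb : p.Orthonormal) {t : ℝ} (hRd : ref.Rd t ∈ SO3) (x : State) :
    errState p ref x.m t (attErr p ref t x.R) (velErr p ref t x) = x := by
  have hB := SO3.mul_transpose (frame_mem_SO3 hb)
  have hD := SO3.mul_transpose hRd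
  have hR : ref.Rd t * (frame p * attErr p ref t x.R * (frame p)ᵀ) = x.R := by
    calc ref.Rd t * (frame p * attErr p ref t x.R * (frame p)ᵀ)
        = ref.Rd t * (frame p * (frame p)ᵀ) * (ref.Rd t)ᵀ * x.R * (frame p * (frame p)ᵀ) := by
          simp only [attErr, Matrix.mul_assoc]
      _ = x.R := by simp only [hB, Matrix.mul_one, hD, Matrix.one_mul]
  have hΩ : frame p *ᵥ velErr p ref t x + x.Rᵀ *ᵥ ref.ωd t = x.Ω := by
    rw [velErr, Matrix.mulVec_mulVec, hB, Matrix.one_mulVec, eΩ, sub_add_cancel]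
  cases x
  simp only [errState] at hR hΩ ⊢
  rw [hR, hΩ]

theorem errState_R_mem_SO3 (hb : p.Orthonormal) {t : ℝ} (hRd : ref.Rd t ∈ SO3) (m : Mode)
    {P : Mat3} (hP : P ∈ SO3) (e : Vec3) : (errState p ref m t P e).R ∈ SO3 :=
  mul_mem hRd (mul_mem (mul_mem (frame_mem_SO3 hb) hP) (SO3.transpose_mem (frame_mem_SO3 hb)))

theorem IsErrorFlow.isFlow (hb : p.Orthonormal) (hJ : p.J.PosDef) (href : ref.IsAdmissible)
    {m : Mode} {S : Set ℝ} (hS : S ⊆ Set.Ici 0) {P : ℝ → Mat3} {e : ℝ → Vec3}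
    (h : IsErrorFlow p (frameInertia p) (refVel p ref) m S P e) :
    IsFlow p ref m S (fun t => errState p ref m t (P t) (e t)) := by
  have hBm := frame_mem_SO3 hb
  have hB := SO3.mul_transpose hBm
  have hkin : ∀ t ∈ S, MatHasDerivWithinAt (fun s => (errState p ref m s (P s) (e s)).R)
      ((errState p ref m t (P t) (e t)).R * hat (errState p ref m t (P t) (e t)).Ω) S t := by
    intro t ht
    have hRd := href.mem_SO3 t (hS ht)
    have hR := errState_R_mem_SO3 hb hRd m (h.mem_SO3 t ht) (e t)
    have hd := (MatHasDerivWithinAt.mono (href.kinematics t (hS ht)) hS).mul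
      (((matHasDerivWithinAt_const (frame p) S t).mul (h.kinematics t ht)).mul
        (matHasDerivWithinAt_const (frame p)ᵀ S t))
    intro i j
    refine (hd i j).congr_deriv (congrFun (congrFun ?_ i) j)
    set R := (errState p ref m t (P t) (e t)).R with hRdef
    have hRe : R = ref.Rd t * (frame p * P t * (frame p)ᵀ) := rfl
    have hΩ : (errState p ref m t (P t) (e t)).Ω = frame p *ᵥ e t + Rᵀ *ᵥ ref.ωd t := rfl
    have e1 : R * hat (Rᵀ *ᵥ ref.ωd t) = hat (ref.ωd t) * R := by
      rw [← hat_mulVec_mul hR, Matrix.mulVec_mulVec, SO3.mul_transpose hR, Matrix.one_mulVec]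
    have e2 : (frame p)ᵀ * hat (frame p *ᵥ e t) = hat (e t) * (frame p)ᵀ := by
      rw [← hat_mulVec_mul (SO3.transpose_mem hBm), Matrix.mulVec_mulVec,
        SO3.transpose_mul hBm, Matrix.one_mulVec]
    rw [hΩ, hat_add, Matrix.mul_add R, e1, hRe]
    simp only [Matrix.zero_mul, Matrix.mul_zero, zero_add, add_zero, Matrix.mul_assoc, e2]
    abel
  refine ⟨fun _ _ => rfl, fun t ht => errState_R_mem_SO3 hb (href.mem_SO3 t (hS ht)) m
    (h.mem_SO3 t ht) (e t), hkin, fun t ht => ?_⟩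
  have hRd := href.mem_SO3 t (hS ht)
  have hw := MatHasDerivWithinAt.mulVec (MatHasDerivWithinAt.transpose (hkin t ht))
    ((href.hasDerivWithinAt_ωd (hS ht)).mono hS)
  refine ⟨_, (hasDerivWithinAt_const_mulVec (frame p) (h.dynamics t ht)).add hw, ?_⟩
  set x := errState p ref m t (P t) (e t) with hx
  have hτ := frame_mulVec_torque hb hRd x
  rw [hx, attErr_errState hb hRd, velErr_errState hb, ← hx] at hτ
  have e1 : ((x.R * hat x.Ω)ᵀ *ᵥ ref.ωd t) = -(x.Ω ⨯₃ (x.Rᵀ *ᵥ ref.ωd t)) := by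
    rw [Matrix.transpose_mul, hat_transpose, Matrix.neg_mul, Matrix.neg_mulVec,
      ← Matrix.mulVec_mulVec, hat_mulVec]
  have e2 : ∀ v, p.J *ᵥ (frame p *ᵥ v) = frame p *ᵥ (frameInertia p *ᵥ v) := fun v => by
    simp only [frameInertia, Matrix.mulVec_mulVec, ← Matrix.mul_assoc]
    rw [hB, Matrix.one_mul]
  have hm : x.m = m := rfl
  rw [hm] at hτ
  rw [e1, Matrix.mulVec_add, e2, Matrix.mulVec_mulVec _ (frameInertia p),
    PosDef.mul_inv (frameInertia_posDef hb hJ), Matrix.one_mulVec, hτ, Matrix.mulVec_mulVec, hB,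
    Matrix.one_mulVec, Matrix.mulVec_add, Matrix.mulVec_neg]
  abel

end Reduction

end AttitudeTracking

end

noncomputable section

namespace AttitudeTracking

/-! ### Hybrid time domains -/

section Domain

variable {t₀ : ℝ} {E : Set (ℝ × ℕ)}

theorem IsHybridTimeDomain.initial_mem (h : IsHybridTimeDomain t₀ E) : (t₀, 0) ∈ E := by
  obtain ⟨⟨T, N⟩, hTN⟩ := h.nonempty
  obtain ⟨τ, h0, hτ, hiff⟩ := h.truncation T N hTN
  have := (hiff (τ 0) 0).2 ⟨Nat.zero_le _, le_rfl, hτ 0 (Nat.zero_le _)⟩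
  rw [h0] at this
  exact this.1

theorem IsHybridTimeDomain.initial_le (h : IsHybridTimeDomain t₀ E) {t : ℝ} {j : ℕ}
    (ht : (t, j) ∈ E) : t₀ ≤ t := by
  obtain ⟨τ, h0, hτ, hiff⟩ := h.truncation t j ht
  have hmono : ∀ k ≤ j, t₀ ≤ τ k := by
    intro k
    induction k with
    | zero => intro _; exact h0.ge
    | succ k ih => exact fun hk => (ih (by omega)).trans (hτ k (by omega))
  exact (hmono j le_rfl).trans ((hiff t j).1 ⟨ht, le_rfl, le_rfl⟩).2.1

theorem IsHybridTimeDomain.slice_ordConnected (h : IsHybridTimeDomain t₀ E) (j : ℕ) :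
    (timeSlice E j).OrdConnected := by
  refine ⟨fun s hs t ht r hr => ?_⟩
  obtain ⟨τ, -, -, hiff⟩ := h.truncation t j ht
  have h1 := (hiff s j).1 ⟨hs, hr.1.trans hr.2, le_rfl⟩
  have h2 := (hiff t j).1 ⟨ht, le_rfl, le_rfl⟩
  exact ((hiff r j).2 ⟨le_rfl, h1.2.1.trans hr.1, hr.2.trans h2.2.2⟩).1

/-- The part of a hybrid time domain up to `(T, N)`. -/
def truncDomain (E : Set (ℝ × ℕ)) (T : ℝ) (N : ℕ) : Set (ℝ × ℕ) := {q ∈ E | q.1 ≤ T ∧ q.2 ≤ N}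

theorem IsHybridTimeDomain.trunc (h : IsHybridTimeDomain t₀ E) {T : ℝ} {N : ℕ}
    (hTN : (T, N) ∈ E) : IsHybridTimeDomain t₀ (truncDomain E T N) := by
  refine ⟨⟨(T, N), hTN, le_rfl, le_rfl⟩,
    fun s i t j hs ht hij => h.ordered s i t j hs.1 ht.1 hij, fun T' N' h' => ?_⟩
  obtain ⟨τ, h0, hτ, hiff⟩ := h.truncation T' N' h'.1
  refine ⟨τ, h0, hτ, fun t j => ?_⟩
  rw [← hiff t j]
  exact ⟨fun hq => ⟨hq.1.1, hq.2⟩,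
    fun hq => ⟨⟨hq.1, hq.2.1.trans h'.2.1, hq.2.2.trans h'.2.2⟩, hq.2⟩⟩

/-- Juxtaposition of a hybrid time domain that ends after `N` jumps with another one. -/
def appendDomain (E : Set (ℝ × ℕ)) (N : ℕ) (E' : Set (ℝ × ℕ)) : Set (ℝ × ℕ) :=
  E ∪ {q | N ≤ q.2 ∧ (q.1, q.2 - N) ∈ E'}

theorem IsHybridTimeDomain.append (h : IsHybridTimeDomain t₀ E) {T : ℝ} {N : ℕ}
    (hTN : (T, N) ∈ E) (hmax : ∀ t j, (t, j) ∈ E → t ≤ T ∧ j ≤ N) {E' : Set (ℝ × ℕ)}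
    (h' : IsHybridTimeDomain T E') : IsHybridTimeDomain t₀ (appendDomain E N E') := by
  refine ⟨⟨(T, N), Or.inl hTN⟩, ?_, ?_⟩
  · rintro s i t j (hs | ⟨hs, hs'⟩) (ht | ⟨ht, ht'⟩) hij
    · exact h.ordered s i t j hs ht hij
    · exact (hmax s i hs).1.trans (h'.initial_le ht')
    · have := (hmax t j ht).2
      simp only at hs
      omega
    · simp only at hs ht hs' ht'
      exact h'.ordered s (i - N) t (j - N) hs' ht' (by omega)
  · rintro T₁ N₁ (hmem | ⟨hN, hmem⟩)
    · obtain ⟨τ, h0, hτ, hiff⟩ := h.truncation T₁ N₁ hmem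
      refine ⟨τ, h0, hτ, fun t j => ?_⟩
      rw [← hiff t j]
      refine ⟨fun ⟨hE, h1, h2⟩ => ⟨?_, h1, h2⟩, fun ⟨hE, h1, h2⟩ => ⟨Or.inl hE, h1, h2⟩⟩
      rcases hE with hE | ⟨hjN, hE⟩
      · exact hE
      · simp only at hjN hE
        -- A point of the second domain that precedes a point of the first must be the junction `(T,
        -- N)`.
        have hN₁ := hmax T₁ N₁ hmem
        have e1 : j = N := by omega
        have e2 : t = T := le_antisymm (h1.trans hN₁.1) (h'.initial_le hE)
        rw [e1, e2]; exact hTN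
    · simp only at hN hmem
      obtain ⟨τ, h0, hτ, hiff⟩ := h.truncation T N hTN
      obtain ⟨σ, k0, hσ, kiff⟩ := h'.truncation T₁ (N₁ - N) hmem
      have hTe : τ N ≤ T := ((hiff T N).1 ⟨hTN, le_rfl, le_rfl⟩).2.1
      have hle : T ≤ T₁ := h'.initial_le hmem
      have hEi : ∀ t j, (t, j) ∈ E ↔ j ≤ N ∧ t ∈ Set.Icc (τ j) (τ (j + 1)) := fun t j => by
        rw [← hiff t j]
        exact ⟨fun hE => ⟨hE, hmax t j hE⟩, fun hE => hE.1⟩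
      have hTe' : τ (N + 1) = T :=
        le_antisymm ((hiff _ N).2 ⟨le_rfl, hτ N le_rfl, le_rfl⟩).2.1
          ((hiff T N).1 ⟨hTN, le_rfl, le_rfl⟩).2.2
      -- Both `τ (N + 1)` and `σ 0` equal `T` and are left out: the last slice of `E` and the first
      -- slice of `E'` merge into slice `N`, from `τ N` to `σ 1`.
      refine ⟨fun j => if j ≤ N then τ j else σ (j - N), by simp [h0], fun j hj => ?_,
        fun t j => ?_⟩
      · rcases lt_trichotomy j N with hlt | rfl | hgt
        · simp only [hlt.le, if_true, show j + 1 ≤ N from hlt]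
          exact hτ j hlt.le
        · simp only [le_rfl, if_true, show ¬ (j + 1 ≤ j) by omega, if_false]
          rw [show j + 1 - j = 0 + 1 by omega]
          exact hTe.trans (k0.ge.trans (hσ 0 (Nat.zero_le _)))
        · simp only [show ¬ (j ≤ N) by omega, if_false, show ¬ (j + 1 ≤ N) by omega]
          rw [show j + 1 - N = (j - N) + 1 by omega]
          exact hσ (j - N) (by omega)
      · rcases lt_trichotomy j N with hlt | rfl | hgt
        · simp only [hlt.le, if_true, show j + 1 ≤ N from hlt]
          constructor
          · rintro ⟨hE | ⟨hE, -⟩, h1, h2⟩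
            · exact ⟨h2, ((hEi t j).1 hE).2⟩
            · simp only at hE; omega
          · rintro ⟨h2, ht⟩
            have hE := (hEi t j).2 ⟨hlt.le, ht⟩
            exact ⟨Or.inl hE, (hmax t j hE).1.trans hle, h2⟩
        · simp only [le_rfl, if_true, show ¬ (j + 1 ≤ j) by omega, if_false]
          rw [show j + 1 - j = 0 + 1 by omega]
          have hσ1 := hσ 0 (Nat.zero_le _)
          constructor
          · rintro ⟨hE | ⟨-, hE⟩, h1, h2⟩
            · have := ((hEi t j).1 hE).2
              exact ⟨h2, this.1, this.2.trans (hTe'.le.trans (k0.ge.trans hσ1))⟩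
            · simp only [Nat.sub_self] at hE
              have := ((kiff t 0).1 ⟨hE, h1, Nat.zero_le _⟩).2
              exact ⟨h2, hTe.trans (k0.ge.trans this.1), this.2⟩
          · rintro ⟨h2, ht⟩
            rcases le_total t T with hle' | hle'
            · exact ⟨Or.inl ((hEi t j).2 ⟨le_rfl, ht.1, hle'.trans hTe'.ge⟩), hle'.trans hle, h2⟩
            · have := (kiff t 0).2 ⟨Nat.zero_le _, k0.le.trans hle', ht.2⟩
              exact ⟨Or.inr ⟨le_rfl, by simpa using this.1⟩, this.2.1, h2⟩
        · simp only [show ¬ (j ≤ N) by omega, if_false, show ¬ (j + 1 ≤ N) by omega]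
          rw [show j + 1 - N = (j - N) + 1 by omega]
          constructor
          · rintro ⟨hE | ⟨-, hE⟩, h1, h2⟩
            · have := (hmax t j hE).2; omega
            · exact ⟨h2, ((kiff t (j - N)).1 ⟨hE, h1, by omega⟩).2⟩
          · rintro ⟨h2, ht⟩
            have := (kiff t (j - N)).2 ⟨by omega, ht⟩
            exact ⟨Or.inr ⟨hgt.le, this.1⟩, this.2.1, h2⟩

theorem isHybridTimeDomain_slice {S : Set ℝ} (ht₀ : t₀ ∈ S)
    (hS : S.OrdConnected) (hle : ∀ t ∈ S, t₀ ≤ t) : IsHybridTimeDomain t₀ (S ×ˢ {0}) := by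
  refine ⟨⟨(t₀, 0), ht₀, rfl⟩, ?_, ?_⟩
  · rintro s i t j ⟨-, hi⟩ ⟨-, hj⟩ hij
    simp only [Set.mem_singleton_iff] at hi hj
    omega
  · rintro T N ⟨hT, hN⟩
    simp only [Set.mem_singleton_iff] at hN hT
    subst hN
    refine ⟨fun j => if j = 0 then t₀ else T, by simp, fun j hj => ?_, fun t j => ?_⟩
    · have : j = 0 := by omega
      subst this
      simpa using hle T hT
    · constructor
      · rintro ⟨⟨h1, h2⟩, h3, -⟩
        simp only [Set.mem_singleton_iff] at h1 h2
        subst h2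
        exact ⟨le_rfl, by simpa using hle t h1, by simpa using h3⟩
      · rintro ⟨hj, ht⟩
        have : j = 0 := by omega
        subst this
        simp only [if_true, zero_add, one_ne_zero, if_false] at ht
        exact ⟨⟨hS.out ht₀ hT ht, rfl⟩, ht.2, le_rfl⟩

theorem isHybridTimeDomain_jump (t₀ : ℝ) : IsHybridTimeDomain t₀ {q | q.1 = t₀ ∧ q.2 ≤ 1} := by
  refine ⟨⟨(t₀, 0), rfl, Nat.zero_le _⟩, ?_, ?_⟩
  · rintro s i t j ⟨hs, -⟩ ⟨ht, -⟩ -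
    exact (hs.trans ht.symm).le
  · rintro T N ⟨hT, hN⟩
    simp only at hT hN
    refine ⟨fun _ => t₀, rfl, fun _ _ => le_rfl, fun t j => ?_⟩
    simp only [Set.mem_ofPred_eq, Set.Icc_self, Set.mem_singleton_iff]
    constructor
    · rintro ⟨⟨h1, -⟩, -, h3⟩
      exact ⟨h3, h1⟩
    · rintro ⟨h1, h2⟩
      exact ⟨⟨h2, by omega⟩, (h2.trans hT.symm).le, h1⟩

end Domain

/-! ### Operations on solutions -/

section Solutions

variable {p : Params} {ref : Reference} {t₀ : ℝ} {E : Set (ℝ × ℕ)} {x : ℝ → ℕ → State}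

theorem IsSolution.trunc (h : IsSolution p ref t₀ E x) {T : ℝ} {N : ℕ} (hTN : (T, N) ∈ E) :
    IsSolution p ref t₀ (truncDomain E T N) x where
  domain := h.domain.trunc hTN
  mem_SO3 t j ht := h.mem_SO3 t j ht.1
  mode_const s t j hs ht := h.mode_const s t j hs.1 ht.1
  mem_flowSet t j ht := h.mem_flowSet t j (interior_mono (fun _ hs => hs.1) ht)
  kinematics t j ht a b := (h.kinematics t j ht.1 a b).mono fun _ hs => hs.1
  dynamics t j ht := by
    obtain ⟨Ω', h1, h2⟩ := h.dynamics t j ht.1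
    exact ⟨Ω', h1.mono fun _ hs => hs.1, h2⟩
  jump t j ht ht' := h.jump t j ht.1 ht'.1

theorem IsSolution.isFlow (h : IsSolution p ref t₀ E x) {s : ℝ} {j : ℕ} (hs : (s, j) ∈ E) :
    IsFlow p ref (x s j).m (timeSlice E j) (fun t => x t j) :=
  ⟨fun t ht => h.mode_const t s j ht hs, fun t ht => h.mem_SO3 t j ht,
    fun t ht a b => h.kinematics t j ht a b, fun t ht => h.dynamics t j ht⟩

theorem IsFlow.mono {m : Mode} {S S' : Set ℝ} {y : ℝ → State} (h : IsFlow p ref m S y)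
    (hS : S' ⊆ S) : IsFlow p ref m S' y :=
  ⟨fun t ht => h.mode t (hS ht), fun t ht => h.mem_SO3 t (hS ht),
    fun t ht => (h.kinematics t (hS ht)).mono hS, fun t ht => by
      obtain ⟨Ω', h1, h2⟩ := h.dynamics t (hS ht)
      exact ⟨Ω', h1.mono hS, h2⟩⟩

theorem timeSlice_prod_zero (S : Set ℝ) : timeSlice (S ×ˢ {0}) 0 = S := by
  ext t; simp [timeSlice]

/-- A flow that stays in the flow set is a solution without jumps. -/
theorem IsFlow.isSolution {m : Mode} {S : Set ℝ} {y : ℝ → State} (h : IsFlow p ref m S y)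
    (ht₀ : t₀ ∈ S) (hS : S.OrdConnected) (hle : ∀ t ∈ S, t₀ ≤ t)
    (hflow : ∀ t ∈ interior S, y t ∈ flowSet p ref t) :
    IsSolution p ref t₀ (S ×ˢ {0}) (fun t _ => y t) := by
  have hj : ∀ {t j}, (t, j) ∈ S ×ˢ ({0} : Set ℕ) → t ∈ S ∧ j = 0 := fun h => h
  refine ⟨isHybridTimeDomain_slice ht₀ hS hle, fun t j ht => h.mem_SO3 t (hj ht).1,
    fun s t j hs ht => (h.mode s (hj hs).1).trans (h.mode t (hj ht).1).symm, fun t j ht => ?_,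
    fun t j ht a b => ?_, fun t j ht => ?_, fun t j ht ht' => ?_⟩
  · have hmem : t ∈ timeSlice (S ×ˢ {0}) j := interior_subset ht
    obtain ⟨-, rfl⟩ := hj hmem
    rw [timeSlice_prod_zero] at ht
    exact hflow t ht
  · obtain ⟨hS, rfl⟩ := hj ht
    rw [timeSlice_prod_zero]
    exact h.kinematics t hS a b
  · obtain ⟨hS, rfl⟩ := hj ht
    rw [timeSlice_prod_zero]
    exact h.dynamics t hS
  · have h1 := (hj ht).2
    have h2 := (hj ht').2
    omega

/-- A single jump. -/
theorem isSolution_jump (hJ : p.J.PosDef) {y y' : State} (hy : y.R ∈ SO3)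
    (hjump : y ∈ jumpSet p ref t₀) (hR : y'.R = y.R) (hΩ : y'.Ω = y.Ω)
    (hm : y'.m ∈ jumpMap p ref t₀ y.R) :
    IsSolution p ref t₀ {q | q.1 = t₀ ∧ q.2 ≤ 1} (fun _ j => if j = 0 then y else y') := by
  have hsl : ∀ j, timeSlice {q : ℝ × ℕ | q.1 = t₀ ∧ q.2 ≤ 1} j ⊆ {t₀} := fun j t ht => ht.1
  -- The slices contain at most one time, where every vector is a derivative.
  have hd : ∀ {F : Type} [NormedAddCommGroup F] [NormedSpace ℝ F] (f : ℝ → F) (f' : F) (t : ℝ)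
      (j : ℕ), t = t₀ →
      HasDerivWithinAt f f' (timeSlice {q : ℝ × ℕ | q.1 = t₀ ∧ q.2 ≤ 1} j) t := by
    rintro F _ _ f f' t j rfl
    refine HasDerivWithinAt.mono ?_ (hsl j)
    exact HasFDerivWithinAt.of_subsingleton Set.subsingleton_singleton
  refine ⟨isHybridTimeDomain_jump t₀, fun t j _ => ?_, fun _ _ _ _ _ => rfl, fun t j ht => ?_,
    fun t j ht a b => hd _ _ t j ht.1, fun t j ht => ?_, fun t j ht ht' => ?_⟩
  · split_ifs
    · exact hy
    · rw [hR]; exact hy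
  · have := interior_mono (hsl j) ht
    simp at this
  · refine ⟨p.J⁻¹ *ᵥ (control p ref t (if j = 0 then y else y')
      - (if j = 0 then y else y').Ω ⨯₃ (p.J *ᵥ (if j = 0 then y else y').Ω)),
      hd _ _ t j ht.1, ?_⟩
    rw [Matrix.mulVec_mulVec, PosDef.mul_inv hJ, Matrix.one_mulVec, sub_add_cancel]
  · have hj : j = 0 := by have := ht'.2; simp only at this; omega
    have ht0 : t = t₀ := ht.1
    subst hj ht0
    exact ⟨hjump, hR, hΩ, hm⟩

/-- A time in only one of the two sets lies outside the closure of the other, so the derivative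
condition there is void; both conditions matter only at `T`. -/
theorem hasDerivWithinAt_glue {F : Type*} [NormedAddCommGroup F] [NormedSpace ℝ F] {S S' : Set ℝ}
    {T t : ℝ} (hS : ∀ s ∈ S, s ≤ T) (hS' : ∀ s ∈ S', T ≤ s) (hTS : T ∈ S) (hTS' : T ∈ S')
    {f g k : ℝ → F} {d : F} (hf : ∀ s ∈ S, k s = f s) (hg : ∀ s ∈ S', k s = g s)
    (hdf : t ∈ S → HasDerivWithinAt f d S t) (hdg : t ∈ S' → HasDerivWithinAt g d S' t)
    (ht : t ∈ S ∪ S') : HasDerivWithinAt k d (S ∪ S') t := by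
  refine HasDerivWithinAt.union ?_ ?_
  · by_cases h : t ∈ S
    · exact (hdf h).congr hf (hf t h)
    · have h' : t ∈ S' := ht.resolve_left h
      have hlt : T < t := lt_of_le_of_ne (hS' t h') fun heq => h (heq ▸ hTS)
      refine HasFDerivWithinAt.of_notMem_closure fun hc => ?_
      have : t ≤ T := closure_minimal (show S ⊆ Set.Iic T from hS) isClosed_Iic hc
      linarith
  · by_cases h : t ∈ S'
    · exact (hdg h).congr hg (hg t h)
    · have h' : t ∈ S := ht.resolve_right h
      have hlt : t < T := lt_of_le_of_ne (hS t h') fun heq => h (heq ▸ hTS')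
      refine HasFDerivWithinAt.of_notMem_closure fun hc => ?_
      have : T ≤ t := closure_minimal (show S' ⊆ Set.Ici T from hS') isClosed_Ici hc
      linarith

end Solutions

end AttitudeTracking

end

noncomputable section

namespace AttitudeTracking

/-! ### Concatenation of solutions -/

section Append

variable {p : Params} {ref : Reference}

theorem mem_flowSet_iff {t : ℝ} (hRd : ref.Rd t ∈ SO3) {x : State} :
    x ∈ flowSet p ref t ↔
      modePotential p x.m (attErr p ref t x.R) - minPotential p (attErr p ref t x.R) ≤ p.δ := by
  rw [← Ψ_eq_modePotential hRd, ← ρ_eq_minPotential hRd]; rfl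

theorem mem_jumpSet_iff {t : ℝ} (hRd : ref.Rd t ∈ SO3) {x : State} :
    x ∈ jumpSet p ref t ↔
      p.δ ≤ modePotential p x.m (attErr p ref t x.R) - minPotential p (attErr p ref t x.R) := by
  rw [← Ψ_eq_modePotential hRd, ← ρ_eq_minPotential hRd]; rfl

theorem mem_jumpMap_iff {t : ℝ} (hRd : ref.Rd t ∈ SO3) {R : Mat3} {m : Mode} :
    m ∈ jumpMap p ref t R ↔
      modePotential p m (attErr p ref t R) = minPotential p (attErr p ref t R) := by
  rw [← Ψ_eq_modePotential hRd, ← ρ_eq_minPotential hRd]; rfl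

theorem IsErrorFlow.continuousOn_potentialGap {K : Mat3} {c : ℝ → Vec3} {m : Mode} {S : Set ℝ}
    {P : ℝ → Mat3} {e : ℝ → Vec3} (h : IsErrorFlow p K c m S P e) :
    ContinuousOn (fun t => modePotential p m (P t) - minPotential p (P t)) S := by
  have hc : ∀ m, ContinuousOn (fun t => modePotential p m (P t)) S := fun m t ht =>
    (hasDerivWithinAt_modePotential p m (h.kinematics t ht)).continuousWithinAt
  exact fun t ht => (hc m t ht).sub
    (Filter.Tendsto.min (hc .I t ht) (Filter.Tendsto.min (hc .II t ht) (hc .III t ht)))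

/-- The flow set is closed along flows. -/
theorem IsFlow.mem_flowSet (hb : p.Orthonormal) (hJ : p.J.PosDef) (href : ref.IsAdmissible)
    {m : Mode} {S : Set ℝ} (hS : S ⊆ Set.Ici 0) (hconn : S.OrdConnected)
    (hne : (interior S).Nonempty) {x : ℝ → State} (h : IsFlow p ref m S x)
    (hint : ∀ t ∈ interior S, x t ∈ flowSet p ref t) {t : ℝ} (ht : t ∈ S) :
    x t ∈ flowSet p ref t := by
  have hcont := (h.isErrorFlow hb hJ href hS).continuousOn_potentialGap
  have hcl : t ∈ closure (interior S) := by
    rw [(hconn.convex : Convex ℝ S).closure_interior_eq_closure_of_nonempty_interior hne]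
    exact subset_closure ht
  rw [mem_flowSet_iff (href.mem_SO3 t (hS ht)), h.mode t ht]
  refine ContinuousWithinAt.closure_le hcl ((hcont t ht).mono interior_subset)
    continuousWithinAt_const fun s hs => ?_
  have h1 := hint s hs
  rwa [mem_flowSet_iff (href.mem_SO3 s (hS (interior_subset hs))),
    h.mode s (interior_subset hs)] at h1

/-- Juxtaposition of hybrid arcs. -/
def appendArc (x : ℝ → ℕ → State) (T : ℝ) (N : ℕ) (x' : ℝ → ℕ → State) (t : ℝ) (j : ℕ) : State :=
  open Classical in if j < N ∨ (j = N ∧ t ≤ T) then x t j else x' t (j - N)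

variable {t₀ T : ℝ} {N : ℕ} {E E' : Set (ℝ × ℕ)} {x x' : ℝ → ℕ → State}

theorem appendArc_of_mem_left (hmax : ∀ t j, (t, j) ∈ E → t ≤ T ∧ j ≤ N) {t : ℝ} {j : ℕ}
    (h : (t, j) ∈ E) : appendArc x T N x' t j = x t j := by
  obtain ⟨h1, h2⟩ := hmax t j h
  have : j < N ∨ (j = N ∧ t ≤ T) := by
    rcases h2.lt_or_eq with h | h
    · exact Or.inl h
    · exact Or.inr ⟨h, h1⟩
  simp only [appendArc, if_pos this]

theorem appendArc_of_mem_right (hmin : ∀ t j, (t, j) ∈ E' → T ≤ t) (hx : x' T 0 = x T N) {t : ℝ}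
    {j : ℕ} (hj : N ≤ j) (h : (t, j - N) ∈ E') : appendArc x T N x' t j = x' t (j - N) := by
  unfold appendArc
  split_ifs with hc
  · rcases hc with hc | ⟨rfl, hc⟩
    · omega
    · have : t = T := le_antisymm hc (hmin _ _ h)
      subst this
      rw [Nat.sub_self, hx]
  · rfl

theorem mem_of_mem_interior_timeSlice {t : ℝ} {j : ℕ} (h : t ∈ interior (timeSlice E j)) :
    (t, j) ∈ E :=
  show t ∈ timeSlice E j from interior_subset h

theorem timeSlice_append_of_lt {j : ℕ} (hj : j < N) :
    timeSlice (appendDomain E N E') j = timeSlice E j := by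
  ext t
  refine ⟨?_, fun h => Or.inl h⟩
  rintro (h | ⟨h, -⟩)
  · exact h
  · simp only at h; omega

theorem timeSlice_append_self :
    timeSlice (appendDomain E N E') N = timeSlice E N ∪ timeSlice E' 0 := by
  ext t
  simp [timeSlice, appendDomain]

theorem timeSlice_append_of_gt (hmax : ∀ t j, (t, j) ∈ E → t ≤ T ∧ j ≤ N) {j : ℕ} (hj : N < j) :
    timeSlice (appendDomain E N E') j = timeSlice E' (j - N) := by
  ext t
  refine ⟨?_, fun h => Or.inr ⟨hj.le, h⟩⟩
  rintro (h | ⟨-, h⟩)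
  · have := (hmax t j h).2; omega
  · exact h

/-- The derivative is prescribed as a function `d` of time and state, so the two arcs have the same
one-sided derivatives at the junction, where their states agree. -/
theorem hasDerivWithinAt_appendArc (hTN : (T, N) ∈ E)
    (hmax : ∀ t j, (t, j) ∈ E → t ≤ T ∧ j ≤ N) (hT' : (T, 0) ∈ E')
    (hmin : ∀ t j, (t, j) ∈ E' → T ≤ t) (hx : x' T 0 = x T N) {F : Type*} [NormedAddCommGroup F]
    [NormedSpace ℝ F] (φ : State → F) (d : ℝ → State → F)
    (h : ∀ t j, (t, j) ∈ E → HasDerivWithinAt (fun s => φ (x s j)) (d t (x t j)) (timeSlice E j) t)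
    (h' : ∀ t j, (t, j) ∈ E' →
      HasDerivWithinAt (fun s => φ (x' s j)) (d t (x' t j)) (timeSlice E' j) t)
    (t : ℝ) (j : ℕ) (ht : (t, j) ∈ appendDomain E N E') :
    HasDerivWithinAt (fun s => φ (appendArc x T N x' s j)) (d t (appendArc x T N x' t j))
      (timeSlice (appendDomain E N E') j) t := by
  have hl := fun {s j} (hs : (s, j) ∈ E) => appendArc_of_mem_left (x := x) (x' := x') hmax hs
  have hr := fun {s j} (hj : N ≤ j) (hs : (s, j - N) ∈ E') =>
    appendArc_of_mem_right (x := x) hmin hx hj hs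
  have ht' : t ∈ timeSlice (appendDomain E N E') j := ht
  rcases lt_trichotomy j N with hlt | rfl | hgt
  · rw [timeSlice_append_of_lt hlt] at ht' ⊢
    rw [hl ht']
    exact (h t j ht').congr (fun s hs => by rw [hl hs]) (by rw [hl ht'])
  · rw [timeSlice_append_self] at ht' ⊢
    refine hasDerivWithinAt_glue (f := fun s => φ (x s j)) (g := fun s => φ (x' s 0)) (T := T)
      (fun s hs => (hmax s j hs).1) (fun s hs => hmin s 0 hs) hTN hT' (fun s hs => by rw [hl hs])
      (fun s hs => ?_) (fun hs => ?_) (fun hs => ?_) ht'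
    · have := hr (s := s) (j := j) le_rfl (by rw [Nat.sub_self]; exact hs)
      simp only [this, Nat.sub_self]
    · rw [hl hs]; exact h t j hs
    · have := hr (s := t) (j := j) le_rfl (by rw [Nat.sub_self]; exact hs)
      rw [this, Nat.sub_self]; exact h' t 0 hs
  · rw [timeSlice_append_of_gt hmax hgt] at ht' ⊢
    rw [hr hgt.le ht']
    exact (h' t _ ht').congr (fun s hs => by rw [hr hgt.le hs]) (by rw [hr hgt.le ht'])

/-- Inverting `J` replaces an existential derivative by a function of time and state, the form that
gluing requires. -/
theorem IsSolution.dynamics_explicit (hJ : p.J.PosDef) (h : IsSolution p ref t₀ E x) (t : ℝ) (j : ℕ)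
    (ht : (t, j) ∈ E) : HasDerivWithinAt (fun s => (x s j).Ω)
      (p.J⁻¹ *ᵥ (control p ref t (x t j) - (x t j).Ω ⨯₃ (p.J *ᵥ (x t j).Ω))) (timeSlice E j) t := by
  obtain ⟨Ω', h1, h2⟩ := h.dynamics t j ht
  rwa [← h2, add_sub_cancel_right, Matrix.mulVec_mulVec, PosDef.inv_mul hJ, Matrix.one_mulVec]

/-- Solutions can be continued by solutions that start from their final state. -/
theorem IsSolution.append (hb : p.Orthonormal) (hJ : p.J.PosDef) (href : ref.IsAdmissible)
    (ht₀ : 0 ≤ t₀) (h : IsSolution p ref t₀ E x) (hTN : (T, N) ∈ E)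
    (hmax : ∀ t j, (t, j) ∈ E → t ≤ T ∧ j ≤ N) (h' : IsSolution p ref T E' x')
    (hx : x' T 0 = x T N) :
    IsSolution p ref t₀ (appendDomain E N E') (appendArc x T N x') := by
  have hT0 : 0 ≤ T := ht₀.trans (h.domain.initial_le hTN)
  have hT' : (T, 0) ∈ E' := h'.domain.initial_mem
  have hmin : ∀ t j, (t, j) ∈ E' → T ≤ t := fun t j ht => h'.domain.initial_le ht
  have hl := fun {s j} (hs : (s, j) ∈ E) => appendArc_of_mem_left (x := x) (x' := x') hmax hs
  have hr := fun {s j} (hj : N ≤ j) (hs : (s, j - N) ∈ E') =>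
    appendArc_of_mem_right (x := x) hmin hx hj hs
  have hcross : ∀ s t j, (s, j) ∈ E → N ≤ j → (t, j - N) ∈ E' →
      (x s j).m = (x' t (j - N)).m := by
    intro s t j hs hj ht
    have hjN : j = N := le_antisymm (hmax s j hs).2 hj
    subst hjN
    rw [Nat.sub_self] at ht ⊢
    rw [h.mode_const s T j hs hTN, ← hx]
    exact h'.mode_const T t 0 hT' ht
  refine ⟨h.domain.append hTN hmax h'.domain, ?_, ?_, ?_, ?_, ?_, ?_⟩
  · rintro t j (ht | ⟨hj, ht⟩)
    · rw [hl ht]; exact h.mem_SO3 t j ht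
    · rw [hr hj ht]; exact h'.mem_SO3 t _ ht
  · rintro s t j (hs | ⟨hj, hs⟩) (ht | ⟨hj', ht⟩)
    · rw [hl hs, hl ht]; exact h.mode_const s t j hs ht
    · rw [hl hs, hr hj' ht]; exact hcross s t j hs hj' ht
    · rw [hr hj hs, hl ht]; exact (hcross t s j ht hj hs).symm
    · rw [hr hj hs, hr hj' ht]; exact h'.mode_const s t _ hs ht
  · intro t j ht
    rcases lt_trichotomy j N with hlt | rfl | hgt
    · rw [timeSlice_append_of_lt hlt] at ht
      rw [hl (mem_of_mem_interior_timeSlice ht)]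
      exact h.mem_flowSet t j ht
    · rw [timeSlice_append_self] at ht
      have hr' : ∀ {s}, s ∈ timeSlice E' 0 → appendArc x T j x' s j = x' s 0 := fun {s} hs => by
        have := hr (s := s) (j := j) le_rfl (by rw [Nat.sub_self]; exact hs)
        rwa [Nat.sub_self] at this
      have hS : ∀ s ∈ timeSlice E j, s ≤ T := fun s hs => (hmax s j hs).1
      have hS' : ∀ s ∈ timeSlice E' 0, T ≤ s := fun s hs => hmin s 0 hs
      rcases lt_trichotomy t T with hlt | rfl | hgt
      · have hi : t ∈ interior (timeSlice E j) := by
          rw [mem_interior_iff_mem_nhds] at ht ⊢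
          filter_upwards [ht, Iio_mem_nhds hlt] with s hs hs'
          exact hs.resolve_right fun h2 => absurd (hS' s h2) (not_le.2 hs')
        rw [hl (mem_of_mem_interior_timeSlice hi)]
        exact h.mem_flowSet t j hi
      -- The junction can be interior to the merged slice and yet an endpoint of both pieces. The
      -- second piece then has nonempty interior, and closedness of the flow set along flows covers
      -- its initial point.
      · have hne : (interior (timeSlice E' 0)).Nonempty := by
          rw [mem_interior_iff_mem_nhds, mem_nhds_iff_exists_Ioo_subset] at ht
          obtain ⟨a, b, hab, hsub⟩ := ht
          obtain ⟨s, hs⟩ := exists_between hab.2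
          refine ⟨s, ?_⟩
          rw [mem_interior_iff_mem_nhds]
          filter_upwards [Ioo_mem_nhds hs.1 hs.2] with r hr
          exact (hsub ⟨hab.1.trans hr.1, hr.2⟩).resolve_left fun h2 =>
            absurd (hS r h2) (not_le.2 hr.1)
        rw [hr' hT']
        exact (h'.isFlow hT').mem_flowSet hb hJ href (fun s hs => hT0.trans (hS' s hs))
          (h'.domain.slice_ordConnected 0) hne (fun s hs => h'.mem_flowSet s 0 hs) hT'
      · have hi : t ∈ interior (timeSlice E' 0) := by
          rw [mem_interior_iff_mem_nhds] at ht ⊢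
          filter_upwards [ht, Ioi_mem_nhds hgt] with s hs hs'
          exact hs.resolve_left fun h2 => absurd (hS s h2) (not_le.2 hs')
        rw [hr' (interior_subset hi)]
        exact h'.mem_flowSet t 0 hi
    · rw [timeSlice_append_of_gt hmax hgt] at ht
      rw [hr hgt.le (mem_of_mem_interior_timeSlice ht)]
      exact h'.mem_flowSet t _ ht
  · intro t j ht a b
    exact hasDerivWithinAt_appendArc hTN hmax hT' hmin hx (fun y => y.R a b)
      (fun _ y => (y.R * hat y.Ω) a b) (fun t j ht => h.kinematics t j ht a b)
      (fun t j ht => h'.kinematics t j ht a b) t j ht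
  · intro t j ht
    refine ⟨_, hasDerivWithinAt_appendArc hTN hmax hT' hmin hx (fun y => y.Ω)
      (fun t y => p.J⁻¹ *ᵥ (control p ref t y - y.Ω ⨯₃ (p.J *ᵥ y.Ω)))
      (h.dynamics_explicit hJ) (h'.dynamics_explicit hJ) t j ht, ?_⟩
    rw [Matrix.mulVec_mulVec, PosDef.mul_inv hJ, Matrix.one_mulVec, sub_add_cancel]
  · have key : ∀ t j, N ≤ j → (t, j - N) ∈ E' → (t, j + 1 - N) ∈ E' →
        appendArc x T N x' t j ∈ jumpSet p ref t ∧
        (appendArc x T N x' t (j + 1)).R = (appendArc x T N x' t j).R ∧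
        (appendArc x T N x' t (j + 1)).Ω = (appendArc x T N x' t j).Ω ∧
        (appendArc x T N x' t (j + 1)).m ∈ jumpMap p ref t (appendArc x T N x' t j).R := by
      intro t j hj ht ht'
      rw [hr hj ht, hr (by omega) ht']
      rw [show j + 1 - N = j - N + 1 by omega] at ht' ⊢
      exact h'.jump t (j - N) ht ht'
    rintro t j (ht | ⟨hj, ht⟩) (ht' | ⟨hj', ht'⟩)
    · rw [hl ht, hl ht']; exact h.jump t j ht ht'
    · simp only at hj' ht'
      have htT : t = T := le_antisymm (hmax t j ht).1 (hmin _ _ ht')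
      subst htT
      have hjN := (hmax t j ht).2
      rcases hjN.lt_or_eq with hlt | rfl
      · have e : N = j + 1 := by omega
        subst e
        rw [hl ht, hl hTN]; exact h.jump t j ht hTN
      · exact key t j le_rfl (by simpa using hT') ht'
    · have := (hmax t _ ht').2
      simp only at hj
      omega
    · exact key t j hj ht ht'

end Append

end AttitudeTracking

end

noncomputable section

namespace AttitudeTracking

variable {p : Params} {ref : Reference}

/-! ### Dissipation along solutions -/

/-- A function that does not increase along flows and drops by `d` at jumps. -/
theorem IsSolution.dissipation {t₀ : ℝ} {E : Set (ℝ × ℕ)} {x : ℝ → ℕ → State}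
    (h : IsSolution p ref t₀ E x) {F : ℝ → State → ℝ} {d : ℝ}
    (hflow : ∀ j a b, a ≤ b → Set.Icc a b ⊆ timeSlice E j → F b (x b j) ≤ F a (x a j))
    (hjump : ∀ t j, (t, j) ∈ E → (t, j + 1) ∈ E → F t (x t (j + 1)) ≤ F t (x t j) - d)
    {s T : ℝ} {i N : ℕ} (hs : (s, i) ∈ E) (hT : (T, N) ∈ E) (hsT : s ≤ T) (hiN : i ≤ N) :
    F T (x T N) + ((N : ℝ) - i) * d ≤ F s (x s i) := by
  obtain ⟨τ, -, hτ, hiff⟩ := h.domain.truncation T N hT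
  have hmem : ∀ k ≤ N, ∀ t ∈ Set.Icc (τ k) (τ (k + 1)), (t, k) ∈ E := fun k hk t ht =>
    ((hiff t k).2 ⟨hk, ht⟩).1
  have hTe : τ (N + 1) = T :=
    le_antisymm ((hiff _ N).2 ⟨le_rfl, hτ N le_rfl, le_rfl⟩).2.1
      ((hiff T N).1 ⟨hT, le_rfl, le_rfl⟩).2.2
  have hsi := ((hiff s i).1 ⟨hs, hsT, hiN⟩).2
  have key : ∀ k, i ≤ k → k ≤ N →
      F (τ (k + 1)) (x (τ (k + 1)) k) + ((k : ℝ) - i) * d ≤ F s (x s i) := by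
    intro k hk
    induction k, hk using Nat.le_induction with
    | base =>
      intro _
      have := hflow i s (τ (i + 1)) hsi.2
        (fun t ht => hmem i hiN t ⟨hsi.1.trans ht.1, ht.2⟩)
      simpa using this
    | succ k hk ih =>
      intro hkN
      have h1 := ih (by omega)
      have hle := hτ (k + 1) hkN
      have h2 := hjump (τ (k + 1)) k (hmem k (by omega) _ ⟨hτ k (by omega), le_rfl⟩)
        (hmem (k + 1) hkN _ ⟨le_rfl, hle⟩)
      have h3 := hflow (k + 1) (τ (k + 1)) (τ (k + 1 + 1)) hle (fun t ht => hmem (k + 1) hkN t ht)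
      push_cast
      linarith
  have := key N hiN le_rfl
  rwa [hTe] at this

/-- The error energy of a state. -/
def stateEnergy (p : Params) (ref : Reference) (t : ℝ) (x : State) : ℝ :=
  energy p (frameInertia p) x.m (attErr p ref t x.R) (velErr p ref t x)

/-- The Lyapunov function of a state. -/
def stateLyapunov (p : Params) (ref : Reference) (κ t : ℝ) (x : State) : ℝ :=
  lyapunov p (frameInertia p) κ x.m (attErr p ref t x.R) (velErr p ref t x)

theorem velErr_congr {t : ℝ} {x y : State} (hR : y.R = x.R) (hΩ : y.Ω = x.Ω) :
    velErr p ref t y = velErr p ref t x := by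
  simp only [velErr, eΩ, hR, hΩ]

theorem stateEnergy_nonneg (hp : p.Tuned) (hb : p.Orthonormal) (hJ : p.J.PosDef) {t : ℝ}
    (hRd : ref.Rd t ∈ SO3) {x : State} (hR : x.R ∈ SO3) : 0 ≤ stateEnergy p ref t x :=
  energy_nonneg hp (frameInertia_posDef hb hJ) x.m (attErr_mem_SO3 hb hRd hR) _

theorem IsFlow.stateEnergy_le (hp : p.Tuned) (hb : p.Orthonormal) (hJ : p.J.PosDef)
    (href : ref.IsAdmissible) {m : Mode} {S : Set ℝ} (hS : S ⊆ Set.Ici 0) (hconv : Convex ℝ S)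
    {y : ℝ → State} (h : IsFlow p ref m S y) {a b : ℝ} (ha : a ∈ S) (hb' : b ∈ S) (hab : a ≤ b) :
    stateEnergy p ref b (y b) ≤ stateEnergy p ref a (y a) := by
  have := (h.isErrorFlow hb hJ href hS).energy_antitoneOn hp.kΩ_pos (frameInertia_posDef hb hJ)
    hconv ha hb' hab
  simpa only [stateEnergy, h.mode a ha, h.mode b hb'] using this

theorem jump_potential_le {t : ℝ} (hRd : ref.Rd t ∈ SO3) {x y : State}
    (hx : x ∈ jumpSet p ref t) (hm : y.m ∈ jumpMap p ref t x.R) :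
    modePotential p y.m (attErr p ref t x.R) ≤ modePotential p x.m (attErr p ref t x.R) - p.δ := by
  rw [mem_jumpSet_iff hRd] at hx
  rw [mem_jumpMap_iff hRd] at hm
  linarith

theorem stateEnergy_jump_le {t : ℝ} (hRd : ref.Rd t ∈ SO3) {x y : State}
    (hx : x ∈ jumpSet p ref t) (hR : y.R = x.R) (hΩ : y.Ω = x.Ω)
    (hm : y.m ∈ jumpMap p ref t x.R) : stateEnergy p ref t y ≤ stateEnergy p ref t x - p.δ := by
  have := jump_potential_le hRd hx hm
  simp only [stateEnergy, energy, velErr_congr hR hΩ, hR]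
  linarith

/-- Each jump costs the energy `δ`, so that the number of jumps is bounded. -/
theorem IsSolution.jumps_mul_le (hp : p.Tuned) (hb : p.Orthonormal) (hJ : p.J.PosDef)
    (href : ref.IsAdmissible) {t₀ : ℝ} (ht₀ : 0 ≤ t₀) {E : Set (ℝ × ℕ)} {x : ℝ → ℕ → State}
    (h : IsSolution p ref t₀ E x) {T : ℝ} {N : ℕ} (hT : (T, N) ∈ E) :
    N * p.δ ≤ stateEnergy p ref t₀ (x t₀ 0) := by
  have hpos : ∀ {t j}, (t, j) ∈ E → 0 ≤ t := fun ht => ht₀.trans (h.domain.initial_le ht)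
  have hdis := h.dissipation (F := stateEnergy p ref) (d := p.δ)
    (fun j a b hab hsub => by
      have ha := hsub (Set.left_mem_Icc.2 hab)
      exact ((h.isFlow ha).mono hsub).stateEnergy_le hp hb hJ href
        (fun t ht => hpos (hsub ht)) (convex_Icc a b) (Set.left_mem_Icc.2 hab)
        (Set.right_mem_Icc.2 hab) hab)
    (fun t j ht ht' => by
      obtain ⟨h1, h2, h3, h4⟩ := h.jump t j ht ht'
      exact stateEnergy_jump_le (href.mem_SO3 t (hpos ht)) h1 h2 h3 h4)
    h.domain.initial_mem hT (h.domain.initial_le hT) (Nat.zero_le _)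
  have hnn := stateEnergy_nonneg hp hb hJ (href.mem_SO3 T (hpos hT)) (h.mem_SO3 T N hT)
  simp only [Nat.cast_zero, sub_zero] at hdis
  linarith

/-! ### Existence and uniqueness of flows -/

theorem Reference.IsAdmissible.exists_refVel_bound (href : ref.IsAdmissible)
    (hb : p.Orthonormal) : ∃ B, 0 ≤ B ∧ ∀ t, 0 ≤ t → eucNorm (refVel p ref t) ≤ B := by
  obtain ⟨B, hB⟩ := href.bounded
  exact ⟨B, (eucNorm_nonneg _).trans (hB 0 le_rfl), fun t ht => by
    rw [eucNorm_refVel hb (href.mem_SO3 t ht)]; exact hB t ht⟩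

theorem exists_isFlow (hp : p.Tuned) (hb : p.Orthonormal) (hJ : p.J.PosDef)
    (href : ref.IsAdmissible) {t₁ : ℝ} (ht₁ : 0 ≤ t₁) {x₁ : State} (hx₁ : x₁.R ∈ SO3) :
    ∃ y, y t₁ = x₁ ∧ IsFlow p ref x₁.m (Set.Ici t₁) y := by
  obtain ⟨B, -, hB⟩ := href.exists_refVel_bound hb
  have hRd := href.mem_SO3 t₁ ht₁
  obtain ⟨P, e, hP, he, hf⟩ := exists_isErrorFlow hp (frameInertia_posDef hb hJ)
    (href.continuousOn_refVel p) hB x₁.m ht₁ (attErr_mem_SO3 hb hRd hx₁) (velErr p ref t₁ x₁)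
  refine ⟨_, ?_, hf.isFlow hb hJ href (Set.Ici_subset_Ici.2 ht₁)⟩
  rw [hP, he, errState_attErr_velErr hb hRd]

theorem IsFlow.eq (hp : p.Tuned) (hb : p.Orthonormal) (hJ : p.J.PosDef)
    (href : ref.IsAdmissible) {m : Mode} {a b : ℝ} (ha : 0 ≤ a) (hab : a ≤ b) {y z : ℝ → State}
    (hy : IsFlow p ref m (Set.Icc a b) y) (hz : IsFlow p ref m (Set.Icc a b) z)
    (hyz : y a = z a) : y b = z b := by
  obtain ⟨B, -, hB⟩ := href.exists_refVel_bound hb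
  have hS : Set.Icc a b ⊆ Set.Ici 0 := fun t ht => ha.trans ht.1
  have hbm : b ∈ Set.Icc a b := Set.right_mem_Icc.2 hab
  obtain ⟨h1, h2⟩ := (hy.isErrorFlow hb hJ href hS).eq hp (frameInertia_posDef hb hJ)
    (fun t ht => hB t (hS ht)) hab (hz.isErrorFlow hb hJ href hS) (by simp only [hyz])
    (by simp only [hyz])
  have hRd := href.mem_SO3 b (hS hbm)
  rw [← errState_attErr_velErr hb hRd (y b), ← errState_attErr_velErr hb hRd (z b), h1, h2,
    hy.mode b hbm, hz.mode b hbm]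

/-! ### Existence of complete solutions -/

theorem TimeUnbounded.append (E : Set (ℝ × ℕ)) (N : ℕ) {E' : Set (ℝ × ℕ)}
    (h : TimeUnbounded E') : TimeUnbounded (appendDomain E N E') := fun T => by
  obtain ⟨t, j, hmem, hle⟩ := h T
  exact ⟨t, j + N, Or.inr ⟨Nat.le_add_left _ _, by simpa using hmem⟩, hle⟩

/-- The energy is a budget for jumps: flow until the gap first reaches `δ`, jump at cost `δ`, and
continue from a state with a smaller budget. If the gap never exceeds `δ`, the flow alone is
complete. -/
theorem exists_unbounded_solution_of_energy_lt (hp : p.Tuned) (hb : p.Orthonormal)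
    (hJ : p.J.PosDef) (href : ref.IsAdmissible) (n : ℕ) :
    ∀ t₁, 0 ≤ t₁ → ∀ x₁ : State, x₁.R ∈ SO3 → stateEnergy p ref t₁ x₁ < n * p.δ →
      ∃ E x, IsSolution p ref t₁ E x ∧ x t₁ 0 = x₁ ∧ TimeUnbounded E := by
  induction n with
  | zero =>
    intro t₁ ht₁ x₁ hx₁ hlt
    have := stateEnergy_nonneg hp hb hJ (href.mem_SO3 t₁ ht₁) hx₁
    simp only [Nat.cast_zero, zero_mul] at hlt
    linarith
  | succ n ih =>
    intro t₁ ht₁ x₁ hx₁ hlt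
    obtain ⟨y, hy₁, hy⟩ := exists_isFlow hp hb hJ href ht₁ hx₁
    have hS : Set.Ici t₁ ⊆ Set.Ici 0 := Set.Ici_subset_Ici.2 ht₁
    have hcont := (hy.isErrorFlow hb hJ href hS).continuousOn_potentialGap
    set g : ℝ → ℝ := fun t => modePotential p x₁.m (attErr p ref t (y t).R)
      - minPotential p (attErr p ref t (y t).R) with hg
    have hflow : ∀ t, t₁ ≤ t → (y t ∈ flowSet p ref t ↔ g t ≤ p.δ) := fun t ht => by
      rw [mem_flowSet_iff (href.mem_SO3 t (hS ht)), hy.mode t ht]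
    by_cases hall : ∀ t, t₁ ≤ t → g t ≤ p.δ
    · refine ⟨Set.Ici t₁ ×ˢ {0}, fun t _ => y t, hy.isSolution Set.self_mem_Ici
        Set.ordConnected_Ici (fun t ht => ht)
        (fun t ht => (hflow t (interior_subset ht)).2 (hall t (interior_subset ht))), hy₁,
        fun T => ⟨max t₁ T, 0, ⟨Set.mem_Ici.2 (le_max_left t₁ T), rfl⟩, le_max_right _ _⟩⟩
    · push Not at hall
      obtain ⟨s, hs, hgs⟩ := hall
      -- Compactness provides a first time `T` at which the gap reaches `δ`; before it the flow
      -- stays in the flow set.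
      have hclosed : IsCompact (Set.Icc t₁ s ∩ g ⁻¹' Set.Ici p.δ) :=
        isCompact_Icc.of_isClosed_subset
          ((hcont.mono Set.Icc_subset_Ici_self).preimage_isClosed_of_isClosed isClosed_Icc
            isClosed_Ici) Set.inter_subset_left
      obtain ⟨T, ⟨⟨hT1, hTs⟩, hgT⟩, hleast⟩ := hclosed.exists_isLeast ⟨s, ⟨hs, le_rfl⟩, hgs.le⟩
      have hbefore : ∀ t, t₁ ≤ t → t < T → g t ≤ p.δ := fun t ht htT => by
        by_contra hc
        exact absurd (hleast ⟨⟨ht, htT.le.trans hTs⟩, (not_le.1 hc).le⟩) (not_le.2 htT)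
      have hT0 : 0 ≤ T := ht₁.trans hT1
      have hRd := href.mem_SO3 T hT0
      obtain ⟨m', hm'⟩ := exists_modePotential_eq_minPotential p (attErr p ref T (y T).R)
      have hjs : y T ∈ jumpSet p ref T := by
        rw [mem_jumpSet_iff hRd, hy.mode T hT1]; exact hgT
      have hjm : m' ∈ jumpMap p ref T (y T).R := (mem_jumpMap_iff hRd).2 hm'
      have hyT := hy.mem_SO3 T hT1
      have hdrop := stateEnergy_jump_le hRd hjs (y := ⟨(y T).R, (y T).Ω, m'⟩) rfl rfl hjm
      have hle := hy.stateEnergy_le hp hb hJ href hS (convex_Ici t₁) Set.self_mem_Ici hT1 hT1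
      rw [hy₁] at hle
      push_cast at hlt
      obtain ⟨E₂, x₂, hsol₂, hx₂, hunb⟩ := ih T hT0 ⟨(y T).R, (y T).Ω, m'⟩ hyT (by linarith)
      have hjump := isSolution_jump hJ (y' := ⟨(y T).R, (y T).Ω, m'⟩) hyT hjs rfl rfl hjm
      have hsol₃ := hjump.append hb hJ href hT0 (N := 1) (T := T) ⟨rfl, le_rfl⟩
        (fun t j ht => ⟨ht.1.le, ht.2⟩) hsol₂ (by simpa using hx₂)
      have hseg : IsSolution p ref t₁ (Set.Icc t₁ T ×ˢ {0}) (fun t _ => y t) := by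
        refine (hy.mono Set.Icc_subset_Ici_self).isSolution (Set.left_mem_Icc.2 hT1)
          Set.ordConnected_Icc (fun t ht => ht.1) fun t ht => ?_
        rw [interior_Icc] at ht
        exact (hflow t ht.1.le).2 (hbefore t ht.1.le ht.2)
      have hsol₄ := hseg.append hb hJ href ht₁ (N := 0) (T := T) ⟨Set.right_mem_Icc.2 hT1, rfl⟩
        (fun t j ht => ⟨ht.1.2, le_of_eq ht.2⟩) hsol₃
        (by simp [appendArc])
      refine ⟨_, _, hsol₄, ?_, TimeUnbounded.append _ _ (TimeUnbounded.append _ _ hunb)⟩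
      simp [appendArc, hT1, hy₁]

/-- From every state there is a solution for all future times. -/
theorem exists_unbounded_solution (hp : p.Tuned) (hb : p.Orthonormal) (hJ : p.J.PosDef)
    (href : ref.IsAdmissible) {t₁ : ℝ} (ht₁ : 0 ≤ t₁) {x₁ : State} (hx₁ : x₁.R ∈ SO3) :
    ∃ E x, IsSolution p ref t₁ E x ∧ x t₁ 0 = x₁ ∧ TimeUnbounded E := by
  obtain ⟨n, hn⟩ := exists_nat_gt (stateEnergy p ref t₁ x₁ / p.δ)
  rw [div_lt_iff₀ hp.δ_pos] at hn
  exact exists_unbounded_solution_of_energy_lt hp hb hJ href n t₁ ht₁ x₁ hx₁ hn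

/-! ### Maximal solutions -/

/-- The energy bounds the number of jumps, so a time-bounded domain has a last slice. Whether or not
that slice contains its supremum, the solution extends. -/
theorem IsMaximalSolution.timeUnbounded (hp : p.Tuned) (hb : p.Orthonormal) (hJ : p.J.PosDef)
    (href : ref.IsAdmissible) {t₀ : ℝ} (ht₀ : 0 ≤ t₀) {E : Set (ℝ × ℕ)} {x : ℝ → ℕ → State}
    (hmaxl : IsMaximalSolution p ref t₀ E x) : TimeUnbounded E := by
  obtain ⟨h, hext⟩ := hmaxl
  by_contra hbd
  unfold TimeUnbounded at hbd
  push Not at hbd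
  obtain ⟨Tb, hTb⟩ := hbd
  have hpos : ∀ {t j}, (t, j) ∈ E → 0 ≤ t := fun ht => ht₀.trans (h.domain.initial_le ht)
  -- the last interval of flow
  obtain ⟨N, ⟨r, hr⟩, hN⟩ : ∃ N, (∃ r, (r, N) ∈ E) ∧ ∀ t j, (t, j) ∈ E → j ≤ N := by
    classical
    obtain ⟨n, hn⟩ := exists_nat_gt (stateEnergy p ref t₀ (x t₀ 0) / p.δ)
    rw [div_lt_iff₀ hp.δ_pos] at hn
    have hub : ∀ t j, (t, j) ∈ E → j ≤ n := fun t j ht => by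
      have h1 := h.jumps_mul_le hp hb hJ href ht₀ ht
      have h2 : (j : ℝ) < n := lt_of_mul_lt_mul_right (h1.trans_lt hn) hp.δ_pos.le
      exact_mod_cast h2.le
    refine ⟨Nat.findGreatest (fun k => ∃ r, (r, k) ∈ E) n,
      Nat.findGreatest_spec (P := fun k => ∃ r, (r, k) ∈ E) (Nat.zero_le _)
        ⟨t₀, h.domain.initial_mem⟩, fun t j ht => Nat.le_findGreatest (hub t j ht) ⟨t, ht⟩⟩
  have hbdd : BddAbove (timeSlice E N) := ⟨Tb, fun t ht => (hTb t N ht).le⟩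
  have hne : (timeSlice E N).Nonempty := ⟨r, hr⟩
  set T := sSup (timeSlice E N) with hTdef
  have hleT : ∀ t ∈ timeSlice E N, t ≤ T := fun t ht => le_csSup hbdd ht
  by_cases hTmem : (T, N) ∈ E
  -- Supremum attained: a complete solution can be appended to the final state.
  · have hmax : ∀ t j, (t, j) ∈ E → t ≤ T ∧ j ≤ N := fun t j ht => by
      refine ⟨?_, hN t j ht⟩
      rcases (hN t j ht).lt_or_eq with hlt | rfl
      · exact h.domain.ordered t j T N ht hTmem hlt
      · exact hleT t ht
    obtain ⟨E', x', hsol', hx', hunb⟩ := exists_unbounded_solution hp hb hJ href (hpos hTmem)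
      (h.mem_SO3 T N hTmem)
    have happ := h.append hb hJ href ht₀ hTmem hmax hsol' hx'
    have heq := hext _ _ happ Set.subset_union_left
      (fun t j ht => appendArc_of_mem_left hmax ht)
    obtain ⟨t, j, hmem, hle⟩ := TimeUnbounded.append E N hunb Tb
    rw [heq] at hmem
    exact absurd (hTb t j hmem) (not_lt.2 hle)
  -- Supremum not attained: the flow restarted at `r` exists beyond `T` and coincides with `x`
  -- before it, so `(T, N)` can be added. The flow condition concerns interior times only and asks
  -- nothing at `T`.
  · have hrT : r < T := lt_of_le_of_ne (hleT r hr) fun heq => hTmem (heq ▸ hr)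
    have hIco : ∀ t, r ≤ t → t < T → (t, N) ∈ E := fun t h1 h2 => by
      obtain ⟨s, hs, hts⟩ := exists_lt_of_lt_csSup hne h2
      exact (h.domain.slice_ordConnected N).out hr hs ⟨h1, hts.le⟩
    obtain ⟨y, hy₁, hy⟩ := exists_isFlow hp hb hJ href (hpos hr) (h.mem_SO3 r N hr)
    have hagree : ∀ t, r ≤ t → t < T → y t = x t N := fun t h1 h2 => by
      have hsub : Set.Icc r t ⊆ timeSlice E N := fun s hs => hIco s hs.1 (hs.2.trans_lt h2)
      exact IsFlow.eq hp hb hJ href (hpos hr) h1 (hy.mono Set.Icc_subset_Ici_self)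
        ((h.isFlow hr).mono hsub) hy₁
    have hseg : IsSolution p ref r (Set.Icc r T ×ˢ {0}) (fun t _ => y t) := by
      refine (hy.mono Set.Icc_subset_Ici_self).isSolution (Set.left_mem_Icc.2 hrT.le)
        Set.ordConnected_Icc (fun t ht => ht.1) fun t ht => ?_
      rw [interior_Icc] at ht
      rw [hagree t ht.1.le ht.2]
      refine h.mem_flowSet t N ?_
      rw [mem_interior_iff_mem_nhds]
      filter_upwards [Ioo_mem_nhds ht.1 ht.2] with s hs
      exact hIco s hs.1.le hs.2
    have hmax : ∀ t j, (t, j) ∈ truncDomain E r N → t ≤ r ∧ j ≤ N := fun t j ht => ht.2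
    have hrmem : (r, N) ∈ truncDomain E r N := ⟨hr, le_rfl, le_rfl⟩
    have happ := (h.trunc hr).append hb hJ href ht₀ hrmem hmax hseg hy₁
    have hcases : ∀ t j, (t, j) ∈ E →
        (t, j) ∈ truncDomain E r N ∨ (j = N ∧ r ≤ t ∧ t < T) := fun t j ht => by
      rcases (hN t j ht).lt_or_eq with hlt | rfl
      · exact Or.inl ⟨ht, h.domain.ordered t j r N ht hr hlt, hlt.le⟩
      · rcases le_total t r with hle | hle
        · exact Or.inl ⟨ht, hle, le_rfl⟩
        · exact Or.inr ⟨rfl, hle, lt_of_le_of_ne (hleT t ht) fun heq => hTmem (heq ▸ ht)⟩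
    have heq := hext _ _ happ
      (by
        rintro ⟨t, j⟩ ht
        rcases hcases t j ht with h1 | ⟨rfl, h1, h2⟩
        · exact Or.inl h1
        · exact Or.inr ⟨le_rfl, ⟨h1, h2.le⟩, by simp⟩)
      (by
        intro t j ht
        rcases hcases t j ht with h1 | ⟨rfl, h1, h2⟩
        · exact appendArc_of_mem_left hmax h1
        · rw [appendArc_of_mem_right (fun s i hs => hseg.domain.initial_le hs) hy₁ le_rfl
            (show (t, j - j) ∈ Set.Icc r T ×ˢ {0} from ⟨⟨h1, h2.le⟩, by simp⟩)]
          exact hagree t h1 h2)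
    have hTin : (T, N) ∈ appendDomain (truncDomain E r N) N (Set.Icc r T ×ˢ {0}) :=
      Or.inr ⟨le_rfl, ⟨hrT.le, le_rfl⟩, by simp⟩
    rw [heq] at hTin
    exact hTmem hTin

/-! ### Exponential decay -/

/-- With the factor `exp (r * t)` the decay rate becomes monotonicity along flows, and jumps do not
increase the Lyapunov function. -/
theorem IsSolution.exp_mul_stateLyapunov_le (hb : p.Orthonormal)
    (hJ : p.J.PosDef) (href : ref.IsAdmissible) {B κ r : ℝ}
    (hB : ∀ t, 0 ≤ t → eucNorm (refVel p ref t) ≤ B)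
    (hw : IsLyapunovWeight p (frameInertia p) B κ r) {t₀ : ℝ} (ht₀ : 0 ≤ t₀) {E : Set (ℝ × ℕ)}
    {x : ℝ → ℕ → State} (h : IsSolution p ref t₀ E x) {s T : ℝ} {i N : ℕ} (hs : (s, i) ∈ E)
    (hT : (T, N) ∈ E) (hsT : s ≤ T) (hiN : i ≤ N) :
    Real.exp (r * T) * stateLyapunov p ref κ T (x T N) ≤
      Real.exp (r * s) * stateLyapunov p ref κ s (x s i) := by
  have hK := frameInertia_posDef hb hJ
  have hpos : ∀ {t j}, (t, j) ∈ E → 0 ≤ t := fun ht => ht₀.trans (h.domain.initial_le ht)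
  have hdis := h.dissipation (d := 0)
    (F := fun t y => Real.exp (r * t) * stateLyapunov p ref κ t y)
    (fun j a b hab hsub => by
      have ha := hsub (Set.left_mem_Icc.2 hab)
      have hS : Set.Icc a b ⊆ Set.Ici 0 := fun t ht => hpos (hsub ht)
      have hfl := (h.isFlow ha).mono hsub
      have hef := hfl.isErrorFlow hb hJ href hS
      have hd : ∀ t ∈ Set.Icc a b, HasDerivWithinAt
          (fun t => Real.exp (r * t) * lyapunov p (frameInertia p) κ (x a j).m
            (attErr p ref t (x t j).R) (velErr p ref t (x t j)))
          (Real.exp (r * t) * r * lyapunov p (frameInertia p) κ (x a j).m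
            (attErr p ref t (x t j).R) (velErr p ref t (x t j)) + Real.exp (r * t) *
            lyapunovRate p (frameInertia p) κ (x a j).m (refVel p ref t)
              (attErr p ref t (x t j).R) (velErr p ref t (x t j))) (Set.Icc a b) t := by
        intro t ht
        have h1 : HasDerivWithinAt (fun t => Real.exp (r * t)) (Real.exp (r * t) * r)
            (Set.Icc a b) t := by
          simpa using (((hasDerivAt_id t).const_mul r).exp).hasDerivWithinAt
        exact h1.fun_mul (hasDerivWithinAt_lyapunov p hK κ (x a j).m (hef.kinematics t ht)
          (hef.dynamics t ht))
      have hanti := antitoneOn_of_hasDerivWithinAt_nonpos (convex_Icc a b)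
        (fun t ht => (hd t ht).continuousWithinAt)
        (fun t ht => (hd t (interior_subset ht)).mono interior_subset) (fun t ht => by
          have htm : t ∈ Set.Icc a b := interior_subset ht
          have hfs := h.mem_flowSet t j (interior_mono hsub ht)
          rw [mem_flowSet_iff (href.mem_SO3 t (hS htm)), hfl.mode t htm] at hfs
          have hdec := hw.decay (x a j).m _ (hef.mem_SO3 t htm) (velErr p ref t (x t j))
            (refVel p ref t) (hB t (hS htm)) hfs
          have := mul_le_mul_of_nonneg_left hdec (Real.exp_pos (r * t)).le
          linarith)
      have := hanti (Set.left_mem_Icc.2 hab) (Set.right_mem_Icc.2 hab) hab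
      simpa only [stateLyapunov, hfl.mode b (Set.right_mem_Icc.2 hab)] using this)
    (fun t j ht ht' => by
      obtain ⟨h1, h2, h3, h4⟩ := h.jump t j ht ht'
      have hRd := href.mem_SO3 t (hpos ht)
      have hj := hw.jump (x t j).m (x t (j + 1)).m _
        (attErr_mem_SO3 hb hRd (h.mem_SO3 t j ht)) (velErr p ref t (x t j))
        (jump_potential_le hRd h1 h4)
      have := mul_le_mul_of_nonneg_left hj (Real.exp_pos (r * t)).le
      simpa only [stateLyapunov, velErr_congr h2 h3, h2, sub_zero] using this)
    hs hT hsT hiN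
  simpa using hdis

theorem frobNorm_nonneg (A : Mat3) : 0 ≤ frobNorm A := Real.sqrt_nonneg _

theorem exists_trackingError_sq_le (hp : p.Tuned) (hb : p.Orthonormal) (hJ : p.J.PosDef)
    (href : ref.IsAdmissible) :
    ∃ A > 0, ∀ t, 0 ≤ t → ∀ x : State, x.R ∈ SO3 →
      trackingError ref t x ^ 2 ≤ A * stateEnergy p ref t x := by
  obtain ⟨C, hC, hCt⟩ := exists_trace_le_modePotential hp
  obtain ⟨l, hl, hlow⟩ := PosDef.exists_lower_bound (frameInertia_posDef hb hJ)
  refine ⟨4 * C + 4 / l, by positivity, fun t ht x hx => ?_⟩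
  have hRd := href.mem_SO3 t ht
  have hP := attErr_mem_SO3 hb hRd hx
  have hf := frobNorm_sq hb hRd hx
  have ha := eucNorm_sq (velErr p ref t x)
  rw [eucNorm_velErr hb hx] at ha
  have h1 := hCt x.m _ hP
  have h2 := hlow (velErr p ref t x)
  have hkin : velErr p ref t x ⬝ᵥ velErr p ref t x ≤
      2 / l * kinetic (frameInertia p) (velErr p ref t x) := by
    rw [div_mul_eq_mul_div, le_div_iff₀ hl, kinetic]; linarith
  have n1 := mul_nonneg hC.le
    (kinetic_nonneg (frameInertia_posDef hb hJ) (velErr p ref t x))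
  have n2 : 0 ≤ 1 / l * modePotential p x.m (attErr p ref t x.R) :=
    mul_nonneg (by positivity) (modePotential_nonneg hp x.m hP)
  have e1 : 4 / l * modePotential p x.m (attErr p ref t x.R) =
    4 * (1 / l * modePotential p x.m (attErr p ref t x.R)) := by ring
  have e2 : 4 / l * kinetic (frameInertia p) (velErr p ref t x) =
    2 * (2 / l * kinetic (frameInertia p) (velErr p ref t x)) := by ring
  rw [trackingError, stateEnergy, energy, mul_add, add_mul, add_mul, e1, e2]
  nlinarith [sq_nonneg (frobNorm (x.R - ref.Rd t) - eucNorm (x.R *ᵥ x.Ω - ref.ωd t))]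

/-- Membership in the flow set is essential: an expelling mode at zero tracking error has positive
energy. -/
theorem exists_stateEnergy_le (hp : p.Tuned) (hb : p.Orthonormal) (href : ref.IsAdmissible) :
    ∃ A > 0, ∀ t, 0 ≤ t → ∀ x : State, x.R ∈ SO3 → x ∈ flowSet p ref t →
      stateEnergy p ref t x ≤ A * trackingError ref t x ^ 2 := by
  obtain ⟨C, hC, hCt⟩ := exists_modePotential_le_trace hp
  obtain ⟨L, hL0, hL⟩ := exists_eucNorm_mulVec_le (frameInertia p)
  refine ⟨C + L, by positivity, fun t ht x hx hfs => ?_⟩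
  have hRd := href.mem_SO3 t ht
  have hf := frobNorm_sq hb hRd hx
  rw [mem_flowSet_iff hRd] at hfs
  have h1 := hCt x.m _ (attErr_mem_SO3 hb hRd hx) hfs
  have h2 := (le_abs_self _).trans
    (abs_dotProduct_le (velErr p ref t x) (frameInertia p *ᵥ velErr p ref t x))
  have h3 := mul_le_mul_of_nonneg_left (hL (velErr p ref t x))
    (eucNorm_nonneg (velErr p ref t x))
  have h4 := h2.trans h3
  rw [eucNorm_velErr hb hx] at h4
  have nf := frobNorm_nonneg (x.R - ref.Rd t)
  have na := eucNorm_nonneg (x.R *ᵥ x.Ω - ref.ωd t)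
  rw [trackingError, stateEnergy, energy, kinetic]
  set f := frobNorm (x.R - ref.Rd t)
  set a := eucNorm (x.R *ᵥ x.Ω - ref.ωd t)
  have m1 : C * f ^ 2 ≤ C * (f + a) ^ 2 := by gcongr; linarith
  have m2 : L * a ^ 2 ≤ L * (f + a) ^ 2 := by gcongr; linarith
  nlinarith [mul_nonneg hC.le (sq_nonneg f), mul_nonneg hL0.le (sq_nonneg a)]

theorem exists_exponential_bound (hp : p.Tuned) (hb : p.Orthonormal) (hJ : p.J.PosDef)
    (href : ref.IsAdmissible) :
    ∃ M > 0, ∃ lam > 0, ∀ t₀, 0 ≤ t₀ → ∀ E x, IsSolution p ref t₀ E x → ∀ t j, (t, j) ∈ E →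
      trackingError ref t (x t j) ≤
        M * Real.exp (-lam * (t - t₀)) * trackingError ref t₀ (x t₀ 0) := by
  obtain ⟨B, hB0, hB⟩ := href.exists_refVel_bound hb
  obtain ⟨κ, -, r, hr, hw⟩ := exists_isLyapunovWeight hp (frameInertia_posDef hb hJ) hB0
  obtain ⟨A₁, hA₁, hlow⟩ := exists_trackingError_sq_le hp hb hJ href
  obtain ⟨A₂, hA₂, hup⟩ := exists_stateEnergy_le hp hb href
  -- The `4` comes from comparing energy and Lyapunov function at both ends, a factor 2 each; the `+
  -- 1` makes `M ≥ 1`, needed for a solution that has not moved.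
  refine ⟨Real.sqrt (4 * A₁ * A₂) + 1, by positivity, r / 2, by positivity,
    fun t₀ ht₀ E x h T N hT => ?_⟩
  have herr : ∀ t y, 0 ≤ trackingError ref t y := fun t y =>
    add_nonneg (frobNorm_nonneg _) (eucNorm_nonneg _)
  have h00 := h.domain.initial_mem
  have hpos : ∀ {t j}, (t, j) ∈ E → 0 ≤ t := fun ht => ht₀.trans (h.domain.initial_le ht)
  have hT₀ := h.domain.initial_le hT
  set M := Real.sqrt (4 * A₁ * A₂) + 1 with hM
  have hM1 : 1 ≤ M := by rw [hM]; linarith [Real.sqrt_nonneg (4 * A₁ * A₂)]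
  have hM2 : 4 * A₁ * A₂ ≤ M ^ 2 := by
    rw [hM]; nlinarith [Real.sq_sqrt (show 0 ≤ 4 * A₁ * A₂ by positivity),
      Real.sqrt_nonneg (4 * A₁ * A₂)]
  -- decay from a state at time `t₀` in the flow set
  have key : ∀ i ≤ N, (t₀, i) ∈ E → x t₀ i ∈ flowSet p ref t₀ →
      trackingError ref T (x T N) ≤
        M * Real.exp (-(r / 2) * (T - t₀)) * trackingError ref t₀ (x t₀ i) := by
    intro i hi hti hfs
    have hdec := h.exp_mul_stateLyapunov_le hb hJ href hB hw ht₀ hti hT hT₀ hi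
    have hR := h.mem_SO3 T N hT
    have hR₀ := h.mem_SO3 t₀ i hti
    have h1 := hlow T (hpos hT) (x T N) hR
    have h2 := hup t₀ ht₀ (x t₀ i) hR₀ hfs
    have h3 := hw.lower (x T N).m _ (attErr_mem_SO3 hb (href.mem_SO3 T (hpos hT)) hR)
      (velErr p ref T (x T N))
    have h4 := hw.upper (x t₀ i).m _ (attErr_mem_SO3 hb (href.mem_SO3 t₀ ht₀) hR₀)
      (velErr p ref t₀ (x t₀ i))
    change stateEnergy p ref T (x T N) ≤ 2 * stateLyapunov p ref κ T (x T N) at h3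
    change stateLyapunov p ref κ t₀ (x t₀ i) ≤ 2 * stateEnergy p ref t₀ (x t₀ i) at h4
    have h5 : stateLyapunov p ref κ T (x T N) ≤
        Real.exp (-(r / 2) * (T - t₀)) ^ 2 * stateLyapunov p ref κ t₀ (x t₀ i) := by
      have e1 : Real.exp (-(r / 2) * (T - t₀)) ^ 2 =
          (Real.exp (r * T))⁻¹ * Real.exp (r * t₀) := by
        rw [← Real.exp_neg, ← Real.exp_add, ← Real.exp_nat_mul]
        congr 1
        push_cast
        ring
      rw [e1, mul_assoc, le_inv_mul_iff₀ (Real.exp_pos _)]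
      exact hdec
    refine le_of_sq_le_sq ?_ (by have := herr t₀ (x t₀ i); positivity)
    set q := Real.exp (-(r / 2) * (T - t₀)) ^ 2 with hq
    have hq0 : 0 ≤ q := sq_nonneg _
    set e₀ := trackingError ref t₀ (x t₀ i) ^ 2 with he₀
    have he₀0 : 0 ≤ e₀ := sq_nonneg _
    calc trackingError ref T (x T N) ^ 2 ≤ A₁ * stateEnergy p ref T (x T N) := h1
      _ ≤ A₁ * (2 * (q * (2 * (A₂ * e₀)))) := by
        gcongr
        refine h3.trans ?_
        gcongr
        refine h5.trans ?_
        gcongr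
        refine h4.trans ?_
        gcongr
      _ = 4 * A₁ * A₂ * (q * e₀) := by ring
      _ ≤ M ^ 2 * (q * e₀) := by gcongr
      _ = _ := by rw [hq, he₀]; ring
  obtain ⟨τ, h0, hτ, hiff⟩ := h.domain.truncation T N hT
  have hle := hτ 0 (Nat.zero_le _)
  rw [h0, zero_add] at hle
  rcases hle.lt_or_eq with hlt | heq
  -- A first slice of positive length places the initial state in the flow set, by closedness.
  · refine key 0 (Nat.zero_le _) h00 ?_
    have hsub : Set.Icc t₀ (τ 1) ⊆ timeSlice E 0 := fun t ht =>
      ((hiff t 0).2 ⟨Nat.zero_le _, by rw [h0]; exact ht⟩).1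
    refine (h.isFlow h00).mem_flowSet hb hJ href (fun t ht => hpos ht)
      (h.domain.slice_ordConnected 0) ?_ (fun t ht => h.mem_flowSet t 0 ht) h00
    have : (interior (Set.Icc t₀ (τ 1))).Nonempty := by
      rw [interior_Icc]; exact Set.nonempty_Ioo.2 hlt
    exact this.mono (interior_mono hsub)
  -- The solution does not flow before its first jump. Either the final point is the initial one, or
  -- the jump occurs at `t₀`; it brings the gap to zero and keeps the tracking error, so decay
  -- starts from index 1.
  · rcases Nat.eq_zero_or_pos N with rfl | hN
    · have hTe := ((hiff T 0).1 ⟨hT, le_rfl, le_rfl⟩).2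
      rw [h0, zero_add, ← heq] at hTe
      have : T = t₀ := le_antisymm hTe.2 hTe.1
      subst this
      simp only [sub_self, mul_zero, Real.exp_zero, mul_one]
      exact le_mul_of_one_le_left (herr _ _) hM1
    · have h01 : (t₀, 1) ∈ E := by
        refine ((hiff t₀ 1).2 ⟨hN, heq.ge, ?_⟩).1
        rw [heq]
        exact hτ 1 hN
      obtain ⟨-, h2, h3, h4⟩ := h.jump t₀ 0 h00 h01
      rw [zero_add] at h2 h3 h4
      have hRd := href.mem_SO3 t₀ ht₀
      have hk := key 1 hN h01 (by
        rw [mem_flowSet_iff hRd, h2, (mem_jumpMap_iff hRd).1 h4, sub_self]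
        exact hp.δ_pos.le)
      have e : trackingError ref t₀ (x t₀ 1) = trackingError ref t₀ (x t₀ 0) := by
        simp only [trackingError, h2, h3]
      rwa [e] at hk

end AttitudeTracking

end

theorem proposition3 (p : AttitudeTracking.Params) (ref : AttitudeTracking.Reference)
    (href : ref.IsAdmissible)
    (hJ : p.J.PosDef)
    (hb₁ : p.b₁ ⬝ᵥ p.b₁ = 1) (hb₂ : p.b₂ ⬝ᵥ p.b₂ = 1) (hb : p.b₁ ⬝ᵥ p.b₂ = 0)
    (hk₁ : 0 < p.k₁) (hk₂ : 0 < p.k₂) (hk : p.k₁ ≠ p.k₂) (hkΩ : 0 < p.kΩ)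
    (hα₁ : 1 < p.α) (hα₂ : p.α < 2)
    (hβ₀ : p.β ≠ 0) (hβ : |p.β| < p.α - 1)
    (hδ₀ : 0 < p.δ) (hδ : p.δ < min p.k₁ p.k₂ * min (2 - p.α) (p.α - |p.β| - 1)) :
    AttitudeTracking.GloballyExponentiallyStable p ref := by
  have hp : p.Tuned := ⟨hk₁, hk₂, hk, hkΩ, hα₁, hα₂, hβ₀, hβ, hδ₀, hδ⟩
  have ho : p.Orthonormal := ⟨hb₁, hb₂, hb⟩
  exact ⟨fun t₀ ht₀ x₀ hx₀ => AttitudeTracking.exists_unbounded_solution hp ho hJ href ht₀ hx₀,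
    fun t₀ ht₀ E x h => h.timeUnbounded hp ho hJ href ht₀,
    AttitudeTracking.exists_exponential_bound hp ho hJ href⟩
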